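/- **Setting (multi-spell MPH model with feedback and lagged duration dependence).** Let $T\ge 2$. Spells $Y_1,\dots,Y_T$ take values in $(0,\infty)$, $Y_0\in\mathbb R$ is an initial duration, $X_1,\dots,X_T\in\mathbb R^d$ are regressors, and $A\in\mathbb R$ is latent heterogeneity. Superscripts denote histories: $y^t=(y_0,\dots,y_t)$, $x^t=(x_1,\dots,x_t)$, $x^{s:T}=(x_s,\dots,x_T)$. Let $\theta=(\alpha,\beta,\gamma)$, let $\lambda_\alpha$ be a known baseline hazard that is positive on $(0,\infty)$, with $\Lambda_\alpha(y)=\int_0^y\lambda_\alpha(u)\,du<\infty$ for all $y>0$ and $\Lambda_\alpha(y)\to\infty$ as $y\to\infty$, and put, for $z_t=(y_t,y_{t-1},x_t)$, $$\rho_\theta(z_t)=\Lambda_\alpha(y_t)e^{\gamma y_{t-1}+x_t'\beta},\qquad f_\theta(y_t\mid y_{t-1},x_t,a)=\lambda_\alpha(y_t)\,e^{\gamma y_{t-1}+x_t'\beta+a}\,e^{-\rho_\theta(z_t)e^a}.$$ For nuisance parameters $\omega=(g,\pi,\nu)\in\Omega$, the joint density of $(Y_0,\dots,Y_T,X_1,\dots,X_T,A)$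 is $$\prod_{t=1}^T f_\theta(y_t\mid y_{t-1},x_t,a)\ \prod_{t=2}^T g(x_t\mid y^{t-1},x^{t-1},a)\ \pi(a\mid y_0,x_1)\ \nu(y_0,x_1).$$ Here $g$, $\pi$, $\nu$ are (conditional) densities, with respect to Lebesgue measure for $A$ and the spells and with respect to fixed $\sigma$-finite dominating measures for $Y_0$ and each $X_t$. They are unrestricted except that all $\omega\in\Omega$ have the same support: $(Y_0,X_1,A)$ has a given support set $\mathcal S$ (on which $\nu\pi>0$), and $g>0$ on the support of the dominating measure of $X_t$, for $t\ge2$. Define $$\widetilde P_{\theta,t}=\frac{\rho_\theta(Z_t)}{\sum_{s=t}^T\rho_\theta(Z_s)}\ (t=1,\dots,T-1),\qquad \overline P_\theta=\sum_{t=1}^T\rho_\theta(Z_t),\qquad \widetilde P_\theta^{t}=(\widetilde P_{\theta,1},\dots,\widetilde P_{\theta,t}),$$ with $\widetilde P_\theta^{0}$ empty. **Lemma.** Let $\omega^*\in\Omega$ and let $\phi_\theta(Y^T,X^T)$ be real-valued and absolutely integrable under $(\theta,\omega^*)$. Then $\phi_\theta$ satisfies 1. (heterogeneity robustness) $\displaystyle\int\phi_\theta(y^T,x^T)\prod_{t=1}^Tf_\theta(y_t\mid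 y_{t-1},x_t,a)\,dy_T\cdots dy_1=0$, and 2. (feedback robustness) for all $s=2,\dots,T$, $\displaystyle\int\phi_\theta(y^T,x^T)\prod_{t=s}^Tf_\theta(y_t\mid y_{t-1},x_t,a)\,dy_T\cdots dy_s$ does not depend on $x^{s:T}$, i.e. is a function of $(y^{s-1},x^{s-1},a)$, (iterated integrals, $y_T$ innermost; both conditions almost everywhere on the common support) if and only if there exist functions $\psi_{\theta,t}$, $t=1,\dots,T-1$, absolutely integrable under $(\theta,\omega^*)$, such that almost surely $$\phi_\theta(Y^T,X^T)=\sum_{t=1}^{T-1}\psi_{\theta,t}\big(Y_0,\widetilde P_\theta^{t},\overline P_\theta,X^t\big),$$ where, for $t=1,\dots,T-1$, under $(\theta,\omega^*)$, $$\mathbb E\big[\psi_{\theta,t}(Y_0,\widetilde P_\theta^{t},\overline P_\theta,X^t)\,\big|\,Y_0,\widetilde P_\theta^{t-1},\overline P_\theta,X^t\big]=0.$$ -/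

import Mathlib

open MeasureTheory

namespace MPH

/-!  Index conventions. A unit is a triple `(y, x, a)` with `y : Fin (T + 1) → ℝ` holding
`Y_0, …, Y_T`, with `x : Fin T → (Fin d → ℝ)` holding `X_1, …, X_T`, and `a : ℝ` the latent
heterogeneity `A`. An index `t : Fin T` stands for the period `t + 1`: its outcome is `y t.succ`,
its lagged outcome is `y t.castSucc`, and its regressor is `x t`. -/

/-- The first `k` entries of a finite sequence. -/
def take {E : Type*} {n k : ℕ} (h : k ≤ n) (v : Fin n → E) : Fin k → E :=
  fun i => v (Fin.castLE h i)

/-- The common parameter `θ = (α, β, γ)`. -/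
structure Param (m d : ℕ) where
  /-- parameter of the baseline hazard -/
  α : Fin m → ℝ
  /-- coefficients of the regressors -/
  β : Fin d → ℝ
  /-- coefficient of the lagged duration -/
  γ : ℝ

/-- A baseline hazard on `(0, ∞)`: positive, with an integrated hazard that is finite at every
duration and tends to infinity (every spell ends). -/
structure IsBaselineHazard (lam : ℝ → ℝ) : Prop where
  measurable : Measurable lam
  pos : ∀ u : ℝ, 0 < u → 0 < lam u
  integrable : ∀ y : ℝ, 0 < y → IntervalIntegrable lam volume 0 y
  tendsto : Filter.Tendsto (fun y : ℝ => ∫ u in (0 : ℝ)..y, lam u) Filter.atTop Filter.atTop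

/-- The generalized residual `ρ_θ(z_t) = Λ_α(y_t) exp (γ y_{t-1} + x_t' β)`, where
`Λ_α(y) = ∫_0^y λ_α(u) du`. -/
noncomputable def rho {m d : ℕ} (lam : (Fin m → ℝ) → ℝ → ℝ) (θ : Param m d)
    (y ylag : ℝ) (x : Fin d → ℝ) : ℝ :=
  (∫ u in (0 : ℝ)..y, lam θ.α u) * Real.exp (θ.γ * ylag + dotProduct x θ.β)

/-- The conditional density `f_θ(y_t | y_{t-1}, x_t, a)` of a spell on `(0, ∞)`. -/
noncomputable def density {m d : ℕ} (lam : (Fin m → ℝ) → ℝ → ℝ) (θ : Param m d)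
    (y ylag : ℝ) (x : Fin d → ℝ) (a : ℝ) : ℝ :=
  lam θ.α y * Real.exp (θ.γ * ylag + dotProduct x θ.β + a)
    * Real.exp (-(rho lam θ y ylag x * Real.exp a))

/-- The dominating measures of the model and the support shared by all nuisance parameters.
`μ0` dominates `Y_0` and `μX t` dominates the regressor of the period with index `t` (each may be
Lebesgue measure, a counting measure, a restriction of these to a subset, …); spells and
heterogeneity have Lebesgue densities. `supp` is the common support of `(Y_0, X_1, A)`. -/
structure Design (T d : ℕ) where
  μ0 : Measure ℝ
  μX : Fin T → Measure (Fin d → ℝ)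
  sigmaFinite_μ0 : SigmaFinite μ0
  sigmaFinite_μX : ∀ t, SigmaFinite (μX t)
  supp : Set (ℝ × (Fin d → ℝ) × ℝ)
  measurableSet_supp : MeasurableSet supp

/-- The dominating measure of `(Y_0, …, Y_T, X_1, …, X_T, A)`, restricted to the common support. -/
noncomputable def Design.dominating {T d : ℕ} [NeZero T] (D : Design T d) :
    Measure ((Fin (T + 1) → ℝ) × (Fin T → (Fin d → ℝ)) × ℝ) :=
  ((Measure.pi (Fin.cons D.μ0 (fun _ : Fin T => volume.restrict (Set.Ioi (0 : ℝ))))).prod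
    ((Measure.pi D.μX).prod volume)).restrict
    {w | (w.1 0, w.2.1 0, w.2.2) ∈ D.supp}

/-- The nuisance parameters `ω = (g, π, ν)` of the model: the feedback process, the heterogeneity
distribution and the initial condition, unrestricted except for having the common support. -/
structure Nuisance {T d : ℕ} [NeZero T] (D : Design T d) where
  /-- `g t y^{t-1} x^{t-1} a x_t`; the value at the first period, `t = 0`, is not used. -/
  g : (t : Fin T) → (Fin (t.val + 1) → ℝ) → (Fin t.val → (Fin d → ℝ)) → ℝ → (Fin d → ℝ) → ℝ
  /-- `π y_0 x_1 a` -/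
  π : ℝ → (Fin d → ℝ) → ℝ → ℝ
  /-- `ν y_0 x_1` -/
  ν : ℝ → (Fin d → ℝ) → ℝ
  measurable_g : ∀ t : Fin T, 0 < t.val → Measurable
    (fun q : (Fin (t.val + 1) → ℝ) × (Fin t.val → (Fin d → ℝ)) × ℝ × (Fin d → ℝ) =>
      g t q.1 q.2.1 q.2.2.1 q.2.2.2)
  measurable_π : Measurable (fun q : ℝ × (Fin d → ℝ) × ℝ => π q.1 q.2.1 q.2.2)
  measurable_ν : Measurable (fun q : ℝ × (Fin d → ℝ) => ν q.1 q.2)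
  g_pos : ∀ t : Fin T, 0 < t.val → ∀ y x a x', 0 < g t y x a x'
  π_nonneg : ∀ y₀ x₁ a, 0 ≤ π y₀ x₁ a
  ν_nonneg : ∀ y₀ x₁, 0 ≤ ν y₀ x₁
  mem_supp_iff : ∀ y₀ x₁ a, (y₀, x₁, a) ∈ D.supp ↔ 0 < ν y₀ x₁ ∧ 0 < π y₀ x₁ a
  lintegral_g : ∀ t : Fin T, 0 < t.val → ∀ y x a,
    ∫⁻ x', ENNReal.ofReal (g t y x a x') ∂(D.μX t) = 1
  lintegral_π : ∀ y₀ x₁, 0 < ν y₀ x₁ → ∫⁻ a, ENNReal.ofReal (π y₀ x₁ a) = 1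
  lintegral_ν : ∫⁻ q, ENNReal.ofReal (ν q.1 q.2) ∂(D.μ0.prod (D.μX 0)) = 1

/-- The complete-data likelihood
`∏_{t=1}^T f_θ(y_t | y_{t-1}, x_t, a) ∏_{t=2}^T g(x_t | y^{t-1}, x^{t-1}, a) π(a | y_0, x_1)
ν(y_0, x_1)`. -/
noncomputable def likelihood {T m d : ℕ} [NeZero T] {D : Design T d}
    (lam : (Fin m → ℝ) → ℝ → ℝ) (θ : Param m d) (ω : Nuisance D)
    (y : Fin (T + 1) → ℝ) (x : Fin T → (Fin d → ℝ)) (a : ℝ) : ℝ :=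
  (∏ t : Fin T, density lam θ (y t.succ) (y t.castSucc) (x t) a)
    * (∏ t : Fin T with 0 < t.val,
        ω.g t (take (Nat.succ_le_succ t.isLt.le) y) (take t.isLt.le x) a (x t))
    * ω.π (y 0) (x 0) a * ω.ν (y 0) (x 0)

/-- The joint law of `(Y_0, …, Y_T, X_1, …, X_T, A)` under `(θ, ω)`. -/
noncomputable def law {T m d : ℕ} [NeZero T] {D : Design T d}
    (lam : (Fin m → ℝ) → ℝ → ℝ) (θ : Param m d) (ω : Nuisance D) :
    Measure ((Fin (T + 1) → ℝ) × (Fin T → (Fin d → ℝ)) × ℝ) :=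
  D.dominating.withDensity (fun w => ENNReal.ofReal (likelihood lam θ ω w.1 w.2.1 w.2.2))

/-- Integration of a function of `(y, x, a)` over the outcome of one period against the model
density `f_θ(y_t | y_{t-1}, x_t, a)`. -/
noncomputable def integrateOut {T m d : ℕ} (lam : (Fin m → ℝ) → ℝ → ℝ) (θ : Param m d)
    (t : Fin T) (F : (Fin (T + 1) → ℝ) → (Fin T → (Fin d → ℝ)) → ℝ → ℝ)
    (y : Fin (T + 1) → ℝ) (x : Fin T → (Fin d → ℝ)) (a : ℝ) : ℝ :=
  ∫ u in Set.Ioi (0 : ℝ),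
    F (Function.update y t.succ u) x a * density lam θ u (y t.castSucc) (x t) a

/-- The iterated integral
`∫ ⋯ ∫ φ(y^T, x^T) ∏_{r=s+1}^T f_θ(y_r | y_{r-1}, x_r, a) dy_T ⋯ dy_{s+1}` for `s = 0, …, T`:
`φ` itself at `s = T`, and one more integration at each step down. -/
noncomputable def tailIntegral {T m d : ℕ} (lam : (Fin m → ℝ) → ℝ → ℝ) (θ : Param m d)
    (φ : (Fin (T + 1) → ℝ) → (Fin T → (Fin d → ℝ)) → ℝ) (s : Fin (T + 1)) :
    (Fin (T + 1) → ℝ) → (Fin T → (Fin d → ℝ)) → ℝ → ℝ :=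
  Fin.reverseInduction
    (motive := fun _ => (Fin (T + 1) → ℝ) → (Fin T → (Fin d → ℝ)) → ℝ → ℝ)
    (fun y x _ => φ y x) (fun t F => integrateOut lam θ t F) s

/-- Heterogeneity robustness:
`∫ φ(y^T, x^T) ∏_{t=1}^T f_θ(y_t | y_{t-1}, x_t, a) dy^{1:T} = 0`, almost everywhere on the common
support. -/
def HeterogeneityRobust {T m d : ℕ} [NeZero T] (D : Design T d)
    (lam : (Fin m → ℝ) → ℝ → ℝ) (θ : Param m d)
    (φ : (Fin (T + 1) → ℝ) → (Fin T → (Fin d → ℝ)) → ℝ) : Prop :=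
  ∀ᵐ w ∂D.dominating, tailIntegral lam θ φ 0 w.1 w.2.1 w.2.2 = 0

/-- Feedback robustness: for every period `s = 2, …, T` (`s = t + 1` below),
`∫ φ(y^T, x^T) ∏_{r=s}^T f_θ(y_r | y_{r-1}, x_r, a) dy^{s:T}` does not depend on `x^{s:T}`, that is,
it is a function of `(y^{s-1}, x^{s-1}, a)` almost everywhere on the common support. -/
def FeedbackRobust {T m d : ℕ} [NeZero T] (D : Design T d)
    (lam : (Fin m → ℝ) → ℝ → ℝ) (θ : Param m d)
    (φ : (Fin (T + 1) → ℝ) → (Fin T → (Fin d → ℝ)) → ℝ) : Prop :=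
  ∀ t : Fin T, 0 < t.val →
    ∃ h : (Fin (t.val + 1) → ℝ) × (Fin t.val → (Fin d → ℝ)) × ℝ → ℝ, Measurable h ∧
      ∀ᵐ w ∂D.dominating, tailIntegral lam θ φ t.castSucc w.1 w.2.1 w.2.2
        = h (take (Nat.succ_le_succ t.isLt.le) w.1, take t.isLt.le w.2.1, w.2.2)

/-- `P_t = ρ_θ(Z_t)`. -/
noncomputable def P {T m d : ℕ} (lam : (Fin m → ℝ) → ℝ → ℝ) (θ : Param m d)
    (y : Fin (T + 1) → ℝ) (x : Fin T → (Fin d → ℝ)) (t : Fin T) : ℝ :=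
  rho lam θ (y t.succ) (y t.castSucc) (x t)

/-- The forward orthogonal deviations `P̃_t = P_t / ∑_{s ≥ t} P_s`. -/
noncomputable def Ptilde {T m d : ℕ} (lam : (Fin m → ℝ) → ℝ → ℝ) (θ : Param m d)
    (y : Fin (T + 1) → ℝ) (x : Fin T → (Fin d → ℝ)) (t : Fin T) : ℝ :=
  P lam θ y x t / ∑ s ∈ Finset.Ici t, P lam θ y x s

/-- The between part `P̄ = ∑_t P_t`. -/
noncomputable def Pbar {T m d : ℕ} (lam : (Fin m → ℝ) → ℝ → ℝ) (θ : Param m d)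
    (y : Fin (T + 1) → ℝ) (x : Fin T → (Fin d → ℝ)) : ℝ :=
  ∑ t : Fin T, P lam θ y x t

/-- The statistic `(Y_0, P̃^k, P̄, X^l)`. -/
noncomputable def stat {T m d : ℕ} (lam : (Fin m → ℝ) → ℝ → ℝ) (θ : Param m d)
    {k l : ℕ} (hk : k ≤ T) (hl : l ≤ T)
    (w : (Fin (T + 1) → ℝ) × (Fin T → (Fin d → ℝ)) × ℝ) :
    ℝ × (Fin k → ℝ) × ℝ × (Fin l → (Fin d → ℝ)) :=
  (w.1 0, take hk (Ptilde lam θ w.1 w.2.1), Pbar lam θ w.1 w.2.1, take hl w.2.1)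

end MPH

namespace MPH

open Set Filter Topology ProbabilityTheory
open scoped ENNReal

/-! Indices start at 0 as in the code, and R_t stands for `tailSum` from index t, so that R_0 is P̄
and R_T = 0. Let H_t collect the outcomes Y_0, …, Y_t and the regressors with indices 0, …, t. Given
H_t and A, the residual P_t is exponential with rate e^A, whatever the feedback process. Hence,
given H_t and A, R_t is e^{-A} times a Gamma variable of shape T - t (`lintegral_law_tailSum`), and
the share P_t / R_t is Beta(1, T - t - 1), independent of R_t, H_t and A (`lintegral_law_share`).
The heterogeneity acts only through the scale of R_t, and the laws of the shares involve neither A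
nor the feedback. Moreover Y_0, the first t shares, P̄ and the first t regressors recode the first
outcomes and regressors together with R_t (`recover_statAt`). Conditioning on the statistic without
its last share is therefore averaging over a Beta variable (`condExp_stat`).

Sufficiency (`ae_tailIntegral_eq_sum`): integrating out the outcome of index t averages over its
share. Terms with smaller index see this period only through R_t and do not change; the term of
index t has mean zero and disappears. What is left after integrating down to index s is a sum over i
< s of functions of the history before s and of a; at s = 0 it is empty.

Necessity (`exists_decomposition`): going backwards from φ, one builds functions κ_s of the history
before s and of R_s whose Gamma averages are the iterated integrals (`Represents`). The share
average of κ_{t+1} may still involve the regressor of index t. Feedback robustness says that its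
Gamma average does not, for almost all a in the support, and completeness of the Gamma scale family
(`ae_eq_zero_of_integral_gm_eq_zero`, from analyticity of Laplace transforms) moves this to the
function itself. Heterogeneity robustness gives κ_0 = 0 in the same way. The increments
κ_{t+1}(R_{t+1}) - κ_t(R_t) have conditional mean zero and telescope to φ. -/

/-! ### The integrated hazard, its inverse, and the change of variables -/

/-- The integrated hazard. -/
noncomputable def cumHaz (lam : ℝ → ℝ) (y : ℝ) : ℝ := ∫ u in (0 : ℝ)..y, lam u

lemma measurable_cumHaz {lam : ℝ → ℝ} (h : Measurable lam) : Measurable (cumHaz lam) := by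
  have h1 : StronglyMeasurable (fun y : ℝ => ∫ u, (Ioc 0 y).indicator lam u) := by
    refine StronglyMeasurable.integral_prod_right (f := fun y u => (Ioc 0 y).indicator lam u) ?_
    have : (Function.uncurry fun y u : ℝ => (Ioc 0 y).indicator lam u)
        = {q : ℝ × ℝ | 0 < q.2 ∧ q.2 ≤ q.1}.indicator (fun q => lam q.2) := by
      ext ⟨y, u⟩; simp [indicator, Function.uncurry]
    rw [this]
    refine (Measurable.indicator (by fun_prop) ?_).stronglyMeasurable
    exact (measurableSet_lt measurable_const measurable_snd).inter
      (measurableSet_le measurable_snd measurable_fst)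
  have h2 : StronglyMeasurable (fun y : ℝ => ∫ u, (Ioc y 0).indicator lam u) := by
    refine StronglyMeasurable.integral_prod_right (f := fun y u => (Ioc y 0).indicator lam u) ?_
    have : (Function.uncurry fun y u : ℝ => (Ioc y 0).indicator lam u)
        = {q : ℝ × ℝ | q.1 < q.2 ∧ q.2 ≤ 0}.indicator (fun q => lam q.2) := by
      ext ⟨y, u⟩; simp [indicator, Function.uncurry]
    rw [this]
    refine (Measurable.indicator (by fun_prop) ?_).stronglyMeasurable
    exact (measurableSet_lt measurable_fst measurable_snd).inter
      (measurableSet_le measurable_snd measurable_const)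
  convert (h1.sub h2).measurable using 1
  ext y
  simp only [cumHaz, intervalIntegral, Pi.sub_apply]
  rw [integral_indicator measurableSet_Ioc, integral_indicator measurableSet_Ioc]

namespace IsBaselineHazard
variable {lam : ℝ → ℝ}

lemma intervalIntegrable (h : IsBaselineHazard lam) {x y : ℝ} (hx : 0 ≤ x) (hy : 0 ≤ y) :
    IntervalIntegrable lam volume x y := by
  have key : ∀ z : ℝ, 0 ≤ z → IntervalIntegrable lam volume 0 z := fun z hz => by
    rcases hz.eq_or_lt with rfl | hz
    · simp
    · exact h.integrable z hz
  exact (key x hx).symm.trans (key y hy)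

lemma cumHaz_sub (h : IsBaselineHazard lam) {x y : ℝ} (hx : 0 ≤ x) (hy : 0 ≤ y) :
    cumHaz lam y - cumHaz lam x = ∫ u in x..y, lam u :=
  intervalIntegral.integral_interval_sub_left (h.intervalIntegrable le_rfl hy)
    (h.intervalIntegrable le_rfl hx)

lemma strictMonoOn (h : IsBaselineHazard lam) : StrictMonoOn (cumHaz lam) (Ici 0) := by
  intro x hx y hy hxy
  have := intervalIntegral.intervalIntegral_pos_of_pos_on
    (h.intervalIntegrable hx hy) (fun u hu => h.pos u (lt_of_le_of_lt hx hu.1)) hxy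
  have h2 := h.cumHaz_sub hx hy
  linarith

@[simp] lemma _root_.MPH.cumHaz_zero : cumHaz lam 0 = 0 := by simp [cumHaz]

lemma cumHaz_pos (h : IsBaselineHazard lam) {y : ℝ} (hy : 0 < y) : 0 < cumHaz lam y := by
  have := h.strictMonoOn (mem_Ici.2 le_rfl) (mem_Ici.2 hy.le) hy
  simpa using this

lemma exists_cumHaz_eq (h : IsBaselineHazard lam) {v : ℝ} (hv : 0 < v) :
    ∃ u, 0 < u ∧ cumHaz lam u = v := by
  obtain ⟨b, hb, hb0⟩ := ((h.tendsto.eventually_ge_atTop v).and (eventually_gt_atTop 0)).exists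
  have hcont : ContinuousOn (cumHaz lam) (uIcc 0 b) := by
    apply intervalIntegral.continuousOn_primitive_interval
    rw [uIcc_of_le hb0.le, integrableOn_Icc_iff_integrableOn_Ioc,
      ← intervalIntegrable_iff_integrableOn_Ioc_of_le hb0.le]
    exact h.integrable b hb0
  rw [uIcc_of_le hb0.le] at hcont
  obtain ⟨u, hu, huv⟩ := intermediate_value_Icc hb0.le hcont
    (show v ∈ Icc (cumHaz lam 0) (cumHaz lam b) from ⟨by simpa using hv.le, hb⟩)
  refine ⟨u, lt_of_le_of_ne hu.1 ?_, huv⟩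
  rintro rfl
  simp at huv
  linarith

end IsBaselineHazard

open Classical in
/-- The inverse of the integrated hazard on `(0, ∞)`. -/
noncomputable def cumHazInv (lam : ℝ → ℝ) (v : ℝ) : ℝ :=
  if h : 0 < v ∧ ∃ u, 0 < u ∧ cumHaz lam u = v then h.2.choose else 0

namespace IsBaselineHazard
variable {lam : ℝ → ℝ}

lemma cumHazInv_pos (h : IsBaselineHazard lam) {v : ℝ} (hv : 0 < v) : 0 < cumHazInv lam v := by
  have h' : 0 < v ∧ ∃ u, 0 < u ∧ cumHaz lam u = v := ⟨hv, h.exists_cumHaz_eq hv⟩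
  rw [cumHazInv, dif_pos h']
  exact h'.2.choose_spec.1

lemma cumHaz_cumHazInv (h : IsBaselineHazard lam) {v : ℝ} (hv : 0 < v) :
    cumHaz lam (cumHazInv lam v) = v := by
  have h' : 0 < v ∧ ∃ u, 0 < u ∧ cumHaz lam u = v := ⟨hv, h.exists_cumHaz_eq hv⟩
  rw [cumHazInv, dif_pos h']
  exact h'.2.choose_spec.2

lemma cumHazInv_of_nonpos {v : ℝ} (hv : v ≤ 0) : cumHazInv lam v = 0 := by
  rw [cumHazInv, dif_neg (fun h => absurd h.1 hv.not_gt)]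

lemma cumHazInv_cumHaz (h : IsBaselineHazard lam) {y : ℝ} (hy : 0 < y) :
    cumHazInv lam (cumHaz lam y) = y := by
  have hp := h.cumHaz_pos hy
  exact h.strictMonoOn.injOn (mem_Ici.2 (h.cumHazInv_pos hp).le) (mem_Ici.2 hy.le)
    (h.cumHaz_cumHazInv hp)

lemma cumHazInv_nonneg (h : IsBaselineHazard lam) (v : ℝ) : 0 ≤ cumHazInv lam v := by
  rcases le_or_gt v 0 with hv | hv
  · rw [cumHazInv_of_nonpos hv]
  · exact (h.cumHazInv_pos hv).le

/-- The default value 0 on (-∞, 0] lies below every value on (0, ∞), so monotonicity, and with it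
measurability, holds on the whole line. -/
lemma monotone_cumHazInv (h : IsBaselineHazard lam) : Monotone (cumHazInv lam) := by
  intro x y hxy
  rcases le_or_gt x 0 with hx | hx
  · rw [cumHazInv_of_nonpos hx]; exact h.cumHazInv_nonneg y
  · have hy := hx.trans_le hxy
    rw [← h.strictMonoOn.le_iff_le (mem_Ici.2 (h.cumHazInv_pos hx).le)
      (mem_Ici.2 (h.cumHazInv_pos hy).le), h.cumHaz_cumHazInv hx, h.cumHaz_cumHazInv hy]
    exact hxy

lemma measurable_cumHazInv (h : IsBaselineHazard lam) : Measurable (cumHazInv lam) :=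
  h.monotone_cumHazInv.measurable

/-- The substitution v = Λ(u) for a hazard that is only measurable, where Λ need not be
differentiable everywhere. Half-open intervals suffice: the preimage of (x, y] in (0, ∞) is (Λ⁻¹(x),
Λ⁻¹(y)], and its mass is a difference of values of Λ. -/
lemma map_cumHaz (h : IsBaselineHazard lam) :
    ((volume.restrict (Ioi (0 : ℝ))).withDensity (fun u => ENNReal.ofReal (lam u))).map
      (cumHaz lam) = volume.restrict (Ioi 0) := by
  have hm := measurable_cumHaz h.measurable
  symm
  apply Measure.ext_of_Ioc
  intro x y hxy
  rw [Measure.map_apply hm measurableSet_Ioc,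
    withDensity_apply _ (hm measurableSet_Ioc), Measure.restrict_apply measurableSet_Ioc,
    Measure.restrict_restrict (hm measurableSet_Ioc)]
  have e1 : Ioc x y ∩ Ioi 0 = Ioc (max x 0) y := by ext; simp
  have e2 : cumHaz lam ⁻¹' Ioc x y ∩ Ioi 0 = Ioc (cumHazInv lam x) (cumHazInv lam y) := by
    ext u
    simp only [mem_inter_iff, mem_preimage, mem_Ioc, mem_Ioi]
    constructor
    · rintro ⟨⟨h1, h2⟩, hu⟩
      refine ⟨?_, ?_⟩
      · rcases le_or_gt x 0 with hx | hx
        · rwa [cumHazInv_of_nonpos hx]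
        · rw [← h.strictMonoOn.lt_iff_lt (mem_Ici.2 (h.cumHazInv_nonneg x)) (mem_Ici.2 hu.le),
            h.cumHaz_cumHazInv hx]
          exact h1
      · have := h.monotone_cumHazInv h2
        rwa [h.cumHazInv_cumHaz hu] at this
    · rintro ⟨h1, h2⟩
      have hu : 0 < u := (h.cumHazInv_nonneg x).trans_lt h1
      have hy : 0 < y := by
        by_contra hy
        rw [cumHazInv_of_nonpos (not_lt.1 hy)] at h2
        linarith
      refine ⟨⟨?_, ?_⟩, hu⟩
      · rcases le_or_gt x 0 with hx | hx
        · exact hx.trans_lt (h.cumHaz_pos hu)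
        · have := h.strictMonoOn (mem_Ici.2 (h.cumHazInv_nonneg x)) (mem_Ici.2 hu.le) h1
          rwa [h.cumHaz_cumHazInv hx] at this
      · have := h.strictMonoOn.monotoneOn (mem_Ici.2 hu.le) (mem_Ici.2 (h.cumHazInv_nonneg y)) h2
        rwa [h.cumHaz_cumHazInv hy] at this
  rw [e1, e2, Real.volume_Ioc]
  have hxy' := h.monotone_cumHazInv hxy.le
  rw [← ofReal_integral_eq_lintegral_ofReal]
  · rw [← intervalIntegral.integral_of_le hxy',
      ← h.cumHaz_sub (h.cumHazInv_nonneg x) (h.cumHazInv_nonneg y)]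
    rcases le_or_gt x 0 with hx | hx
    · rw [cumHazInv_of_nonpos hx, max_eq_right hx]
      rcases le_or_gt y 0 with hy | hy
      · rw [cumHazInv_of_nonpos hy]; simp [hy]
      · rw [h.cumHaz_cumHazInv hy]; simp
    · rw [h.cumHaz_cumHazInv hx, h.cumHaz_cumHazInv (hx.trans hxy), max_eq_left hx.le]
  · exact (intervalIntegrable_iff_integrableOn_Ioc_of_le hxy').1
      (h.intervalIntegrable (h.cumHazInv_nonneg x) (h.cumHazInv_nonneg y))
  · filter_upwards [ae_restrict_mem measurableSet_Ioc] with u hu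
    exact (h.pos u ((h.cumHazInv_nonneg x).trans_lt hu.1)).le

end IsBaselineHazard

/-! ### Gamma and Beta distributions -/

/-- The unit rate Gamma distribution with integer shape `k`, a point mass at zero if `k = 0`. -/
noncomputable def gm : ℕ → Measure ℝ
  | 0 => Measure.dirac 0
  | k + 1 => (volume.restrict (Ioi 0)).withDensity
      (fun r => ENNReal.ofReal (r ^ k / k.factorial * Real.exp (-r)))

/-- The Beta distribution with parameters `1` and `k`, a point mass at one if `k = 0`. -/
noncomputable def bt : ℕ → Measure ℝ
  | 0 => Measure.dirac 1
  | k + 1 => (volume.restrict (Ioo 0 1)).withDensity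
      (fun b => ENNReal.ofReal ((k + 1) * (1 - b) ^ k))

lemma gm_one : gm 1 = (volume.restrict (Ioi 0)).withDensity
    (fun r => ENNReal.ofReal (Real.exp (-r))) := by
  simp [gm]

instance instProbGm : ∀ k, IsProbabilityMeasure (gm k)
  | 0 => by unfold gm; infer_instance
  | k + 1 => by
    constructor
    rw [gm, withDensity_apply _ MeasurableSet.univ, Measure.restrict_univ,
      ← ofReal_integral_eq_lintegral_ofReal]
    · have := Real.Gamma_eq_integral (s := k + 1) (by positivity)
      rw [Real.Gamma_nat_eq_factorial] at this
      rw [← ENNReal.ofReal_one]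
      congr 1
      rw [← div_self (show (k.factorial : ℝ) ≠ 0 by positivity)]
      nth_rw 2 [this]
      rw [← integral_div]
      refine setIntegral_congr_fun measurableSet_Ioi fun r hr => ?_
      simp
      ring
    · have := Real.GammaIntegral_convergent (s := k + 1) (by positivity)
      refine IntegrableOn.congr_fun (this.div_const (k.factorial : ℝ)) (fun r hr => ?_)
        measurableSet_Ioi
      simp
      ring
    · filter_upwards [ae_restrict_mem measurableSet_Ioi] with r hr
      have : (0 : ℝ) < r := hr
      positivity

instance instProbBt : ∀ k, IsProbabilityMeasure (bt k)
  | 0 => by unfold bt; infer_instance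
  | k + 1 => by
    constructor
    rw [bt, withDensity_apply _ MeasurableSet.univ, Measure.restrict_univ,
      ← ofReal_integral_eq_lintegral_ofReal]
    · rw [← integral_Ioc_eq_integral_Ioo, ← intervalIntegral.integral_of_le zero_le_one,
        intervalIntegral.integral_const_mul,
        intervalIntegral.integral_comp_sub_left (fun b => b ^ k)]
      simp
      field_simp
    · exact (Continuous.integrableOn_Icc (by fun_prop)).mono_set Ioo_subset_Icc_self
    · filter_upwards [ae_restrict_mem measurableSet_Ioo] with r hr
      have : (0 : ℝ) < 1 - r := by linarith [hr.2]
      positivity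

lemma gm_ae_pos (k : ℕ) : ∀ᵐ r ∂(gm (k + 1)), 0 < r :=
  (withDensity_absolutelyContinuous _ _).ae_le (ae_restrict_mem measurableSet_Ioi)

lemma bt_ae_mem : ∀ k : ℕ, ∀ᵐ b ∂(bt k), b ∈ Ioc (0 : ℝ) 1
  | 0 => by simp [bt, ae_dirac_eq]
  | k + 1 => (withDensity_absolutelyContinuous _ _).ae_le <| by
      filter_upwards [ae_restrict_mem measurableSet_Ioo] with b hb using ⟨hb.1, hb.2.le⟩

lemma ae_gm_iff (k : ℕ) {p : ℝ → Prop} :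
    (∀ᵐ r ∂(gm (k + 1)), p r) ↔ ∀ᵐ r ∂(volume.restrict (Ioi (0 : ℝ))), p r := by
  constructor
  · refine fun h => (withDensity_absolutelyContinuous' (by fun_prop) ?_).ae_le h
    filter_upwards [ae_restrict_mem measurableSet_Ioi] with r hr
    have : (0 : ℝ) < r := hr
    rw [Ne, ENNReal.ofReal_eq_zero, not_le]
    positivity
  · exact fun h => (withDensity_absolutelyContinuous _ _).ae_le h

lemma lintegral_Ioi_scale {c : ℝ} (hc : 0 < c) {F : ℝ → ℝ≥0∞} (hF : Measurable F) :
    ∫⁻ v in Ioi (0 : ℝ), F v = ∫⁻ r in Ioi (0 : ℝ), ENNReal.ofReal c * F (c * r) := by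
  have h := Real.smul_map_volume_mul_left hc.ne'
  rw [← lintegral_indicator measurableSet_Ioi, ← lintegral_indicator measurableSet_Ioi]
  conv_lhs => rw [← h]
  have hm : Measurable (fun r => (Ioi (0 : ℝ)).indicator F (c * r)) :=
    (hF.indicator measurableSet_Ioi).comp (measurable_const_mul c)
  rw [lintegral_smul_measure, lintegral_map (hF.indicator measurableSet_Ioi) (by fun_prop),
    smul_eq_mul, ← lintegral_const_mul _ hm, abs_of_pos hc]
  congr with r
  simp [indicator, hc]

/-- The conditional distribution of a spell is the law of a rescaled exponential variable,
transformed by the inverse integrated hazard. -/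
lemma IsBaselineHazard.spell_eq_map {lam : ℝ → ℝ} (h : IsBaselineHazard lam) {c : ℝ}
    (hc : 0 < c) :
    (volume.restrict (Ioi (0 : ℝ))).withDensity
      (fun u => ENNReal.ofReal (lam u * c * Real.exp (-(cumHaz lam u * c))))
      = (gm 1).map (fun e => cumHazInv lam (c⁻¹ * e)) := by
  have hm := measurable_cumHaz h.measurable
  have hi := h.measurable_cumHazInv
  have hl := h.measurable
  refine Measure.ext_of_lintegral _ fun H hH => ?_
  rw [lintegral_withDensity_eq_lintegral_mul _ (by fun_prop) hH, lintegral_map hH (by fun_prop),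
    gm_one, lintegral_withDensity_eq_lintegral_mul _ (by fun_prop) (by fun_prop)]
  simp only [Pi.mul_apply]
  -- Substitute r = c v and then v = Λ(u), which undoes the map e ↦ Λ⁻¹(e / c).
  conv_rhs => rw [lintegral_Ioi_scale hc (by fun_prop), ← h.map_cumHaz]
  rw [lintegral_map (by fun_prop) hm, lintegral_withDensity_eq_lintegral_mul _ (by fun_prop)
    (by fun_prop)]
  refine setLIntegral_congr_fun measurableSet_Ioi fun u hu => ?_
  have hu' := h.pos u hu
  simp only [Pi.mul_apply]
  rw [inv_mul_cancel_left₀ hc.ne', h.cumHazInv_cumHaz hu, ← mul_assoc, ← mul_assoc,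
    ← ENNReal.ofReal_mul hu'.le, ← ENNReal.ofReal_mul (by positivity), mul_comm c (cumHaz lam u)]

lemma lintegral_Ioo_scale {r : ℝ} (hr : 0 < r) {H : ℝ → ℝ≥0∞} (hH : Measurable H) :
    ∫⁻ p in Ioo 0 r, H p = ∫⁻ b in Ioo (0 : ℝ) 1, ENNReal.ofReal r * H (b * r) := by
  have h := lintegral_Ioi_scale hr (F := (Iio r).indicator H) (hH.indicator measurableSet_Iio)
  rw [setLIntegral_indicator measurableSet_Iio, inter_comm, Ioi_inter_Iio] at h
  rw [h, ← lintegral_indicator measurableSet_Ioi, ← lintegral_indicator measurableSet_Ioo]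
  congr with b
  have : r * b < r ↔ b < 1 := by constructor <;> intro <;> nlinarith
  simp only [indicator, mem_Ioi, mem_Ioo, mem_Iio, this, mul_comm b r]
  by_cases h0 : 0 < b <;> by_cases h1 : b < 1 <;> simp [h0, h1]

/-- The ratio of an exponential variable to its sum with an independent Gamma variable has a Beta
distribution and is independent of that sum. -/
lemma lintegral_bt_gm (k : ℕ) {F : ℝ → ℝ → ℝ≥0∞} (hF : Measurable (Function.uncurry F)) :
    ∫⁻ r, ∫⁻ b, F (b * r) ((1 - b) * r) ∂(bt k) ∂(gm (k + 1))
      = ∫⁻ p, ∫⁻ q, F p q ∂(gm k) ∂(gm 1) := by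
  -- With the point masses `gm 0` at 0 and `bt 0` at 1, both sides are the integral of F(p, 0); this
  -- is the last period.
  rcases k with _ | k
  · have h1 : ∀ p : ℝ, Measurable (fun q => F p q) := fun p => by fun_prop
    have h2 : ∀ r : ℝ, Measurable (fun b : ℝ => F (b * r) ((1 - b) * r)) := fun p => by fun_prop
    simp [gm, bt, lintegral_dirac' _ (h1 _), lintegral_dirac' _ (h2 _)]
  have hF' : ∀ {α : Type} [MeasurableSpace α] {f g : α → ℝ}, Measurable f → Measurable g →
      Measurable (fun x => F (f x) (g x)) := fun hf hg => hF.comp (hf.prodMk hg)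
  have dG : ∀ j, Measurable (fun r : ℝ => ENNReal.ofReal (r ^ j / j.factorial * Real.exp (-r))) :=
    fun j => by fun_prop
  have dB : Measurable (fun b : ℝ => ENNReal.ofReal ((k + 1) * (1 - b) ^ k)) := by fun_prop
  -- Both sides equal the integral of (r - p)^k / k! · e^{-r} F(p, r - p) over 0 < p < r: put p = b
  -- r on the left and r = p + q on the right, and exchange the order of integration.
  have L : ∫⁻ r, ∫⁻ b, F (b * r) ((1 - b) * r) ∂(bt (k + 1)) ∂(gm (k + 1 + 1))
      = ∫⁻ r in Ioi (0 : ℝ), ∫⁻ p in Ioo 0 r,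
        ENNReal.ofReal ((r - p) ^ k / k.factorial * Real.exp (-r)) * F p (r - p) := by
    rw [gm, lintegral_withDensity_eq_lintegral_mul _ (dG _)]
    swap
    · refine Measurable.lintegral_prod_right' (f := fun q : ℝ × ℝ => F (q.2 * q.1)
        ((1 - q.2) * q.1)) (hF' (by fun_prop) (by fun_prop))
    refine setLIntegral_congr_fun measurableSet_Ioi fun r hr => ?_
    have hr : 0 < r := hr
    simp only [Pi.mul_apply]
    rw [bt, lintegral_withDensity_eq_lintegral_mul _ dB (hF' (by fun_prop) (by fun_prop)),
      lintegral_Ioo_scale hr (H := fun p =>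
        ENNReal.ofReal ((r - p) ^ k / k.factorial * Real.exp (-r)) * F p (r - p))
        (Measurable.mul (by fun_prop) (hF' (by fun_prop) (by fun_prop))),
      ← lintegral_const_mul _ (dB.mul (hF' (by fun_prop) (by fun_prop)))]
    refine setLIntegral_congr_fun measurableSet_Ioo fun b hb => ?_
    have hb1 : 0 < 1 - b := by linarith [hb.2]
    have e : r - b * r = (1 - b) * r := by ring
    simp only [Pi.mul_apply]
    rw [← mul_assoc, ← mul_assoc, e, ← ENNReal.ofReal_mul (by positivity),
      ← ENNReal.ofReal_mul (by positivity)]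
    congr 2
    rw [Nat.factorial_succ]
    push_cast
    field_simp
    rw [mul_pow]
    ring
  have R : ∫⁻ p, ∫⁻ q, F p q ∂(gm (k + 1)) ∂(gm 1)
      = ∫⁻ p in Ioi (0 : ℝ), ∫⁻ r in Ioi p,
        ENNReal.ofReal ((r - p) ^ k / k.factorial * Real.exp (-r)) * F p (r - p) := by
    rw [gm_one, lintegral_withDensity_eq_lintegral_mul _ (by fun_prop)]
    swap
    · exact Measurable.lintegral_prod_right' (f := fun q : ℝ × ℝ => F q.1 q.2) hF
    refine setLIntegral_congr_fun measurableSet_Ioi fun p hp => ?_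
    simp only [Pi.mul_apply]
    rw [gm, lintegral_withDensity_eq_lintegral_mul _ (dG _) (hF' (by fun_prop) (by fun_prop)),
      ← lintegral_const_mul _ ((dG _).mul (hF' (by fun_prop) (by fun_prop))),
      ← lintegral_indicator measurableSet_Ioi, ← lintegral_indicator measurableSet_Ioi,
      ← lintegral_sub_right_eq_self (fun q => (Ioi (0 : ℝ)).indicator _ q) p]
    congr with r
    simp only [indicator, mem_Ioi, sub_pos]
    split_ifs with hr
    · have : 0 < r - p := sub_pos.2 hr
      simp only [Pi.mul_apply]
      rw [← mul_assoc, ← ENNReal.ofReal_mul (by positivity), mul_left_comm, ← Real.exp_add]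
      congr 4
      ring
    · rfl
  rw [L, R]
  have sw : ∀ r p : ℝ, (Ioi (0 : ℝ)).indicator (fun r => (Ioo 0 r).indicator (fun p =>
        ENNReal.ofReal ((r - p) ^ k / k.factorial * Real.exp (-r)) * F p (r - p)) p) r
      = (Ioi (0 : ℝ)).indicator (fun p => (Ioi p).indicator (fun r =>
        ENNReal.ofReal ((r - p) ^ k / k.factorial * Real.exp (-r)) * F p (r - p)) r) p := by
    intro r p
    simp only [indicator, mem_Ioi, mem_Ioo]
    by_cases h1 : 0 < p <;> by_cases h2 : p < r
    · simp [h1, h2, h1.trans h2]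
    all_goals simp [h1, h2]
  rw [← lintegral_indicator measurableSet_Ioi, ← lintegral_indicator measurableSet_Ioi]
  have e1 : ∀ r : ℝ, (Ioi (0 : ℝ)).indicator (fun r => ∫⁻ p in Ioo 0 r,
        ENNReal.ofReal ((r - p) ^ k / k.factorial * Real.exp (-r)) * F p (r - p)) r
      = ∫⁻ p, (Ioi (0 : ℝ)).indicator (fun r => (Ioo 0 r).indicator (fun p =>
        ENNReal.ofReal ((r - p) ^ k / k.factorial * Real.exp (-r)) * F p (r - p)) p) r := by
    intro r
    by_cases hr : 0 < r
    · simp [indicator_of_mem (mem_Ioi.2 hr), lintegral_indicator measurableSet_Ioo]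
    · simp [indicator_of_notMem (notMem_Ioi.2 (not_lt.1 hr))]
  have e2 : ∀ p : ℝ, (Ioi (0 : ℝ)).indicator (fun p => ∫⁻ r in Ioi p,
        ENNReal.ofReal ((r - p) ^ k / k.factorial * Real.exp (-r)) * F p (r - p)) p
      = ∫⁻ r, (Ioi (0 : ℝ)).indicator (fun p => (Ioi p).indicator (fun r =>
        ENNReal.ofReal ((r - p) ^ k / k.factorial * Real.exp (-r)) * F p (r - p)) r) p := by
    intro r
    by_cases hr : 0 < r
    · simp [indicator_of_mem (mem_Ioi.2 hr), lintegral_indicator measurableSet_Ioi]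
    · simp [indicator_of_notMem (notMem_Ioi.2 (not_lt.1 hr))]
  simp_rw [e1, e2, ← sw]
  apply lintegral_lintegral_swap
  simp_rw [sw]
  refine Measurable.aemeasurable ?_
  have : (Function.uncurry fun r p : ℝ => (Ioi (0 : ℝ)).indicator (fun p => (Ioi p).indicator (fun r =>
        ENNReal.ofReal ((r - p) ^ k / k.factorial * Real.exp (-r)) * F p (r - p)) r) p)
      = {z : ℝ × ℝ | 0 < z.2 ∧ z.2 < z.1}.indicator (fun z =>
        ENNReal.ofReal ((z.1 - z.2) ^ k / k.factorial * Real.exp (-z.1)) * F z.2 (z.1 - z.2)) := by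
    ext ⟨r, p⟩
    simp only [Function.uncurry, indicator, mem_Ioi, mem_ofPred_eq]
    by_cases h1 : 0 < p <;> simp [h1]
  rw [this]
  refine Measurable.indicator (Measurable.mul (by fun_prop) (hF' (by fun_prop) (by fun_prop))) ?_
  exact (measurableSet_lt measurable_const measurable_snd).inter
      (measurableSet_lt measurable_snd measurable_fst)

lemma map_bt_gm (k : ℕ) :
    ((gm (k + 1)).prod (bt k)).map (fun z => (z.2 * z.1, (1 - z.2) * z.1))
      = (gm 1).prod (gm k) := by
  refine Measure.ext_of_lintegral _ fun F hF => ?_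
  rw [lintegral_map hF (by fun_prop), lintegral_prod _ (by fun_prop), lintegral_prod _ (by fun_prop)]
  exact lintegral_bt_gm k (F := fun p q => F (p, q)) hF

/-- A function of p + q = b r + (1 - b) r = r does not see the Beta variable, which integrates out.
-/
lemma lintegral_gm_conv (k : ℕ) {F : ℝ → ℝ≥0∞} (hF : Measurable F) :
    ∫⁻ r, F r ∂(gm (k + 1)) = ∫⁻ p, ∫⁻ q, F (p + q) ∂(gm k) ∂(gm 1) := by
  rw [← lintegral_bt_gm k (F := fun p q => F (p + q)) (by fun_prop)]
  refine lintegral_congr fun r => ?_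
  have : ∀ b : ℝ, b * r + (1 - b) * r = r := fun b => by ring
  simp [this]

/-! ### Laplace transforms and completeness -/

/-- Uniqueness of the Laplace transform of a function on `(0, ∞)`, from its zeros accumulating
at one point in the interior of its domain. -/
lemma ae_eq_zero_of_frequently_laplace_eq_zero {g : ℝ → ℝ} (hg : Measurable g)
    (hg0 : ∀ v ≤ 0, g v = 0) {l₁ l₂ : ℝ} (hl : l₁ < l₂)
    (hint : Integrable (fun v => g v * Real.exp (-l₁ * v)))
    (hfr : ∃ᶠ l in 𝓝[≠] l₂, ∫ v, g v * Real.exp (-l * v) = 0) : ∀ᵐ v, g v = 0 := by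
  have hint' : ∀ l, l₁ ≤ l → Integrable (fun v => g v * Real.exp (-l * v)) := by
    intro l hl
    refine hint.mono (by fun_prop) (Eventually.of_forall fun v => ?_)
    rcases le_or_gt v 0 with hv | hv
    · simp [hg0 v hv]
    · rw [norm_mul, norm_mul, Real.norm_of_nonneg (Real.exp_pos _).le,
        Real.norm_of_nonneg (Real.exp_pos _).le]
      gcongr
  -- Used with q = g and q = -g: the signed function is split into two finite measures with
  -- densities g⁺ e^{-l₂ v} and g⁻ e^{-l₂ v}. Their moment generating functions at t are the Laplace
  -- transforms of g⁺ and g⁻ at l₂ - t, finite for t ≤ l₂ - l₁; so 0 is an interior point.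
  have main : ∀ q : ℝ → ℝ, Measurable q → (∀ v, ‖q v‖ ≤ ‖g v‖) → ∀ t, t ≤ l₂ - l₁ →
      (Integrable (fun v => Real.exp (t * id v))
        (volume.withDensity fun v => ENNReal.ofReal (q v * Real.exp (-l₂ * v)))) ∧
      mgf id (volume.withDensity fun v => ENNReal.ofReal (q v * Real.exp (-l₂ * v))) t
        = ∫ v, (max (q v) 0) * Real.exp (-(l₂ - t) * v) := by
    intro q hq hqg t ht
    have e : ∀ v, (ENNReal.ofReal (q v * Real.exp (-l₂ * v))).toReal * Real.exp (t * v)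
        = max (q v) 0 * Real.exp (-(l₂ - t) * v) := by
      intro v
      have := Real.exp_pos (-l₂ * v)
      rw [ENNReal.toReal_ofReal', ← zero_mul (Real.exp (-l₂ * v)),
        ← max_mul_of_nonneg _ _ this.le, mul_assoc, ← Real.exp_add, zero_mul]
      congr 2
      ring
    constructor
    · rw [integrable_withDensity_iff_integrable_smul' (by fun_prop) (by simp)]
      simp only [smul_eq_mul, id, e]
      refine (hint' (l₂ - t) (by linarith)).mono (by fun_prop) (Eventually.of_forall fun v => ?_)
      rw [norm_mul, norm_mul]
      refine mul_le_mul_of_nonneg_right (le_trans ?_ (hqg v)) (norm_nonneg _)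
      rw [Real.norm_of_nonneg (le_max_right _ _)]
      exact max_le (le_abs_self _) (abs_nonneg _)
    · rw [mgf, integral_withDensity_eq_integral_toReal_smul (by fun_prop) (by simp)]
      simp only [smul_eq_mul, id, e]
  obtain ⟨μ, hμ⟩ : ∃ μ, μ = volume.withDensity fun v => ENNReal.ofReal (g v * Real.exp (-l₂ * v)) :=
    ⟨_, rfl⟩
  obtain ⟨ν, hν⟩ : ∃ ν, ν = volume.withDensity
    fun v => ENNReal.ofReal (-g v * Real.exp (-l₂ * v)) := ⟨_, rfl⟩
  have m1 := main g hg (fun v => le_rfl)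
  have m2 := main (fun v => -g v) hg.neg (fun v => by simp)
  rw [← hμ] at m1
  rw [← hν] at m2
  have fin : ∀ ρ : Measure ℝ, Integrable (fun v => Real.exp (0 * id v)) ρ → IsFiniteMeasure ρ := by
    intro ρ h
    simp only [zero_mul, Real.exp_zero] at h
    rcases integrable_const_iff.1 h with h | h
    · norm_num at h
    · exact h
  have : IsFiniteMeasure μ := fin _ (m1 0 (by linarith)).1
  have : IsFiniteMeasure ν := fin _ (m2 0 (by linarith)).1
  have i1 : Iio (l₂ - l₁) ⊆ interior (integrableExpSet id μ) :=
    isOpen_Iio.subset_interior_iff.2 fun t ht => (m1 t (le_of_lt ht)).1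
  have i2 : Iio (l₂ - l₁) ⊆ interior (integrableExpSet id ν) :=
    isOpen_Iio.subset_interior_iff.2 fun t ht => (m2 t (le_of_lt ht)).1
  have fr : ∃ᶠ t : ℝ in 𝓝[≠] 0, complexMGF id μ t = complexMGF id ν t := by
    have hT : Tendsto (fun l => l₂ - l) (𝓝[≠] l₂) (𝓝[≠] 0) := by
      refine tendsto_nhdsWithin_iff.2 ⟨?_, ?_⟩
      · have : Tendsto (fun l => l₂ - l) (𝓝 l₂) (𝓝 (l₂ - l₂)) :=
          (continuous_const.sub continuous_id).tendsto _
        rw [sub_self] at this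
        exact this.mono_left nhdsWithin_le_nhds
      · filter_upwards [self_mem_nhdsWithin] with l hl
        exact sub_ne_zero.2 (Ne.symm hl)
    refine hT.frequently ((hfr.and_eventually
      (nhdsWithin_le_nhds (lt_mem_nhds hl))).mono ?_)
    rintro l ⟨h0, hl1⟩
    rw [complexMGF_ofReal, complexMGF_ofReal, (m1 _ (by linarith)).2, (m2 _ (by linarith)).2,
      sub_sub_cancel, Complex.ofReal_inj, ← sub_eq_zero, ← integral_sub]
    · refine (integral_congr_ae (Eventually.of_forall fun v => ?_)).trans h0
      rcases le_total (g v) 0 with h | h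
      · simp [h]
      · simp [h]
    · refine (hint' l hl1.le).mono (by fun_prop) (Eventually.of_forall fun v => ?_)
      rw [norm_mul, norm_mul]
      refine mul_le_mul_of_nonneg_right ?_ (norm_nonneg _)
      rw [Real.norm_of_nonneg (le_max_right _ _)]
      exact max_le (le_abs_self _) (abs_nonneg _)
    · refine (hint' l hl1.le).mono (by fun_prop) (Eventually.of_forall fun v => ?_)
      rw [norm_mul, norm_mul]
      refine mul_le_mul_of_nonneg_right ?_ (norm_nonneg _)
      rw [Real.norm_of_nonneg (le_max_right _ _)]
      exact max_le (neg_le_abs _) (abs_nonneg _)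
  -- Identity theorem on the half-plane Re z < l₂ - l₁, which contains the imaginary axis; the two
  -- characteristic functions then agree.
  have eqOn : EqOn (complexMGF id μ) (complexMGF id ν) {z | z.re ∈ Iio (l₂ - l₁)} := by
    refine AnalyticOnNhd.eqOn_of_preconnected_of_frequently_eq
      (analyticOnNhd_complexMGF.mono fun z hz => i1 hz)
      (analyticOnNhd_complexMGF.mono fun z hz => i2 hz)
      ((convex_Iio _).linear_preimage Complex.reLm).isPreconnected
      (z₀ := ((0 : ℝ) : ℂ)) (by simpa using hl) ?_
    rw [frequently_iff_seq_forall] at fr ⊢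
    obtain ⟨xs, hx, hxe⟩ := fr
    refine ⟨fun n => xs n, ?_, fun n => hxe n⟩
    rw [tendsto_nhdsWithin_iff] at hx ⊢
    exact ⟨Complex.continuous_ofReal.continuousAt.tendsto.comp hx.1, by simpa using hx.2⟩
  have hμν : μ = ν := by
    refine Measure.ext_of_charFun ?_
    ext t
    rw [← complexMGF_id_mul_I, ← complexMGF_id_mul_I]
    exact eqOn (by simpa using hl)
  have hd : μ univ ≠ ∞ := measure_ne_top _ _
  rw [hμ, hν, withDensity_eq_iff (by fun_prop) (by fun_prop)
    (by rwa [hμ, withDensity_apply _ MeasurableSet.univ, Measure.restrict_univ] at hd)] at hμν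
  -- Equal densities mean g⁺ = g⁻ almost everywhere, and hence g = 0.
  filter_upwards [hμν] with v hv
  have hexp := Real.exp_pos (-l₂ * v)
  have hv := congrArg ENNReal.toReal hv
  rw [ENNReal.toReal_ofReal', ENNReal.toReal_ofReal'] at hv
  rcases lt_trichotomy (g v) 0 with h | h | h
  · rw [max_eq_right (by nlinarith), max_eq_left (by nlinarith)] at hv
    nlinarith
  · exact h
  · rw [max_eq_left (by nlinarith), max_eq_right (by nlinarith)] at hv
    nlinarith

/-- Completeness of a scale family of Gamma distributions, over any non-null set of log rates. -/
lemma ae_eq_zero_of_integral_gm_eq_zero (k : ℕ) {f : ℝ → ℝ} (hf : Measurable f) {S : Set ℝ}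
    (hS : volume S ≠ 0)
    (hint : ∀ a ∈ S, Integrable (fun r => f (Real.exp (-a) * r)) (gm (k + 1)))
    (h0 : ∀ a ∈ S, ∫ r, f (Real.exp (-a) * r) ∂(gm (k + 1)) = 0) :
    ∀ᵐ v ∂(volume.restrict (Ioi (0 : ℝ))), f v = 0 := by
  -- With r = e^a v, the Gamma integral becomes, up to a positive factor, the Laplace transform of
  -- f(v) v^k at e^a.
  set g : ℝ → ℝ := (Ioi (0 : ℝ)).indicator (fun v => f v * v ^ k) with hg
  have hgm : Measurable g := Measurable.indicator (by fun_prop) measurableSet_Ioi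
  have hsub : ∀ a v : ℝ, Real.exp (-a) * (Real.exp a * v) = v := fun a v => by
    rw [← mul_assoc, ← Real.exp_add]; simp
  have dens : ∀ a : ℝ, ∀ r ∈ Ioi (0 : ℝ),
      (ENNReal.ofReal (r ^ k / k.factorial * Real.exp (-r))).toReal • f (Real.exp (-a) * r)
      = (fun r => r ^ k / k.factorial * Real.exp (-r) * f (Real.exp (-a) * r)) r := by
    intro a r hr
    have : (0 : ℝ) < r := hr
    rw [ENNReal.toReal_ofReal (by positivity), smul_eq_mul]
  have scal : ∀ a v : ℝ, (fun r => r ^ k / k.factorial * Real.exp (-r) * f (Real.exp (-a) * r))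
        (Real.exp a * v)
      = Real.exp a ^ k / k.factorial * (f v * v ^ k * Real.exp (-Real.exp a * v)) := by
    intro a v
    simp only [hsub]
    rw [mul_pow]
    ring_nf
  have gind : ∀ a v : ℝ, g v * Real.exp (-Real.exp a * v)
      = (Ioi (0 : ℝ)).indicator (fun v => f v * v ^ k * Real.exp (-Real.exp a * v)) v := by
    intro a v
    simp only [hg, indicator]
    split_ifs <;> simp
  have cpos : ∀ a : ℝ, Real.exp a ^ k / (k.factorial : ℝ) ≠ 0 := fun a => by positivity
  have I1 : ∀ a ∈ S, Integrable (fun v => g v * Real.exp (-Real.exp a * v)) := by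
    intro a ha
    have h := hint a ha
    rw [gm, integrable_withDensity_iff_integrable_smul' (by fun_prop) (by simp)] at h
    have h' := IntegrableOn.congr_fun h (dens a) measurableSet_Ioi
    have h2 := (integrableOn_Ioi_comp_mul_left_iff
      (fun r => r ^ k / k.factorial * Real.exp (-r) * f (Real.exp (-a) * r)) 0
      (Real.exp_pos a)).2 (by simpa using h')
    simp only [gind]
    rw [integrable_indicator_iff measurableSet_Ioi]
    have h3 := Integrable.congr h2 (Eventually.of_forall (scal a))
    exact (integrable_const_mul_iff (IsUnit.mk0 _ (cpos a)) _).1 h3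
  have I0 : ∀ a ∈ S, ∫ v, g v * Real.exp (-Real.exp a * v) = 0 := by
    intro a ha
    have h := h0 a ha
    rw [gm, integral_withDensity_eq_integral_toReal_smul (by fun_prop) (by simp),
      setIntegral_congr_fun measurableSet_Ioi (dens a)] at h
    have h2 := integral_comp_mul_left_Ioi
      (fun r => r ^ k / k.factorial * Real.exp (-r) * f (Real.exp (-a) * r)) 0
      (Real.exp_pos a)
    rw [mul_zero, h, smul_zero, integral_congr_ae (Eventually.of_forall (scal a)),
      integral_const_mul] at h2
    simp only [gind]
    rw [integral_indicator measurableSet_Ioi]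
    exact (mul_eq_zero.1 h2).resolve_left (cpos a)
  -- Only countably many points of S are isolated from the right, so the others form a non-null set
  -- and contain some a₁ < a₂. Integrability at a₁ opens the half-plane, and zeros at points of S
  -- accumulate at e^{a₂} inside it.
  set S' := {x ∈ S | 𝓝[S ∩ Ioi x] x ≠ ⊥} with hS'
  have hS'0 : volume S' ≠ 0 := by
    intro h
    apply hS
    have hc : {x ∈ S | 𝓝[S ∩ Ioi x] x = ⊥}.Countable :=
      countable_setOfPred_isolated_right_within
    refine measure_mono_null (t := S' ∪ {x ∈ S | 𝓝[S ∩ Ioi x] x = ⊥}) (fun x hx => ?_)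
      (measure_union_null h (hc.measure_zero _))
    by_cases hx' : 𝓝[S ∩ Ioi x] x = ⊥
    · exact Or.inr ⟨hx, hx'⟩
    · exact Or.inl ⟨hx, hx'⟩
  obtain ⟨a₁, ha₁, a₂, ha₂, h12⟩ : ∃ a₁ ∈ S', ∃ a₂ ∈ S', a₁ < a₂ := by
    have : S'.Nontrivial := by
      rw [← not_subsingleton_iff]
      exact fun h => hS'0 (h.measure_zero _)
    exact this.exists_lt
  have := ae_eq_zero_of_frequently_laplace_eq_zero hgm
    (fun v hv => indicator_of_notMem (notMem_Ioi.2 hv) _) (Real.exp_lt_exp.2 h12) (I1 a₁ ha₁.1) (by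
      have hT : Tendsto Real.exp (𝓝[S ∩ Ioi a₂] a₂) (𝓝[≠] (Real.exp a₂)) := by
        refine tendsto_nhdsWithin_iff.2 ⟨?_, ?_⟩
        · exact Real.continuous_exp.continuousAt.tendsto.mono_left nhdsWithin_le_nhds
        · filter_upwards [self_mem_nhdsWithin] with x hx
          exact (Real.exp_lt_exp.2 hx.2).ne'
      have : (𝓝[S ∩ Ioi a₂] a₂).NeBot := ⟨ha₂.2⟩
      refine hT.frequently (Eventually.frequently ?_)
      filter_upwards [self_mem_nhdsWithin] with x hx using I0 x hx.1)
  rw [ae_restrict_iff' measurableSet_Ioi]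
  filter_upwards [this] with v hv hv0
  rw [hg, indicator_of_mem hv0] at hv
  have : (0 : ℝ) < v := hv0
  exact (mul_eq_zero.1 hv).resolve_right (by positivity)

/-! ### Integrating out one coordinate of the complete data -/

section Pi

/-- Both integrands have the same marginal once coordinate i is integrated out, because c has mass
one along it. A coordinate can thus be integrated out without leaving the product space, which lets
all periods share one sample space. -/
lemma lintegral_pi_refresh {ι : Type*} [Fintype ι] [DecidableEq ι] {X : ι → Type*}
    [∀ i, MeasurableSpace (X i)] (μ : ∀ i, Measure (X i)) [∀ i, SigmaFinite (μ i)] (i : ι)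
    {F c : (∀ i, X i) → ℝ≥0∞} (hF : Measurable F) (hc : Measurable c)
    (h1 : ∀ w, ∫⁻ u, c (Function.update w i u) ∂(μ i) = 1) :
    ∫⁻ w, F w ∂(Measure.pi μ)
      = ∫⁻ w, (∫⁻ u, F (Function.update w i u) ∂(μ i)) * c w ∂(Measure.pi μ) := by
  have hm : Measurable fun w => ∫⁻ u, F (Function.update w i u) ∂(μ i) := by
    rw [← lmarginal_singleton]
    exact hF.lmarginal μ
  refine lintegral_eq_of_lmarginal_eq {i} hF (hm.mul hc) ?_
  rw [lmarginal_singleton, lmarginal_singleton]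
  ext w
  simp only [Function.update_idem]
  rw [lintegral_const_mul _ (by fun_prop), h1, mul_one]

lemma lintegral_pi_prod_eq_one {α : Type*} [MeasurableSpace α] : ∀ {n : ℕ}
    (μ : Fin n → Measure α) [∀ i, SigmaFinite (μ i)] (c : Fin n → α → ℝ≥0∞)
    (_ : ∀ t, Measurable (c t)) (_ : ∀ t, ∫⁻ u, c t u ∂(μ t) = 1),
    ∫⁻ y, ∏ t, c t (y t) ∂(Measure.pi μ) = 1
  | 0, μ, _, c, hc, h1 => by simp
  | n + 1, μ, _, c, hc, h1 => by
    have h := (measurePreserving_piFinSuccAbove μ 0).lintegral_comp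
      (f := fun q => c 0 q.1 * ∏ t : Fin n, c t.succ (q.2 t)) (by fun_prop)
    rw [lintegral_prod_mul (hc 0).aemeasurable
      (g := fun z : Fin n → α => ∏ t : Fin n, c t.succ (z t)) (Measurable.aemeasurable (by fun_prop)), h1, one_mul] at h
    simp only [Fin.prod_univ_succ]
    refine Eq.trans ?_ (h.trans ?_)
    · rfl
    exact lintegral_pi_prod_eq_one (fun t => μ t.succ) _ (fun t => hc t.succ) (fun t => h1 t.succ)

lemma lintegral_pi_head_mul {α : Type*} [MeasurableSpace α] {n : ℕ}
    (μ : Fin (n + 1) → Measure α) [∀ i, SigmaFinite (μ i)] {G : α → ℝ≥0∞} (hG : Measurable G)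
    (c : Fin n → α → ℝ≥0∞) (hc : ∀ t, Measurable (c t))
    (h1 : ∀ t, ∫⁻ u, c t u ∂(μ t.succ) = 1) :
    ∫⁻ y, G (y 0) * ∏ t, c t (y t.succ) ∂(Measure.pi μ) = ∫⁻ u, G u ∂(μ 0) := by
  have h := (measurePreserving_piFinSuccAbove μ 0).lintegral_comp
      (f := fun q => G q.1 * ∏ t : Fin n, c t (q.2 t)) (by fun_prop)
  rw [lintegral_prod_mul hG.aemeasurable
      (g := fun z : Fin n → α => ∏ t : Fin n, c t (z t)) (Measurable.aemeasurable (by fun_prop))] at h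
  have := lintegral_pi_prod_eq_one (fun t => μ t.succ) c hc h1
  exact h.trans (by simp only [Fin.zero_succAbove, this, mul_one])

end Pi

/-- Complete data `(y, x, a)`. -/
abbrev Data (T d : ℕ) := (Fin (T + 1) → ℝ) × (Fin T → (Fin d → ℝ)) × ℝ

variable {T m d : ℕ}

/-- Replace the outcome of a period. -/
def setY (t : Fin T) (w : Data T d) (u : ℝ) : Data T d := (Function.update w.1 t.succ u, w.2)

/-- Replace the regressor of a period. -/
def setX (t : Fin T) (w : Data T d) (v : Fin d → ℝ) : Data T d :=
  (w.1, Function.update w.2.1 t v, w.2.2)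

@[fun_prop]
lemma measurable_setY (t : Fin T) : Measurable fun q : Data T d × ℝ => setY t q.1 q.2 := by
  unfold setY
  refine Measurable.prodMk ?_ (by fun_prop)
  refine measurable_pi_lambda _ fun i => ?_
  by_cases h : i = t.succ
  · subst h; simpa using measurable_snd
  · simp only [Function.update_of_ne h]; fun_prop

@[fun_prop]
lemma measurable_setX (t : Fin T) :
    Measurable fun q : Data T d × (Fin d → ℝ) => setX t q.1 q.2 := by
  unfold setX
  refine Measurable.prodMk (by fun_prop) (Measurable.prodMk ?_ (by fun_prop))
  refine measurable_pi_lambda _ fun i => ?_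
  by_cases h : i = t
  · subst h; simpa using measurable_snd
  · simp only [Function.update_of_ne h]; fun_prop

lemma _root_.Measurable.setY {α : Type*} [MeasurableSpace α] (t : Fin T) {f : α → Data T d}
    {g : α → ℝ} (hf : Measurable f) (hg : Measurable g) : Measurable fun z => setY t (f z) (g z) :=
  (measurable_setY t).comp (hf.prodMk hg)

lemma _root_.Measurable.setX {α : Type*} [MeasurableSpace α] (t : Fin T) {f : α → Data T d}
    {g : α → Fin d → ℝ} (hf : Measurable f) (hg : Measurable g) :
    Measurable fun z => setX t (f z) (g z) :=
  (measurable_setX t).comp (hf.prodMk hg)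

instance (D : Design T d) (i : Fin (T + 1)) : SigmaFinite
    ((Fin.cons D.μ0 (fun _ : Fin T => volume.restrict (Set.Ioi (0 : ℝ))) :
      Fin (T + 1) → Measure ℝ) i) := by
  refine Fin.cases ?_ (fun j => ?_) i
  · exact D.sigmaFinite_μ0
  · simp only [Fin.cons_succ]; infer_instance

instance (D : Design T d) (i : Fin T) : SigmaFinite (D.μX i) := D.sigmaFinite_μX i

section Dominating
variable [NeZero T] (D : Design T d)

/-- The event that `(Y_0, X_1, A)` is in the support. -/
def Design.suppSet : Set (Data T d) := {w | (w.1 0, w.2.1 0, w.2.2) ∈ D.supp}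

lemma Design.measurableSet_suppSet : MeasurableSet D.suppSet := by
  have : Measurable fun w : Data T d => (w.1 0, w.2.1 0, w.2.2) := by fun_prop
  exact this D.measurableSet_supp

instance : SFinite D.dominating := by unfold Design.dominating; infer_instance

lemma setY_mem_suppSet (t : Fin T) (w : Data T d) (u : ℝ) :
    setY t w u ∈ D.suppSet ↔ w ∈ D.suppSet := by
  simp [Design.suppSet, setY, Function.update_of_ne (Fin.succ_ne_zero t).symm]

lemma setX_mem_suppSet (t : Fin T) (ht : 0 < t.val) (w : Data T d) (v : Fin d → ℝ) :
    setX t w v ∈ D.suppSet ↔ w ∈ D.suppSet := by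
  have : (0 : Fin T) ≠ t := fun h => by simp [← h] at ht
  simp [Design.suppSet, setX, Function.update_of_ne this]

lemma lintegral_dominating (F : Data T d → ℝ≥0∞) :
    ∫⁻ w, F w ∂D.dominating
      = ∫⁻ w, D.suppSet.indicator F w ∂((Measure.pi (Fin.cons D.μ0
        (fun _ : Fin T => volume.restrict (Set.Ioi (0 : ℝ))))).prod
          ((Measure.pi D.μX).prod volume)) := by
  rw [lintegral_indicator D.measurableSet_suppSet]
  rfl

/-- The support constrains only (y_0, x_1, a), so its indicator is constant along a spell coordinate
and factors out. -/
lemma lintegral_setY (t : Fin T) {F c : Data T d → ℝ≥0∞} (hF : Measurable F) (hc : Measurable c)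
    (h1 : ∀ w, ∫⁻ u in Ioi (0 : ℝ), c (setY t w u) = 1) :
    ∫⁻ w, F w ∂D.dominating
      = ∫⁻ w, (∫⁻ u in Ioi (0 : ℝ), F (setY t w u)) * c w ∂D.dominating := by
  have hm : Measurable fun w => ∫⁻ u in Ioi (0 : ℝ), F (setY t w u) :=
    Measurable.lintegral_prod_right' (f := fun q : Data T d × ℝ => F (setY t q.1 q.2))
      (by fun_prop)
  have hFi := hF.indicator D.measurableSet_suppSet
  have hmc : Measurable fun w => (∫⁻ u in Ioi (0 : ℝ), F (setY t w u)) * c w := hm.mul hc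
  rw [lintegral_dominating, lintegral_dominating, lintegral_prod_symm' _ hFi,
    lintegral_prod_symm' _ (hmc.indicator D.measurableSet_suppSet)]
  refine lintegral_congr fun q => ?_
  rw [lintegral_pi_refresh _ t.succ (F := fun y => D.suppSet.indicator F (y, q))
    (c := fun y => c (y, q)) (by fun_prop) (by fun_prop)
    (fun y => by rw [Fin.cons_succ]; exact h1 (y, q))]
  refine lintegral_congr fun y => ?_
  have : ∀ u, D.suppSet.indicator F (Function.update y t.succ u, q)
      = D.suppSet.indicator 1 (y, q) * F (setY t (y, q) u) := by
    intro u
    have := setY_mem_suppSet D t (y, q) u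
    by_cases h : (y, q) ∈ D.suppSet
    · rw [indicator_of_mem h, indicator_of_mem (by exact this.2 h)]; simp [setY]
    · rw [indicator_of_notMem h, indicator_of_notMem (by exact fun h' => h (this.1 h'))]; simp
  simp only [this, Fin.cons_succ]
  have hFs : Measurable fun v => F (setY t (y, q) v) :=
    hF.comp (measurable_const.setY t measurable_id)
  rw [lintegral_const_mul _ hFs]
  by_cases h : (y, q) ∈ D.suppSet <;> simp [h]

/-- The regressor of index 0 is excluded because the support constrains it. -/
lemma lintegral_setX (t : Fin T) (ht : 0 < t.val) {F c : Data T d → ℝ≥0∞} (hF : Measurable F)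
    (hc : Measurable c) (h1 : ∀ w, ∫⁻ v, c (setX t w v) ∂(D.μX t) = 1) :
    ∫⁻ w, F w ∂D.dominating
      = ∫⁻ w, (∫⁻ v, F (setX t w v) ∂(D.μX t)) * c w ∂D.dominating := by
  have hm : Measurable fun w => ∫⁻ v, F (setX t w v) ∂(D.μX t) :=
    Measurable.lintegral_prod_right' (f := fun q : Data T d × _ => F (setX t q.1 q.2))
      (by fun_prop)
  have hFi := hF.indicator D.measurableSet_suppSet
  have hmc : Measurable fun w => (∫⁻ v, F (setX t w v) ∂(D.μX t)) * c w := hm.mul hc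
  have hmi := hmc.indicator D.measurableSet_suppSet
  rw [lintegral_dominating, lintegral_dominating, lintegral_prod _ (by fun_prop),
    lintegral_prod _ (by fun_prop)]
  refine lintegral_congr fun y => ?_
  rw [lintegral_prod_symm' _ (by fun_prop), lintegral_prod_symm' _ (by fun_prop)]
  refine lintegral_congr fun a => ?_
  rw [lintegral_pi_refresh _ t (F := fun x => D.suppSet.indicator F (y, x, a))
    (c := fun x => c (y, x, a)) (by fun_prop) (by fun_prop)
    (fun x => h1 (y, x, a))]
  refine lintegral_congr fun x => ?_
  have : ∀ u, D.suppSet.indicator F (y, Function.update x t u, a)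
      = D.suppSet.indicator 1 (y, x, a) * F (setX t (y, x, a) u) := by
    intro u
    have := setX_mem_suppSet D t ht (y, x, a) u
    by_cases h : (y, x, a) ∈ D.suppSet
    · rw [indicator_of_mem h, indicator_of_mem (by exact this.2 h)]; simp [setX]
    · rw [indicator_of_notMem h, indicator_of_notMem (by exact fun h' => h (this.1 h'))]; simp
  simp only [this]
  have hFs : Measurable fun v => F (setX t (y, x, a) v) :=
    hF.comp (measurable_const.setX t measurable_id)
  rw [lintegral_const_mul _ hFs]
  by_cases h : (y, x, a) ∈ D.suppSet <;> simp [h]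

lemma ae_dominating_pos : ∀ᵐ w ∂D.dominating, ∀ t : Fin T, 0 < w.1 t.succ := by
  refine Measure.absolutelyContinuous_of_le Measure.restrict_le_self |>.ae_le ?_
  refine (Measure.quasiMeasurePreserving_fst (μ := Measure.pi (Fin.cons D.μ0
        (fun _ : Fin T => volume.restrict (Set.Ioi (0 : ℝ))) : Fin (T + 1) → Measure ℝ))).ae
          (p := fun y => ∀ t : Fin T, 0 < y t.succ) ?_
  refine ae_all_iff.2 fun t => ?_
  refine (Measure.tendsto_eval_ae_ae (μ := (Fin.cons D.μ0
    (fun _ : Fin T => volume.restrict (Set.Ioi (0 : ℝ))) : Fin (T + 1) → Measure ℝ))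
    (i := t.succ)).eventually (p := fun u : ℝ => 0 < u) ?_
  rw [Fin.cons_succ]
  exact ae_restrict_mem measurableSet_Ioi

lemma ae_dominating_suppSet : ∀ᵐ w ∂D.dominating, w ∈ D.suppSet :=
  ae_restrict_mem D.measurableSet_suppSet

/-- A null set meets almost every line in the direction of a spell in a null set. The exponential
density only serves as a positive reference density of mass one. -/
lemma ae_setY (t : Fin T) {p : Data T d → Prop} (hp : ∀ᵐ w ∂D.dominating, p w) :
    ∀ᵐ w ∂D.dominating, ∀ᵐ u ∂(volume.restrict (Ioi (0 : ℝ))), p (setY t w u) := by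
  set N := toMeasurable D.dominating {w | ¬ p w}
  have hN : MeasurableSet N := measurableSet_toMeasurable _ _
  have hN0 : D.dominating N = 0 := by rw [measure_toMeasurable]; exact hp
  have e1 : ∫⁻ u in Ioi (0 : ℝ), ENNReal.ofReal (Real.exp (-u)) = 1 := by
    have := measure_univ (μ := gm 1)
    rwa [gm_one, withDensity_apply _ MeasurableSet.univ, Measure.restrict_univ] at this
  have hm : Measurable fun w => ∫⁻ u in Ioi (0 : ℝ), N.indicator (1 : Data T d → ℝ≥0∞) (setY t w u) :=
    Measurable.lintegral_prod_right' (f := fun q : Data T d × ℝ => N.indicator 1 (setY t q.1 q.2))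
      ((measurable_one.indicator hN).comp (measurable_setY t))
  have h := lintegral_setY D t (F := N.indicator 1)
    (c := fun w => ENNReal.ofReal (Real.exp (-w.1 t.succ))) (measurable_one.indicator hN)
    (by fun_prop) (fun w => by simpa [setY] using e1)
  have hmc : Measurable fun w : Data T d => (∫⁻ u in Ioi (0 : ℝ),
      N.indicator (1 : Data T d → ℝ≥0∞) (setY t w u))
        * ENNReal.ofReal (Real.exp (-w.1 t.succ)) := hm.mul (by fun_prop)
  rw [lintegral_indicator_one hN, hN0, eq_comm, lintegral_eq_zero_iff hmc] at h
  filter_upwards [h] with w hw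
  have : ∫⁻ u in Ioi (0 : ℝ), N.indicator (1 : Data T d → ℝ≥0∞) (setY t w u) = 0 := by
    refine (mul_eq_zero.1 hw).resolve_right ?_
    simp [Real.exp_pos]
  have hms : Measurable fun u => N.indicator (1 : Data T d → ℝ≥0∞) (setY t w u) :=
    (measurable_one.indicator hN).comp (measurable_const.setY t measurable_id)
  rw [lintegral_eq_zero_iff hms] at this
  filter_upwards [this] with u hu
  by_contra hp'
  simp at hu
  exact hu (subset_toMeasurable _ _ hp')

/-- The measure of a regressor need not be finite; the feedback density at a frozen history supplies
a positive reference density of mass one. -/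
lemma ae_setX (ω : Nuisance D) (t : Fin T) (ht : 0 < t.val) {p : Data T d → Prop}
    (hp : ∀ᵐ w ∂D.dominating, p w) :
    ∀ᵐ w ∂D.dominating, ∀ᵐ v ∂(D.μX t), p (setX t w v) := by
  set N := toMeasurable D.dominating {w | ¬ p w}
  have hN : MeasurableSet N := measurableSet_toMeasurable _ _
  have hN0 : D.dominating N = 0 := by rw [measure_toMeasurable]; exact hp
  have hg : Measurable fun v => ω.g t 0 0 0 v :=
    (ω.measurable_g t ht).comp (f := fun v => (0, 0, 0, v)) (by fun_prop)
  have hm : Measurable fun w => ∫⁻ v, N.indicator (1 : Data T d → ℝ≥0∞) (setX t w v) ∂(D.μX t) :=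
    Measurable.lintegral_prod_right' (f := fun q : Data T d × _ => N.indicator 1 (setX t q.1 q.2))
      ((measurable_one.indicator hN).comp (measurable_setX t))
  have hc : Measurable fun w : Data T d => ENNReal.ofReal (ω.g t 0 0 0 (w.2.1 t)) :=
    (hg.comp (f := fun w : Data T d => w.2.1 t) (by fun_prop)).ennreal_ofReal
  have h := lintegral_setX D t ht (F := N.indicator 1)
    (c := fun w => ENNReal.ofReal (ω.g t 0 0 0 (w.2.1 t))) (measurable_one.indicator hN)
    hc (fun w => by simpa [setX] using ω.lintegral_g t ht 0 0 0)
  have hmc : Measurable fun w : Data T d => (∫⁻ v,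
      N.indicator (1 : Data T d → ℝ≥0∞) (setX t w v) ∂(D.μX t))
        * ENNReal.ofReal (ω.g t 0 0 0 (w.2.1 t)) := hm.mul hc
  rw [lintegral_indicator_one hN, hN0, eq_comm, lintegral_eq_zero_iff hmc] at h
  filter_upwards [h] with w hw
  have : ∫⁻ v, N.indicator (1 : Data T d → ℝ≥0∞) (setX t w v) ∂(D.μX t) = 0 := by
    refine (mul_eq_zero.1 hw).resolve_right ?_
    simp [ω.g_pos t ht]
  have hms : Measurable fun u => N.indicator (1 : Data T d → ℝ≥0∞) (setX t w u) :=
    (measurable_one.indicator hN).comp (measurable_const.setX t measurable_id)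
  rw [lintegral_eq_zero_iff hms] at this
  filter_upwards [this] with u hu
  by_contra hp'
  simp at hu
  exact hu (subset_toMeasurable _ _ hp')

end Dominating

/-! ### Dependence on histories -/

/-- Two data points share the outcomes up to index `i` and the regressors before index `j`. -/
def Agree (i j : ℕ) (w w' : Data T d) : Prop :=
  (∀ l : Fin (T + 1), l.val ≤ i → w.1 l = w'.1 l) ∧ ∀ l : Fin T, l.val < j → w.2.1 l = w'.2.1 l

lemma Agree.mono {i j i' j' : ℕ} {w w' : Data T d} (h : Agree i j w w') (hi : i' ≤ i)
    (hj : j' ≤ j) : Agree i' j' w w' :=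
  ⟨fun l hl => h.1 l (hl.trans hi), fun l hl => h.2 l (hl.trans_le hj)⟩

lemma agree_setY {t : Fin T} {i j : ℕ} (h : i ≤ t.val) (w : Data T d) (u : ℝ) :
    Agree i j (setY t w u) w := by
  refine ⟨fun l hl => ?_, fun _ _ => rfl⟩
  have : l ≠ t.succ := fun h' => by simp [h'] at hl; omega
  simp [setY, this]

lemma agree_setX {t : Fin T} {i j : ℕ} (h : j ≤ t.val) (w : Data T d) (v : Fin d → ℝ) :
    Agree i j (setX t w v) w := by
  refine ⟨fun _ _ => rfl, fun l hl => ?_⟩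
  have : l ≠ t := fun h' => by simp [h'] at hl; omega
  simp [setX, this]

lemma Agree.setY {t : Fin T} {i j : ℕ} {w w' : Data T d} (h : Agree i j w w') (hi : t.val ≤ i)
    (u : ℝ) : Agree (t.val + 1) j (setY t w u) (setY t w' u) := by
  refine ⟨fun l hl => ?_, h.2⟩
  by_cases hl' : l = t.succ
  · simp [MPH.setY, hl']
  · have h3 : l.val ≠ t.val + 1 := fun h' => hl' (Fin.ext (by simpa using h'))
    simp only [MPH.setY, Function.update_of_ne hl']
    exact h.1 l (by omega)

lemma Agree.setX {t : Fin T} {i j : ℕ} {w w' : Data T d} (h : Agree i j w w') (hj : t.val ≤ j)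
    (v : Fin d → ℝ) : Agree i (t.val + 1) (setX t w v) (setX t w' v) := by
  refine ⟨h.1, fun l hl => ?_⟩
  by_cases hl' : l = t
  · simp [MPH.setX, hl']
  · have h3 : l.val ≠ t.val := fun h' => hl' (Fin.ext h')
    simp only [MPH.setX, Function.update_of_ne hl']
    exact h.2 l (by omega)

/-- `F` depends on the outcomes up to index `i`, on the regressors before index `j`, and on the
heterogeneity. -/
def DepOn {β : Type*} (i j : ℕ) (F : Data T d → β) : Prop :=
  ∀ w w', Agree i j w w' → w.2.2 = w'.2.2 → F w = F w'

lemma DepOn.mono {β : Type*} {i j i' j' : ℕ} {F : Data T d → β} (h : DepOn i j F) (hi : i ≤ i')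
    (hj : j ≤ j') : DepOn i' j' F := fun w w' h1 h2 => h w w' (h1.mono hi hj) h2

/-- `F` depends on the outcomes up to index `i` and on the regressors before index `j`. -/
def DepOnObs {β : Type*} (i j : ℕ) (F : Data T d → β) : Prop :=
  ∀ w w', Agree i j w w' → F w = F w'

lemma DepOnObs.depOn {β : Type*} {i j : ℕ} {F : Data T d → β} (h : DepOnObs i j F) :
    DepOn i j F := fun w w' h1 _ => h w w' h1

/-- The factor of the hazard of a period that does not involve the heterogeneity. -/
noncomputable def rate (θ : Param m d) (t : Fin T) (w : Data T d) : ℝ :=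
  Real.exp (θ.γ * w.1 t.castSucc + dotProduct (w.2.1 t) θ.β)

lemma rate_pos (θ : Param m d) (t : Fin T) (w : Data T d) : 0 < rate θ t w := Real.exp_pos _

@[fun_prop]
lemma measurable_rate (θ : Param m d) (t : Fin T) : Measurable (rate (T := T) θ t) := by
  unfold rate dotProduct; fun_prop

lemma Agree.rate_eq {i j : ℕ} {w w' : Data T d} (h : Agree i j w w') (θ : Param m d) (t : Fin T)
    (hi : t.val ≤ i) (hj : t.val < j) : rate θ t w = rate θ t w' := by
  rw [rate, rate, h.1 _ (by simpa using hi), h.2 _ hj]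

/-- The density of a spell with rate `c`. -/
noncomputable def spellPDF (lam : ℝ → ℝ) (c u : ℝ) : ℝ≥0∞ :=
  ENNReal.ofReal (lam u * c * Real.exp (-(cumHaz lam u * c)))

lemma density_eq (lam : (Fin m → ℝ) → ℝ → ℝ) (θ : Param m d) (t : Fin T) (w : Data T d) (u : ℝ) :
    density lam θ u (w.1 t.castSucc) (w.2.1 t) w.2.2
      = lam θ.α u * (rate θ t w * Real.exp w.2.2)
        * Real.exp (-(cumHaz (lam θ.α) u * (rate θ t w * Real.exp w.2.2))) := by
  simp only [density, rho, rate, cumHaz, Real.exp_add]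
  ring_nf

lemma lintegral_spellPDF {lam : ℝ → ℝ} (h : IsBaselineHazard lam) {c : ℝ} (hc : 0 < c) :
    ∫⁻ u in Ioi (0 : ℝ), spellPDF lam c u = 1 := by
  have h1 := h.spell_eq_map hc
  have hi := h.measurable_cumHazInv
  have h2 : ((gm 1).map (fun e => cumHazInv lam (c⁻¹ * e))) univ = 1 := by
    rw [Measure.map_apply (by fun_prop) MeasurableSet.univ]; simp
  rwa [← h1, withDensity_apply _ MeasurableSet.univ, Measure.restrict_univ] at h2

lemma take_setY {t s : Fin T} (h : s.val < t.val + 1) (w : Data T d) (u : ℝ) :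
    take (Nat.succ_le_succ s.isLt.le) (setY t w u).1 = take (Nat.succ_le_succ s.isLt.le) w.1 := by
  ext l
  have : (Fin.castLE (Nat.succ_le_succ s.isLt.le) l) ≠ t.succ := fun h' => by
    have := congrArg Fin.val h'
    simp at this
    omega
  simp [take, setY, this]

lemma take_setX {t s : Fin T} (h : s.val ≤ t.val) (w : Data T d) (v : Fin d → ℝ) :
    take s.isLt.le (setX t w v).2.1 = take s.isLt.le w.2.1 := by
  ext l
  have : (Fin.castLE s.isLt.le l) ≠ t := fun h' => by
    have := congrArg Fin.val h'
    simp at this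
    omega
  simp [take, setX, this]

/-! ### Likelihoods truncated at a period -/

section Lik
variable [NeZero T] {D : Design T d}

/-- The likelihood with the densities of the outcomes with `i ≤ t` and of the regressors with
`j ≤ t` replaced by fixed reference densities. -/
noncomputable def partialLik (lam : (Fin m → ℝ) → ℝ → ℝ) (θ : Param m d) (ω : Nuisance D)
    (i j : ℕ) (w : Data T d) : ℝ≥0∞ :=
  (∏ t : Fin T, spellPDF (lam θ.α)
      (if t.val < i then rate θ t w * Real.exp w.2.2 else 1) (w.1 t.succ))
    * (∏ t : Fin T, if t.val = 0 then 1 else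
        if t.val < j then ENNReal.ofReal (ω.g t (take (Nat.succ_le_succ t.isLt.le) w.1)
          (take t.isLt.le w.2.1) w.2.2 (w.2.1 t)) else ENNReal.ofReal (ω.g t 0 0 0 (w.2.1 t)))
    * ENNReal.ofReal (ω.π (w.1 0) (w.2.1 0) w.2.2) * ENNReal.ofReal (ω.ν (w.1 0) (w.2.1 0))

lemma measurable_take {E : Type*} [MeasurableSpace E] {n k : ℕ} (h : k ≤ n) :
    Measurable (take h : (Fin n → E) → Fin k → E) :=
  measurable_pi_lambda _ fun _ => measurable_pi_apply _

lemma measurable_feedback (ω : Nuisance D) (t : Fin T) (ht : 0 < t.val) :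
    Measurable fun w : Data T d => ω.g t (take (Nat.succ_le_succ t.isLt.le) w.1)
          (take t.isLt.le w.2.1) w.2.2 (w.2.1 t) :=
  (ω.measurable_g t ht).comp (f := fun w : Data T d => (take (Nat.succ_le_succ t.isLt.le) w.1,
          take t.isLt.le w.2.1, w.2.2, w.2.1 t))
    (((measurable_take _).comp measurable_fst).prodMk
      (((measurable_take _).comp (by fun_prop)).prodMk (by fun_prop)))

lemma measurable_feedback_ref (ω : Nuisance D) (t : Fin T) (ht : 0 < t.val) :
    Measurable fun v => ω.g t 0 0 0 v :=
  (ω.measurable_g t ht).comp (f := fun v => (0, 0, 0, v)) (by fun_prop)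

lemma measurable_spellPDF {lam : ℝ → ℝ} (h : Measurable lam) :
    Measurable (Function.uncurry (spellPDF lam)) := by
  have := measurable_cumHaz h
  unfold spellPDF Function.uncurry
  fun_prop

lemma measurable_partialLik {lam : (Fin m → ℝ) → ℝ → ℝ} {θ : Param m d}
    (hlam : IsBaselineHazard (lam θ.α)) (ω : Nuisance D) (i j : ℕ) :
    Measurable (partialLik lam θ ω i j) := by
  have h1 := measurable_spellPDF hlam.measurable
  have hπ : Measurable fun w : Data T d => ω.π (w.1 0) (w.2.1 0) w.2.2 :=
    ω.measurable_π.comp (f := fun w : Data T d => (w.1 0, w.2.1 0, w.2.2)) (by fun_prop)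
  have hν : Measurable fun w : Data T d => ω.ν (w.1 0) (w.2.1 0) :=
    ω.measurable_ν.comp (f := fun w : Data T d => (w.1 0, w.2.1 0)) (by fun_prop)
  unfold partialLik
  refine Measurable.mul (Measurable.mul (Measurable.mul ?_ ?_) hπ.ennreal_ofReal)
    hν.ennreal_ofReal
  · refine Finset.measurable_fun_prod _ fun t _ => ?_
    refine h1.comp (f := fun w : Data T d => ((if t.val < i then rate θ t w * Real.exp w.2.2 else 1),
      (w.1 t.succ))) (Measurable.prodMk ?_ (by fun_prop))
    split_ifs <;> fun_prop
  · refine Finset.measurable_fun_prod _ fun t _ => ?_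
    split_ifs with h0 hj
    · fun_prop
    · exact (measurable_feedback ω t (Nat.pos_of_ne_zero h0)).ennreal_ofReal
    · exact ((measurable_feedback_ref ω t (Nat.pos_of_ne_zero h0)).comp
        (f := fun w : Data T d => w.2.1 t) (by fun_prop)).ennreal_ofReal

lemma prod_mul_eq_mul_prod {ι : Type*} [Fintype ι] [DecidableEq ι] {F G : ι → ℝ≥0∞} (t : ι)
    (h : ∀ s, s ≠ t → F s = G s) : (∏ s, F s) * G t = F t * ∏ s, G s := by
  rw [← Finset.mul_prod_erase _ F (Finset.mem_univ t), ← Finset.mul_prod_erase _ G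
    (Finset.mem_univ t), Finset.prod_congr rfl fun s hs => h s (Finset.ne_of_mem_erase hs)]
  ring

/-- The two likelihoods differ in one factor: the other rates and the feedback densities up to index
t do not involve this outcome, and the later factors are reference densities. Cross-multiplication
avoids division in `ℝ≥0∞`. -/
lemma partialLik_setY (lam : (Fin m → ℝ) → ℝ → ℝ) (θ : Param m d) (ω : Nuisance D) (t : Fin T)
    (w : Data T d) (u : ℝ) :
    partialLik lam θ ω (t.val + 1) (t.val + 1) (setY t w u) * spellPDF (lam θ.α) 1 (w.1 t.succ)
      = spellPDF (lam θ.α) (rate θ t w * Real.exp w.2.2) u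
        * partialLik lam θ ω t.val (t.val + 1) w := by
  have hr : ∀ s : Fin T, s.val ≤ t.val → rate θ s (setY t w u) = rate θ s w := fun s hs =>
    (agree_setY (j := T) le_rfl w u).rate_eq θ s hs s.isLt
  have h1 := prod_mul_eq_mul_prod t
    (F := fun s : Fin T => spellPDF (lam θ.α)
      (if s.val < t.val + 1 then rate θ s (setY t w u) * Real.exp (setY t w u).2.2 else 1)
      ((setY t w u).1 s.succ))
    (G := fun s : Fin T => spellPDF (lam θ.α)
      (if s.val < t.val then rate θ s w * Real.exp w.2.2 else 1) (w.1 s.succ)) (by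
      intro s hs
      have hs' : s.val ≠ t.val := fun h => hs (Fin.ext h)
      have : (setY t w u).1 s.succ = w.1 s.succ := by simp [setY, hs]
      simp only [this]
      rcases lt_or_ge s.val t.val with h | h
      · rw [if_pos (by omega), if_pos h, hr s h.le]; rfl
      · rw [if_neg (by omega), if_neg (by omega)])
  have h2 : (∏ s : Fin T, if s.val = 0 then 1 else
        if s.val < t.val + 1 then ENNReal.ofReal (ω.g s (take (Nat.succ_le_succ s.isLt.le)
          (setY t w u).1) (take s.isLt.le (setY t w u).2.1) (setY t w u).2.2
            ((setY t w u).2.1 s)) else ENNReal.ofReal (ω.g s 0 0 0 ((setY t w u).2.1 s)))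
      = ∏ s : Fin T, if s.val = 0 then 1 else
        if s.val < t.val + 1 then ENNReal.ofReal (ω.g s (take (Nat.succ_le_succ s.isLt.le) w.1)
          (take s.isLt.le w.2.1) w.2.2 (w.2.1 s)) else ENNReal.ofReal (ω.g s 0 0 0 (w.2.1 s)) := by
    refine Finset.prod_congr rfl fun s _ => ?_
    split_ifs with h0 h
    · rfl
    · rw [take_setY h]; rfl
    · rfl
  have h3 : (setY t w u).1 0 = w.1 0 := by
    simp [setY, Function.update_of_ne (Fin.succ_ne_zero t).symm]
  simp only [lt_irrefl, if_false, Nat.lt_succ_self, if_true, hr t le_rfl] at h1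
  simp only [partialLik, h2, h3]
  have h4 : (setY t w u).1 t.succ = u := by simp [setY]
  rw [h4] at h1
  simp only [setY] at h1 ⊢
  rw [mul_right_comm _ _ (spellPDF _ _ _), mul_right_comm _ _ (spellPDF _ _ _),
    mul_right_comm _ _ (spellPDF _ _ _), h1]
  simp only [mul_assoc]

/-- Only the feedback factor of index t changes, since the true spell densities retained have
smaller index. -/
lemma partialLik_setX (lam : (Fin m → ℝ) → ℝ → ℝ) (θ : Param m d) (ω : Nuisance D) (t : Fin T)
    (ht : 0 < t.val) (w : Data T d) (v : Fin d → ℝ) :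
    partialLik lam θ ω t.val (t.val + 1) (setX t w v) * ENNReal.ofReal (ω.g t 0 0 0 (w.2.1 t))
      = ENNReal.ofReal (ω.g t (take (Nat.succ_le_succ t.isLt.le) w.1)
          (take t.isLt.le w.2.1) w.2.2 v) * partialLik lam θ ω t.val t.val w := by
  have hr : ∀ s : Fin T, s.val < t.val → rate θ s (setX t w v) = rate θ s w := fun s hs =>
    (agree_setX (i := T) le_rfl w v).rate_eq θ s s.isLt.le hs
  have h1 : (∏ s : Fin T, spellPDF (lam θ.α)
      (if s.val < t.val then rate θ s (setX t w v) * Real.exp (setX t w v).2.2 else 1)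
      ((setX t w v).1 s.succ)) = ∏ s : Fin T, spellPDF (lam θ.α)
      (if s.val < t.val then rate θ s w * Real.exp w.2.2 else 1) (w.1 s.succ) := by
    refine Finset.prod_congr rfl fun s _ => ?_
    split_ifs with h
    · rw [hr s h]; rfl
    · rfl
  have h2 := prod_mul_eq_mul_prod t (F := fun s : Fin T => if s.val = 0 then 1 else
        if s.val < t.val + 1 then ENNReal.ofReal (ω.g s (take (Nat.succ_le_succ s.isLt.le)
          (setX t w v).1) (take s.isLt.le (setX t w v).2.1) (setX t w v).2.2
            ((setX t w v).2.1 s)) else ENNReal.ofReal (ω.g s 0 0 0 ((setX t w v).2.1 s)))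
      (G := fun s : Fin T => if s.val = 0 then 1 else
        if s.val < t.val then ENNReal.ofReal (ω.g s (take (Nat.succ_le_succ s.isLt.le) w.1)
          (take s.isLt.le w.2.1) w.2.2 (w.2.1 s)) else ENNReal.ofReal (ω.g s 0 0 0 (w.2.1 s))) (by
    intro s hs
    have hs' : s.val ≠ t.val := fun h => hs (Fin.ext h)
    have hv : (setX t w v).2.1 s = w.2.1 s := by simp [setX, hs]
    simp only [hv]
    by_cases h0 : s.val = 0
    · rw [if_pos h0, if_pos h0]
    rw [if_neg h0, if_neg h0]
    rcases lt_or_ge s.val t.val with h | h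
    · rw [if_pos (by omega), if_pos h, take_setX h.le]; rfl
    · rw [if_neg (by omega), if_neg (by omega)])
  have h0 : (0 : Fin T) ≠ t := fun h => by simp [← h] at ht
  have h3 : (setX t w v).2.1 0 = w.2.1 0 := by simp [setX, Function.update_of_ne h0]
  have h4 : (setX t w v).2.1 t = v := by simp [setX]
  simp only [lt_irrefl, if_false, Nat.lt_succ_self, if_true, ht.ne', take_setX le_rfl, h4] at h2
  simp only [partialLik, h1, h3]
  simp only [setX] at h2 ⊢
  rw [mul_right_comm _ _ (ENNReal.ofReal (ω.g t 0 0 0 (w.2.1 t))),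
    mul_right_comm _ _ (ENNReal.ofReal (ω.g t 0 0 0 (w.2.1 t))),
    mul_assoc _ _ (ENNReal.ofReal (ω.g t 0 0 0 (w.2.1 t))), h2]
  simp only [mul_assoc, mul_left_comm _ (ENNReal.ofReal (ω.g t _ _ _ v))]

lemma partialLik_zero (lam : (Fin m → ℝ) → ℝ → ℝ) (θ : Param m d) (ω : Nuisance D) (w : Data T d) :
    partialLik lam θ ω 0 1 w = partialLik lam θ ω 0 0 w := by
  unfold partialLik
  congr 3
  refine Finset.prod_congr rfl fun s _ => ?_
  by_cases h0 : s.val = 0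
  · simp [h0]
  · simp [h0]

lemma likelihood_eq {lam : (Fin m → ℝ) → ℝ → ℝ} {θ : Param m d}
    (hlam : IsBaselineHazard (lam θ.α)) (ω : Nuisance D) {w : Data T d}
    (hw : ∀ t : Fin T, 0 < w.1 t.succ) :
    ENNReal.ofReal (likelihood lam θ ω w.1 w.2.1 w.2.2) = partialLik lam θ ω T T w := by
  have hd : ∀ t : Fin T, 0 ≤ density lam θ (w.1 t.succ) (w.1 t.castSucc) (w.2.1 t) w.2.2 := by
    intro t
    have := hlam.pos _ (hw t)
    unfold density
    positivity
  have hg : 0 ≤ ∏ t : Fin T with 0 < t.val,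
        ω.g t (take (Nat.succ_le_succ t.isLt.le) w.1) (take t.isLt.le w.2.1) w.2.2 (w.2.1 t) :=
    Finset.prod_nonneg fun t ht => (ω.g_pos t (by simpa using ht) _ _ _ _).le
  have hp := Finset.prod_nonneg (s := Finset.univ) fun t _ => hd t
  rw [likelihood, ENNReal.ofReal_mul (mul_nonneg (mul_nonneg hp hg) (ω.π_nonneg _ _ _)),
    ENNReal.ofReal_mul (mul_nonneg hp hg), ENNReal.ofReal_mul hp, partialLik,
    ENNReal.ofReal_prod_of_nonneg (fun t _ => hd t),
    ENNReal.ofReal_prod_of_nonneg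
      (fun t ht => (ω.g_pos t (by simpa using ht) _ _ _ _).le), Finset.prod_filter]
  congr 3
  · refine Finset.prod_congr rfl fun t _ => ?_
    rw [if_pos t.isLt, density_eq]; rfl
  · refine Finset.prod_congr rfl fun t _ => ?_
    rcases Nat.eq_zero_or_pos t.val with h | h
    · rw [if_neg (by omega), if_pos h]
    · rw [if_pos h, if_neg (by omega), if_pos t.isLt]

lemma law_eq {lam : (Fin m → ℝ) → ℝ → ℝ} {θ : Param m d}
    (hlam : IsBaselineHazard (lam θ.α)) (ω : Nuisance D) :
    law lam θ ω = D.dominating.withDensity (partialLik lam θ ω T T) := by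
  refine withDensity_congr_ae ?_
  filter_upwards [ae_dominating_pos D] with w hw using likelihood_eq hlam ω hw

/-- The likelihood is strictly positive on the support at positive spells, so the law and the
dominating measure have the same null sets. This links the robustness conditions to the almost sure
statements of the decomposition. -/
lemma ae_law_iff {lam : (Fin m → ℝ) → ℝ → ℝ} {θ : Param m d}
    (hlam : IsBaselineHazard (lam θ.α)) (ω : Nuisance D) {p : Data T d → Prop} :
    (∀ᵐ w ∂(law lam θ ω), p w) ↔ ∀ᵐ w ∂D.dominating, p w := by
  rw [law_eq hlam]
  constructor
  · refine fun h => (withDensity_absolutelyContinuous'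
      (measurable_partialLik hlam ω T T).aemeasurable ?_).ae_le h
    filter_upwards [ae_dominating_pos D, ae_dominating_suppSet D] with w hw hs
    rw [Ne, ← likelihood_eq hlam ω hw, ENNReal.ofReal_eq_zero, not_le]
    obtain ⟨hν, hπ⟩ := (ω.mem_supp_iff _ _ _).1 hs
    refine mul_pos (mul_pos (mul_pos ?_ ?_) hπ) hν
    · refine Finset.prod_pos fun t _ => ?_
      have := hlam.pos _ (hw t)
      unfold density
      positivity
    · exact Finset.prod_pos fun t ht => ω.g_pos t (by simpa using ht) _ _ _ _
  · exact fun h => (withDensity_absolutelyContinuous _ _).ae_le h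

end Lik

/-! ### Generalized residuals as coordinates -/

/-- Replace the outcome of a period by the one whose generalized residual is `p`. -/
noncomputable def draw (lam : (Fin m → ℝ) → ℝ → ℝ) (θ : Param m d) (t : Fin T) (w : Data T d)
    (p : ℝ) : Data T d :=
  setY t w (cumHazInv (lam θ.α) ((rate θ t w)⁻¹ * p))

/-- The sum of the generalized residuals from index `s` onwards. -/
noncomputable def tailSum (lam : (Fin m → ℝ) → ℝ → ℝ) (θ : Param m d) (s : ℕ) (w : Data T d) : ℝ :=
  ∑ l : Fin T with s ≤ l.val, P lam θ w.1 w.2.1 l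

section Basic
variable {lam : (Fin m → ℝ) → ℝ → ℝ} {θ : Param m d}

lemma P_eq (w : Data T d) (t : Fin T) :
    P lam θ w.1 w.2.1 t = cumHaz (lam θ.α) (w.1 t.succ) * rate θ t w := rfl

lemma measurable_P (hlam : IsBaselineHazard (lam θ.α)) (t : Fin T) :
    Measurable fun w : Data T d => P lam θ w.1 w.2.1 t := by
  have := measurable_cumHaz hlam.measurable
  simp only [P_eq]
  fun_prop

lemma measurable_tailSum (hlam : IsBaselineHazard (lam θ.α)) (s : ℕ) :
    Measurable (tailSum (T := T) lam θ s) :=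
  Finset.measurable_fun_sum _ fun t _ => measurable_P hlam t

lemma tailSum_of_le {s : ℕ} (hs : T ≤ s) (w : Data T d) : tailSum lam θ s w = 0 := by
  rw [tailSum, Finset.filter_false_of_mem fun l _ => by have := l.isLt; omega, Finset.sum_empty]

lemma tailSum_eq_add (t : Fin T) (w : Data T d) :
    tailSum lam θ t.val w = P lam θ w.1 w.2.1 t + tailSum lam θ (t.val + 1) w := by
  have : (Finset.univ.filter fun l : Fin T => t.val ≤ l.val)
      = insert t (Finset.univ.filter fun l : Fin T => t.val + 1 ≤ l.val) := by
    ext l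
    simp [Fin.ext_iff]
    omega
  rw [tailSum, tailSum, this, Finset.sum_insert (by simp)]

lemma tailSum_eq_sum_Ici (t : Fin T) (w : Data T d) :
    tailSum lam θ t.val w = ∑ s ∈ Finset.Ici t, P lam θ w.1 w.2.1 s := by
  rw [tailSum]
  refine Finset.sum_congr ?_ fun _ _ => rfl
  ext l
  simp only [Finset.mem_filter, Finset.mem_univ, true_and, Finset.mem_Ici, Fin.le_def]

lemma tailSum_zero (w : Data T d) : tailSum lam θ 0 w = Pbar lam θ w.1 w.2.1 := by
  simp [tailSum, Pbar]

lemma Agree.P_eq {i j : ℕ} {w w' : Data T d} (h : Agree i j w w') (t : Fin T)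
    (hi : t.val + 1 ≤ i) (hj : t.val < j) : P lam θ w.1 w.2.1 t = P lam θ w'.1 w'.2.1 t := by
  rw [MPH.P_eq, MPH.P_eq, h.rate_eq θ t (by omega) hj, h.1 t.succ (by simpa using hi)]

lemma agree_draw {t : Fin T} {i j : ℕ} (h : i ≤ t.val) (w : Data T d) (p : ℝ) :
    Agree i j (draw lam θ t w p) w := agree_setY h w _

lemma Agree.draw {t : Fin T} {i j : ℕ} {w w' : Data T d} (h : Agree i j w w') (hi : t.val ≤ i)
    (hj : t.val < j) (p : ℝ) :
    Agree (t.val + 1) j (draw lam θ t w p) (draw lam θ t w' p) := by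
  rw [MPH.draw, MPH.draw, h.rate_eq θ t hi hj]
  exact h.setY hi _

lemma P_draw (hlam : IsBaselineHazard (lam θ.α)) (t : Fin T) (w : Data T d) {p : ℝ} (hp : 0 < p) :
    P lam θ (draw lam θ t w p).1 (draw lam θ t w p).2.1 t = p := by
  have h1 := rate_pos θ t w
  rw [P_eq, (agree_draw (j := T) le_rfl w p).rate_eq θ t le_rfl t.isLt]
  simp only [draw, setY, Function.update_self]
  rw [hlam.cumHaz_cumHazInv (by positivity)]
  field_simp

lemma draw_P (hlam : IsBaselineHazard (lam θ.α)) (t : Fin T) (w : Data T d)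
    (hw : 0 < w.1 t.succ) : draw lam θ t w (P lam θ w.1 w.2.1 t) = w := by
  have h1 := rate_pos θ t w
  rw [draw, P_eq, mul_comm, mul_assoc, mul_inv_cancel₀ h1.ne', mul_one, hlam.cumHazInv_cumHaz hw]
  simp [setY]

lemma P_pos (hlam : IsBaselineHazard (lam θ.α)) (t : Fin T) (w : Data T d)
    (hw : 0 < w.1 t.succ) : 0 < P lam θ w.1 w.2.1 t :=
  mul_pos (hlam.cumHaz_pos hw) (rate_pos θ t w)

lemma draw_pos (hlam : IsBaselineHazard (lam θ.α)) (t : Fin T) (w : Data T d) {p : ℝ}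
    (hp : 0 < p) : 0 < (draw lam θ t w p).1 t.succ := by
  have h1 := rate_pos θ t w
  simp only [draw, setY, Function.update_self]
  exact hlam.cumHazInv_pos (by positivity)

lemma tailSum_nonneg (hlam : IsBaselineHazard (lam θ.α)) (s : ℕ) (w : Data T d)
    (hw : ∀ t : Fin T, 0 < w.1 t.succ) : 0 ≤ tailSum lam θ s w :=
  Finset.sum_nonneg fun t _ => (P_pos hlam t w (hw t)).le

lemma tailSum_pos (hlam : IsBaselineHazard (lam θ.α)) (t : Fin T) (w : Data T d)
    (hw : ∀ t : Fin T, 0 < w.1 t.succ) : 0 < tailSum lam θ t.val w := by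
  rw [tailSum_eq_add]
  exact add_pos_of_pos_of_nonneg (P_pos hlam t w (hw t)) (tailSum_nonneg hlam _ w hw)

lemma measurable_draw (hlam : IsBaselineHazard (lam θ.α)) (t : Fin T) :
    Measurable fun q : Data T d × ℝ => draw lam θ t q.1 q.2 := by
  have := hlam.measurable_cumHazInv
  unfold draw
  exact measurable_fst.setY t (by fun_prop)

lemma _root_.Measurable.draw {α : Type*} [MeasurableSpace α] (hlam : IsBaselineHazard (lam θ.α))
    (t : Fin T) {f : α → Data T d} {g : α → ℝ} (hf : Measurable f) (hg : Measurable g) :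
    Measurable fun z => draw lam θ t (f z) (g z) :=
  (measurable_draw hlam t).comp (hf.prodMk hg)

/-- The law of a spell given its past is that of `draw` at a rescaled exponential variable. -/
lemma spell_eq_map_draw (hlam : IsBaselineHazard (lam θ.α)) (t : Fin T) (w : Data T d) :
    (volume.restrict (Ioi (0 : ℝ))).withDensity
      (spellPDF (lam θ.α) (rate θ t w * Real.exp w.2.2))
      = (gm 1).map (fun e => cumHazInv (lam θ.α) ((rate θ t w)⁻¹ * (Real.exp (-w.2.2) * e))) := by
  have := hlam.spell_eq_map (mul_pos (rate_pos θ t w) (Real.exp_pos w.2.2))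
  simp only [mul_inv, ← Real.exp_neg, mul_assoc] at this ⊢
  rw [← this]
  unfold spellPDF
  simp only [mul_assoc]

lemma lintegral_spell (hlam : IsBaselineHazard (lam θ.α)) (t : Fin T) (w : Data T d)
    {G : Data T d → ℝ≥0∞} (hG : Measurable G) :
    ∫⁻ u in Ioi (0 : ℝ), G (setY t w u) * spellPDF (lam θ.α) (rate θ t w * Real.exp w.2.2) u
      = ∫⁻ e, G (draw lam θ t w (Real.exp (-w.2.2) * e)) ∂(gm 1) := by
  have hm : Measurable fun u => G (setY t w u) := hG.comp (measurable_const.setY t measurable_id)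
  have hd : Measurable (spellPDF (lam θ.α) (rate θ t w * Real.exp w.2.2)) :=
    (measurable_spellPDF hlam.measurable).comp (measurable_const.prodMk measurable_id)
  have hi := hlam.measurable_cumHazInv
  have h := lintegral_withDensity_eq_lintegral_mul (volume.restrict (Ioi (0 : ℝ))) hd hm
  rw [spell_eq_map_draw hlam, lintegral_map hm (by fun_prop)] at h
  simp only [draw]
  rw [h]
  exact lintegral_congr fun u => mul_comm _ _

end Basic

/-! ### Laws of residuals, tail sums and shares under the model -/

section Law
variable [NeZero T] {D : Design T d} {lam : (Fin m → ℝ) → ℝ → ℝ} {θ : Param m d}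

/-- Refreshing the outcome with the reference density leaves the true spell density under the inner
integral, and that spell is `draw` at e^{-a} times a unit exponential. -/
lemma lintegral_partialLik_draw (hlam : IsBaselineHazard (lam θ.α)) (ω : Nuisance D) (t : Fin T)
    {G : Data T d → ℝ≥0∞} (hG : Measurable G) :
    ∫⁻ w, G w * partialLik lam θ ω (t.val + 1) (t.val + 1) w ∂D.dominating
      = ∫⁻ w, (∫⁻ e, G (draw lam θ t w (Real.exp (-w.2.2) * e)) ∂(gm 1))
          * partialLik lam θ ω t.val (t.val + 1) w ∂D.dominating := by
  have hd := measurable_spellPDF hlam.measurable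
  have hL := measurable_partialLik hlam ω (t.val + 1) (t.val + 1)
  have hGL : Measurable fun w => G w * partialLik lam θ ω (t.val + 1) (t.val + 1) w := hG.mul hL
  rw [lintegral_setY D t hGL (c := fun w => spellPDF (lam θ.α) 1 (w.1 t.succ))
    (hd.comp (measurable_const.prodMk (by fun_prop)))
    (fun w => by simpa [setY] using lintegral_spellPDF hlam one_pos)]
  refine lintegral_congr fun w => ?_
  have hm : Measurable fun u => G (setY t w u) := hG.comp (measurable_const.setY t measurable_id)
  have hLm : Measurable fun u =>
      G (setY t w u) * partialLik lam θ ω (t.val + 1) (t.val + 1) (setY t w u) :=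
    hGL.comp (measurable_const.setY t measurable_id)
  have hsp : Measurable (spellPDF (lam θ.α) (rate θ t w * Real.exp w.2.2)) :=
    hd.comp (measurable_const.prodMk measurable_id)
  rw [← lintegral_spell hlam t w hG, ← lintegral_mul_const _ hLm,
    ← lintegral_mul_const _ (show Measurable fun u => G (setY t w u) *
      spellPDF (lam θ.α) (rate θ t w * Real.exp w.2.2) u from hm.mul hsp)]
  refine lintegral_congr fun u => ?_
  rw [mul_assoc, partialLik_setY, mul_assoc]

/-- The feedback drops out here: a functional that does not see the regressor lets its conditional
density integrate to one, whatever that density is. -/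
lemma lintegral_partialLik_setX (hlam : IsBaselineHazard (lam θ.α)) (ω : Nuisance D) (t : Fin T)
    {G : Data T d → ℝ≥0∞} (hG : Measurable G) (hGd : DepOn t.val t.val G) :
    ∫⁻ w, G w * partialLik lam θ ω t.val (t.val + 1) w ∂D.dominating
      = ∫⁻ w, G w * partialLik lam θ ω t.val t.val w ∂D.dominating := by
  rcases Nat.eq_zero_or_pos t.val with ht | ht
  · simp only [ht, zero_add, partialLik_zero]
  have hL := measurable_partialLik hlam ω t.val (t.val + 1)
  have href := measurable_feedback_ref ω t ht
  have hGL : Measurable fun w => G w * partialLik lam θ ω t.val (t.val + 1) w := hG.mul hL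
  rw [lintegral_setX D t ht hGL (c := fun w => ENNReal.ofReal (ω.g t 0 0 0 (w.2.1 t)))
    (href.comp (f := fun w : Data T d => w.2.1 t) (by fun_prop)).ennreal_ofReal
    (fun w => by simpa [setX] using ω.lintegral_g t ht 0 0 0)]
  refine lintegral_congr fun w => ?_
  have hLm : Measurable fun v => partialLik lam θ ω t.val (t.val + 1) (setX t w v) :=
    hL.comp (measurable_const.setX t measurable_id)
  have hGv : ∀ v, G (setX t w v) = G w := fun v => hGd _ _ (agree_setX le_rfl w v) rfl
  have hgm : Measurable fun v => ω.g t (take (Nat.succ_le_succ t.isLt.le) w.1)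
          (take t.isLt.le w.2.1) w.2.2 v :=
    (ω.measurable_g t ht).comp (f := fun v => (take (Nat.succ_le_succ t.isLt.le) w.1,
          take t.isLt.le w.2.1, w.2.2, v)) (by fun_prop)
  simp only [hGv]
  rw [lintegral_const_mul _ hLm, mul_assoc, ← lintegral_mul_const _ hLm]
  simp only [partialLik_setX lam θ ω t ht]
  rw [lintegral_mul_const _ hgm.ennreal_ofReal, ω.lintegral_g t ht, one_mul]

lemma lintegral_law (hlam : IsBaselineHazard (lam θ.α)) (ω : Nuisance D)
    {G : Data T d → ℝ≥0∞} (hG : Measurable G) :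
    ∫⁻ w, G w ∂(law lam θ ω) = ∫⁻ w, G w * partialLik lam θ ω T T w ∂D.dominating := by
  rw [law_eq hlam, lintegral_withDensity_eq_lintegral_mul _ (measurable_partialLik hlam ω T T) hG]
  exact lintegral_congr fun w => mul_comm _ _

lemma lintegral_law_of_succ (hlam : IsBaselineHazard (lam θ.α)) (ω : Nuisance D) (t : Fin T)
    (ih : ∀ G : Data T d → ℝ≥0∞, Measurable G → DepOn (t.val + 1) (t.val + 1) G →
      ∫⁻ w, G w ∂(law lam θ ω)
        = ∫⁻ w, G w * partialLik lam θ ω (t.val + 1) (t.val + 1) w ∂D.dominating)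
    {G : Data T d → ℝ≥0∞} (hG : Measurable G) (hGd : DepOn t.val (t.val + 1) G) :
    ∫⁻ w, G w ∂(law lam θ ω)
      = ∫⁻ w, G w * partialLik lam θ ω t.val (t.val + 1) w ∂D.dominating := by
  rw [ih G hG (hGd.mono (Nat.le_succ _) le_rfl), lintegral_partialLik_draw hlam ω t hG]
  refine lintegral_congr fun w => ?_
  have : ∀ e, G (draw lam θ t w (Real.exp (-w.2.2) * e)) = G w :=
    fun e => hGd _ _ (agree_draw le_rfl w _) rfl
  simp [this]

/-- By backward induction the true densities of later periods each contribute a factor one, so the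
reference densities may stand in for them. -/
lemma lintegral_law_eq_partialLik (hlam : IsBaselineHazard (lam θ.α)) (ω : Nuisance D) :
    ∀ k s : ℕ, s + k = T → ∀ G : Data T d → ℝ≥0∞, Measurable G → DepOn s s G →
    ∫⁻ w, G w ∂(law lam θ ω) = ∫⁻ w, G w * partialLik lam θ ω s s w ∂D.dominating
  | 0, s, hs, G, hG, _ => by
    obtain rfl : s = T := by omega
    exact lintegral_law hlam ω hG
  | k + 1, s, hs, G, hG, hGd => by
    have h1 := lintegral_law_eq_partialLik hlam ω k (s + 1) (by omega)
    have h2 := lintegral_law_of_succ hlam ω ⟨s, by omega⟩ h1 hG (hGd.mono le_rfl (Nat.le_succ _))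
    rw [h2]
    exact lintegral_partialLik_setX hlam ω ⟨s, by omega⟩ hG hGd

/-- Given the outcomes before a period, the regressors up to it and the heterogeneity, the
generalized residual of the period is exponential with rate `exp a`. -/
lemma lintegral_law_draw (hlam : IsBaselineHazard (lam θ.α)) (ω : Nuisance D) (t : Fin T)
    {G : Data T d → ℝ≥0∞} (hG : Measurable G) (hGd : DepOn (t.val + 1) (t.val + 1) G) :
    ∫⁻ w, G w ∂(law lam θ ω)
      = ∫⁻ w, ∫⁻ e, G (draw lam θ t w (Real.exp (-w.2.2) * e)) ∂(gm 1) ∂(law lam θ ω) := by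
  have ih := lintegral_law_eq_partialLik hlam ω (T - (t.val + 1)) (t.val + 1)
    (by have := t.isLt; omega)
  have hm : Measurable fun q : Data T d × ℝ => G (draw lam θ t q.1 (Real.exp (-q.1.2.2) * q.2)) :=
    hG.comp (measurable_fst.draw hlam t (by fun_prop))
  rw [ih G hG hGd, lintegral_partialLik_draw hlam ω t hG]
  refine (lintegral_law_of_succ hlam ω t ih hm.lintegral_prod_right' fun w w' h ha => ?_).symm
  refine lintegral_congr fun e => hGd _ _ ?_ ha
  rw [ha]
  exact h.draw le_rfl (Nat.lt_succ_self _) _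

/-- Given the outcomes before a period, the regressors up to it and the heterogeneity, the sum of
the generalized residuals from that period onwards has a Gamma distribution. -/
lemma lintegral_law_tailSum (hlam : IsBaselineHazard (lam θ.α)) (ω : Nuisance D) :
    ∀ k s : ℕ, s + k = T → ∀ F : Data T d × ℝ → ℝ≥0∞, Measurable F →
    (∀ r, DepOn s (s + 1) fun w => F (w, r)) →
    ∫⁻ w, F (w, tailSum lam θ s w) ∂(law lam θ ω)
      = ∫⁻ w, ∫⁻ r, F (w, Real.exp (-w.2.2) * r) ∂(gm k) ∂(law lam θ ω)
  | 0, s, hs, F, hF, _ => by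
    refine lintegral_congr fun w => ?_
    rw [tailSum_of_le (by omega), gm, lintegral_dirac' _ (by fun_prop), mul_zero]
  | k + 1, s, hs, F, hF, hFd => by
    obtain ⟨t, rfl⟩ : ∃ t : Fin T, t.val = s := ⟨⟨s, by omega⟩, rfl⟩
    have hP : Measurable fun q : Data T d × ℝ => P lam θ q.1.1 q.1.2.1 t :=
      (measurable_P hlam t).comp measurable_fst
    simp only [tailSum_eq_add]
    -- Write R_t = P_t + R_{t+1}. At index t + 1 the residual P_t belongs to the past, so the
    -- induction hypothesis replaces R_{t+1} alone; P_t is replaced next, and the two convolve.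
    rw [lintegral_law_tailSum hlam ω k (t.val + 1) (by omega)
      (fun q => F (q.1, P lam θ q.1.1 q.1.2.1 t + q.2)) (by fun_prop)
      (fun r w w' h ha => by
        simp only
        rw [h.P_eq t le_rfl (by omega)]
        exact hFd _ _ _ (h.mono (Nat.le_succ _) (Nat.le_succ _)) ha)]
    have hm : Measurable fun q : Data T d × ℝ =>
        F (q.1, P lam θ q.1.1 q.1.2.1 t + Real.exp (-q.1.2.2) * q.2) := by fun_prop
    rw [lintegral_law_draw hlam ω t hm.lintegral_prod_right' (fun w w' h ha => by
        refine lintegral_congr fun r => ?_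
        rw [h.P_eq t le_rfl (by omega), ha]
        exact hFd _ _ _ (h.mono (Nat.le_succ _) le_rfl) ha)]
    refine lintegral_congr fun w => ?_
    rw [lintegral_gm_conv k (F := fun r => F (w, Real.exp (-w.2.2) * r)) (by fun_prop)]
    refine lintegral_congr_ae ?_
    filter_upwards [gm_ae_pos 0] with e he
    refine lintegral_congr fun r => ?_
    rw [P_draw hlam t w (mul_pos (Real.exp_pos _) he), mul_add]
    exact hFd _ _ _ (agree_draw le_rfl w _) rfl

/-- The share of a generalized residual in the sum from that period onwards has a Beta
distribution and is independent of that sum, of the past, of the regressors up to that period and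
of the heterogeneity. -/
lemma lintegral_law_share (hlam : IsBaselineHazard (lam θ.α)) (ω : Nuisance D) (t : Fin T)
    {k : ℕ} (hk : t.val + 1 + k = T) {F : Data T d × ℝ × ℝ → ℝ≥0∞} (hF : Measurable F)
    (hFd : ∀ z, DepOn t.val (t.val + 1) fun w => F (w, z)) :
    ∫⁻ w, F (w, P lam θ w.1 w.2.1 t, tailSum lam θ (t.val + 1) w) ∂(law lam θ ω)
      = ∫⁻ w, ∫⁻ b, F (w, b * tailSum lam θ t.val w, (1 - b) * tailSum lam θ t.val w) ∂(bt k)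
        ∂(law lam θ ω) := by
  have hP : Measurable fun q : Data T d × ℝ => P lam θ q.1.1 q.1.2.1 t :=
    (measurable_P hlam t).comp measurable_fst
  -- On this side the pair (P_t, R_{t+1}) becomes e^{-a} times independent exponential and Gamma
  -- variables. On the other side R_t becomes e^{-a} times a Gamma variable, and the common scale
  -- e^{-a} passes through the Beta–Gamma identity.
  rw [lintegral_law_tailSum hlam ω k (t.val + 1) hk
      (fun q => F (q.1, P lam θ q.1.1 q.1.2.1 t, q.2)) (by fun_prop)
      (fun r w w' h ha => by
        simp only
        rw [h.P_eq t le_rfl (by omega)]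
        exact hFd _ _ _ (h.mono (Nat.le_succ _) (Nat.le_succ _)) ha)]
  have hm : Measurable fun q : Data T d × ℝ =>
      F (q.1, P lam θ q.1.1 q.1.2.1 t, Real.exp (-q.1.2.2) * q.2) := by fun_prop
  rw [lintegral_law_draw hlam ω t hm.lintegral_prod_right' (fun w w' h ha => by
        refine lintegral_congr fun r => ?_
        rw [h.P_eq t le_rfl (by omega), ha]
        exact hFd _ _ _ (h.mono (Nat.le_succ _) le_rfl) ha)]
  have hm2 : Measurable fun q : (Data T d × ℝ) × ℝ => F (q.1.1, q.2 * q.1.2, (1 - q.2) * q.1.2) := by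
    fun_prop
  rw [lintegral_law_tailSum hlam ω (k + 1) t.val (by omega)
    (fun q => ∫⁻ b, F (q.1, b * q.2, (1 - b) * q.2) ∂(bt k)) hm2.lintegral_prod_right'
    (fun r w w' h ha => lintegral_congr fun b => hFd _ _ _ h ha)]
  refine lintegral_congr fun w => ?_
  have h := lintegral_bt_gm k (F := fun p q => F (w, Real.exp (-w.2.2) * p, Real.exp (-w.2.2) * q))
    (by unfold Function.uncurry; fun_prop)
  simp only [mul_left_comm _ (Real.exp (-w.2.2))]
  rw [h]
  refine lintegral_congr_ae ?_
  filter_upwards [gm_ae_pos 0] with e he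
  refine lintegral_congr fun r => ?_
  rw [P_draw hlam t w (mul_pos (Real.exp_pos _) he)]
  exact hFd _ _ _ (agree_draw le_rfl w _) rfl

/-- The Gamma representation applied to the indicator of the failure set. -/
lemma ae_law_tailSum_iff (hlam : IsBaselineHazard (lam θ.α)) (ω : Nuisance D) {k s : ℕ}
    (hs : s + k = T) {p : Data T d → ℝ → Prop} (hp : MeasurableSet {q : Data T d × ℝ | p q.1 q.2})
    (hpd : ∀ r, DepOn s (s + 1) fun w => p w r) :
    (∀ᵐ w ∂(law lam θ ω), p w (tailSum lam θ s w))
      ↔ ∀ᵐ w ∂(law lam θ ω), ∀ᵐ r ∂(gm k), p w (Real.exp (-w.2.2) * r) := by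
  classical
  set F : Data T d × ℝ → ℝ≥0∞ := {q : Data T d × ℝ | p q.1 q.2}ᶜ.indicator 1 with hF
  have hFm : Measurable F := measurable_one.indicator hp.compl
  have hF0 : ∀ w r, F (w, r) = 0 ↔ p w r := fun w r => by simp [hF, indicator]
  have ht := measurable_tailSum (T := T) hlam s
  have h := lintegral_law_tailSum hlam ω k s hs F hFm (fun r w w' h ha => by
    have := hpd r w w' h ha
    simp only [hF, indicator, mem_compl_iff, mem_ofPred_eq]
    simp only at this
    rw [this]; rfl)
  have hm : Measurable fun q : Data T d × ℝ => F (q.1, Real.exp (-q.1.2.2) * q.2) := by fun_prop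
  calc _ ↔ ∫⁻ w, F (w, tailSum lam θ s w) ∂(law lam θ ω) = 0 := by
        rw [lintegral_eq_zero_iff (by fun_prop)]
        exact eventually_congr (Eventually.of_forall fun w => (hF0 _ _).symm)
    _ ↔ ∫⁻ w, ∫⁻ r, F (w, Real.exp (-w.2.2) * r) ∂(gm k) ∂(law lam θ ω) = 0 := by rw [h]
    _ ↔ _ := by
        rw [lintegral_eq_zero_iff hm.lintegral_prod_right']
        refine eventually_congr (Eventually.of_forall fun w => ?_)
        simp only [Pi.zero_apply]
        rw [lintegral_eq_zero_iff (by fun_prop)]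
        exact eventually_congr (Eventually.of_forall fun r => hF0 _ _)

/-- At stage 0 every factor is a density of mass one; where ν vanishes, the mass of π is unknown but
multiplied by zero. Dropping the restriction to the support gives a bound, and finiteness is all
that conditional expectations require. -/
lemma lintegral_law_one_le (hlam : IsBaselineHazard (lam θ.α)) (ω : Nuisance D) :
    ∫⁻ _, 1 ∂(law lam θ ω) ≤ 1 := by
  rw [lintegral_law_eq_partialLik hlam ω T 0 (by omega) _ measurable_const fun _ _ _ _ => rfl]
  simp only [one_mul]
  have hL := measurable_partialLik hlam ω 0 0
  have hd := measurable_spellPDF hlam.measurable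
  refine (setLIntegral_le_lintegral _ _).trans ?_
  rw [lintegral_prod _ hL.aemeasurable]
  obtain ⟨n, rfl⟩ : ∃ n, T = n + 1 := ⟨T - 1, by have := NeZero.pos T; omega⟩
  set c : Fin n → (Fin d → ℝ) → ℝ≥0∞ := fun t v => ENNReal.ofReal (ω.g t.succ 0 0 0 v) with hc
  have hcm : ∀ t, Measurable (c t) := fun t =>
    (measurable_feedback_ref ω t.succ (by simp)).ennreal_ofReal
  have hν := ω.measurable_ν
  have hone : Measurable (spellPDF (lam θ.α) 1) := hd.comp (measurable_const.prodMk measurable_id)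
  have key : ∀ y : Fin (n + 1 + 1) → ℝ, ∫⁻ q : (Fin (n + 1) → (Fin d → ℝ)) × ℝ,
      partialLik lam θ ω 0 0 (y, q) ∂((Measure.pi D.μX).prod volume)
      ≤ (∫⁻ v, ENNReal.ofReal (ω.ν (y 0) v) ∂(D.μX 0))
        * ∏ t : Fin (n + 1), spellPDF (lam θ.α) 1 (y t.succ) := by
    intro y
    have hνy : Measurable fun v => ENNReal.ofReal (ω.ν (y 0) v) :=
      (hν.comp (f := fun v => (y 0, v)) (by fun_prop)).ennreal_ofReal
    have hLy : Measurable fun q : (Fin (n + 1) → (Fin d → ℝ)) × ℝ =>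
        partialLik lam θ ω 0 0 (y, q) := hL.comp measurable_prodMk_left
    rw [lintegral_prod _ hLy.aemeasurable,
      ← lintegral_pi_head_mul D.μX hνy c hcm (fun t => ω.lintegral_g t.succ (by simp) 0 0 0),
      mul_comm, ← lintegral_const_mul _ (by fun_prop)]
    refine lintegral_mono fun x => ?_
    have hπ : Measurable fun a => ENNReal.ofReal (ω.π (y 0) (x 0) a) :=
      (ω.measurable_π.comp (f := fun a => (y 0, x 0, a)) (by fun_prop)).ennreal_ofReal
    simp only [partialLik, Nat.not_lt_zero, if_false]
    rw [lintegral_mul_const _ (hπ.const_mul _), lintegral_const_mul _ hπ]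
    have e : (∏ t : Fin (n + 1), if t.val = 0 then 1 else ENNReal.ofReal (ω.g t 0 0 0 (x t)))
        = ∏ t, c t (x t.succ) := by
      rw [Fin.prod_univ_succ]; simp [hc]
    rw [e]
    rcases (ω.ν_nonneg (y 0) (x 0)).eq_or_lt with h0 | h0
    · simp [← h0]
    · rw [ω.lintegral_π _ _ h0, mul_one, mul_assoc, mul_comm (∏ t, c t (x t.succ))]
  refine (lintegral_mono key).trans ?_
  have hνm : Measurable fun u => ∫⁻ v, ENNReal.ofReal (ω.ν u v) ∂(D.μX 0) :=
    Measurable.lintegral_prod_right' (f := fun q : ℝ × (Fin d → ℝ) => ENNReal.ofReal (ω.ν q.1 q.2))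
      hν.ennreal_ofReal
  rw [lintegral_pi_head_mul _ hνm (fun _ => spellPDF (lam θ.α) 1) (fun _ => hone)
    (fun t => by rw [Fin.cons_succ]; exact lintegral_spellPDF hlam one_pos), Fin.cons_zero]
  have := lintegral_prod (μ := D.μ0) (ν := D.μX 0) (fun q => ENNReal.ofReal (ω.ν q.1 q.2))
    hν.ennreal_ofReal.aemeasurable
  rw [← this, ω.lintegral_ν]

lemma isFiniteMeasure_law (hlam : IsBaselineHazard (lam θ.α)) (ω : Nuisance D) :
    IsFiniteMeasure (law lam θ ω) :=
  ⟨by simpa using (lintegral_law_one_le hlam ω).trans_lt ENNReal.one_lt_top⟩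

end Law

/-! ### The statistic and its conditional expectations -/

/-- The sum of the generalized residuals with indices in `[s, k)`. -/
noncomputable def midSum (lam : (Fin m → ℝ) → ℝ → ℝ) (θ : Param m d) (s k : ℕ) (w : Data T d) : ℝ :=
  ∑ l : Fin T with s ≤ l.val ∧ l.val < k, P lam θ w.1 w.2.1 l

/-- The statistic `(Y_0, P̃^k, P̄, X^l)` with the sum of the generalized residuals from index `k`
onwards replaced by `r`. -/
noncomputable def statAt (lam : (Fin m → ℝ) → ℝ → ℝ) (θ : Param m d) {k l : ℕ} (hk : k ≤ T)
    (hl : l ≤ T) (w : Data T d) (r : ℝ) : ℝ × (Fin k → ℝ) × ℝ × (Fin l → (Fin d → ℝ)) :=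
  (w.1 0, fun i => P lam θ w.1 w.2.1 (Fin.castLE hk i) / (midSum lam θ i.val k w + r),
    midSum lam θ 0 k w + r, take hl w.2.1)

/-- Append a share to the statistic. -/
def appendShare {k : ℕ} {α : Type*} (q : ℝ × (Fin k → ℝ) × α) (b : ℝ) :
    ℝ × (Fin (k + 1) → ℝ) × α :=
  (q.1, Fin.snoc q.2.1 b, q.2.2)

/-- Drop the last share of the statistic. -/
def dropShare {k : ℕ} {α : Type*} (q : ℝ × (Fin (k + 1) → ℝ) × α) : ℝ × (Fin k → ℝ) × α :=
  (q.1, Fin.init q.2.1, q.2.2)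

@[simp] lemma dropShare_appendShare {k : ℕ} {α : Type*} (q : ℝ × (Fin k → ℝ) × α) (b : ℝ) :
    dropShare (appendShare q b) = q := by
  simp [dropShare, appendShare]

lemma measurable_appendShare {k : ℕ} {α : Type*} [MeasurableSpace α] :
    Measurable fun z : (ℝ × (Fin k → ℝ) × α) × ℝ => appendShare z.1 z.2 := by
  refine Measurable.prodMk (by fun_prop) (Measurable.prodMk ?_ (by fun_prop))
  refine measurable_pi_lambda _ fun i => ?_
  refine Fin.lastCases ?_ (fun j => ?_) i
  · simp only [Fin.snoc_last]; fun_prop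
  · simp only [Fin.snoc_castSucc]; fun_prop

lemma measurable_dropShare {k : ℕ} {α : Type*} [MeasurableSpace α] :
    Measurable (dropShare : ℝ × (Fin (k + 1) → ℝ) × α → _) := by
  unfold dropShare Fin.init
  fun_prop

section Basic
variable {lam : (Fin m → ℝ) → ℝ → ℝ} {θ : Param m d}

lemma midSum_self (k : ℕ) (w : Data T d) : midSum lam θ k k w = 0 := by
  rw [midSum, Finset.filter_false_of_mem fun l _ => by omega, Finset.sum_empty]

lemma midSum_eq_add (t : Fin T) {k : ℕ} (h : t.val < k) (w : Data T d) :
    midSum lam θ t.val k w = P lam θ w.1 w.2.1 t + midSum lam θ (t.val + 1) k w := by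
  have : (Finset.univ.filter fun l : Fin T => t.val ≤ l.val ∧ l.val < k)
      = insert t (Finset.univ.filter fun l : Fin T => t.val + 1 ≤ l.val ∧ l.val < k) := by
    ext l
    simp [Fin.ext_iff]
    omega
  rw [midSum, midSum, this, Finset.sum_insert (by simp)]

lemma midSum_succ (t : Fin T) {s : ℕ} (h : s ≤ t.val) (w : Data T d) :
    midSum lam θ s (t.val + 1) w = midSum lam θ s t.val w + P lam θ w.1 w.2.1 t := by
  have : (Finset.univ.filter fun l : Fin T => s ≤ l.val ∧ l.val < t.val + 1)
      = insert t (Finset.univ.filter fun l : Fin T => s ≤ l.val ∧ l.val < t.val) := by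
    ext l
    simp [Fin.ext_iff]
    omega
  rw [midSum, midSum, this, Finset.sum_insert (by simp), add_comm]

lemma tailSum_eq_midSum_add {s k : ℕ} (h : s ≤ k) (w : Data T d) :
    tailSum lam θ s w = midSum lam θ s k w + tailSum lam θ k w := by
  rw [tailSum, midSum, tailSum, ← Finset.sum_filter_add_sum_filter_not _ (fun l : Fin T => l.val < k),
    Finset.filter_filter, Finset.filter_filter]
  refine congrArg₂ (· + ·) rfl (Finset.sum_congr ?_ fun _ _ => rfl)
  ext l
  simp only [Finset.mem_filter, Finset.mem_univ, true_and]
  omega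

lemma Agree.midSum_eq {i j s k : ℕ} {w w' : Data T d} (h : Agree i j w w') (hi : k ≤ i)
    (hj : k ≤ j) : midSum lam θ s k w = midSum lam θ s k w' := by
  refine Finset.sum_congr rfl fun l hl => ?_
  have : l.val < k := (Finset.mem_filter.1 hl).2.2
  exact h.P_eq l (by omega) (by omega)

lemma measurable_midSum (hlam : IsBaselineHazard (lam θ.α)) (s k : ℕ) :
    Measurable (midSum (T := T) lam θ s k) :=
  Finset.measurable_fun_sum _ fun t _ => measurable_P hlam t

lemma midSum_nonneg (hlam : IsBaselineHazard (lam θ.α)) (s k : ℕ) (w : Data T d)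
    (hw : ∀ t : Fin T, t.val < k → 0 < w.1 t.succ) : 0 ≤ midSum lam θ s k w :=
  Finset.sum_nonneg fun t ht => (P_pos hlam t w (hw t (Finset.mem_filter.1 ht).2.2)).le

/-- The tail sum is the only channel from the outcomes and regressors of later periods to the shares
and P̄, so it can be separated as an argument r. -/
lemma stat_eq_statAt {k l : ℕ} (hk : k ≤ T) (hl : l ≤ T) (w : Data T d) :
    stat lam θ hk hl w = statAt lam θ hk hl w (tailSum lam θ k w) := by
  simp only [stat, statAt, Prod.mk.injEq, true_and, and_true]
  refine ⟨?_, ?_⟩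
  · ext i
    rw [take, Ptilde, ← tailSum_eq_sum_Ici, tailSum_eq_midSum_add (k := k) (by simp)]
    rfl
  · rw [← tailSum_zero, tailSum_eq_midSum_add (Nat.zero_le k)]

lemma Agree.statAt_eq {k l i j : ℕ} {w w' : Data T d} (h : Agree i j w w') (hk : k ≤ T)
    (hl : l ≤ T) (hki : k ≤ i) (hkj : k ≤ j) (hlj : l ≤ j) (r : ℝ) :
    statAt lam θ hk hl w r = statAt lam θ hk hl w' r := by
  simp only [statAt, Prod.mk.injEq]
  refine ⟨h.1 0 (Nat.zero_le _), ?_, ?_, ?_⟩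
  · ext n
    have := n.isLt
    rw [h.P_eq _ (by simp; omega) (by simp; omega), h.midSum_eq hki hkj]
  · rw [h.midSum_eq hki hkj]
  · ext n : 1
    have := n.isLt
    exact h.2 _ (by simp; omega)

lemma measurable_statAt (hlam : IsBaselineHazard (lam θ.α)) {k l : ℕ} (hk : k ≤ T) (hl : l ≤ T) :
    Measurable fun q : Data T d × ℝ => statAt lam θ hk hl q.1 q.2 := by
  have hP : ∀ t, Measurable fun q : Data T d × ℝ => P lam θ q.1.1 q.1.2.1 t := fun t =>
    (measurable_P hlam t).comp measurable_fst
  have hM : ∀ s, Measurable fun q : Data T d × ℝ => midSum lam θ s k q.1 := fun s =>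
    (measurable_midSum hlam s k).comp measurable_fst
  unfold statAt
  refine Measurable.prodMk (by fun_prop) (Measurable.prodMk ?_ (Measurable.prodMk (by fun_prop) ?_))
  · exact measurable_pi_lambda _ fun i => (hP _).div ((hM _).add measurable_snd)
  · exact (measurable_take hl).comp (by fun_prop)

lemma measurable_stat (hlam : IsBaselineHazard (lam θ.α)) {k l : ℕ} (hk : k ≤ T) (hl : l ≤ T) :
    Measurable (stat (d := d) lam θ hk hl) := by
  have ht := measurable_tailSum (T := T) (d := d) hlam k
  have : stat lam θ hk hl = fun w : Data T d => statAt lam θ hk hl w (tailSum lam θ k w) :=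
    funext fun w => stat_eq_statAt hk hl w
  rw [this]
  exact (measurable_statAt hlam hk hl).comp (measurable_id.prodMk ht)

lemma statAt_succ (t : Fin T) {l : ℕ} (hl : l ≤ T) (w : Data T d) (r : ℝ) :
    statAt lam θ (Nat.succ_le_of_lt t.isLt) hl w r
      = appendShare (statAt lam θ t.isLt.le hl w (P lam θ w.1 w.2.1 t + r))
        (P lam θ w.1 w.2.1 t / (P lam θ w.1 w.2.1 t + r)) := by
  simp only [statAt, appendShare, Prod.mk.injEq, true_and, and_true]
  refine ⟨?_, ?_⟩
  · ext i
    refine Fin.lastCases ?_ (fun j => ?_) i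
    · simp only [Fin.snoc_last, Fin.val_last]
      rw [midSum_succ t le_rfl, midSum_self, zero_add]
      rfl
    · simp only [Fin.snoc_castSucc, Fin.val_castSucc]
      rw [midSum_succ t j.isLt.le, add_assoc]
      rfl
  · rw [midSum_succ t (Nat.zero_le _), add_assoc]

end Basic

section Law
variable [NeZero T] {D : Design T d} {lam : (Fin m → ℝ) → ℝ → ℝ} {θ : Param m d}

lemma ae_law_pos (hlam : IsBaselineHazard (lam θ.α)) (ω : Nuisance D) :
    ∀ᵐ w ∂(law lam θ ω), ∀ t : Fin T, 0 < w.1 t.succ :=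
  (ae_law_iff hlam ω).2 (ae_dominating_pos D)

/-- One more share is an independent Beta draw. The bound l ≤ t + 1 admits the regressor of index t,
of which the share is independent too. -/
lemma map_stat_eq (hlam : IsBaselineHazard (lam θ.α)) (ω : Nuisance D) (t : Fin T) {k l : ℕ}
    (hk : t.val + 1 + k = T) (hl : l ≤ T) (hlt : l ≤ t.val + 1) :
    (law lam θ ω).map (stat lam θ (Nat.succ_le_of_lt t.isLt) hl)
      = ((law lam θ ω).prod (bt k)).map
        (fun z => appendShare (stat lam θ t.isLt.le hl z.1) z.2) := by
  have hs := measurable_stat (d := d) hlam (Nat.succ_le_of_lt t.isLt) hl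
  have hs' := measurable_stat (d := d) hlam t.isLt.le hl
  have hsa := measurable_statAt (d := d) hlam t.isLt.le hl
  have happ := measurable_appendShare (k := t.val) (α := ℝ × (Fin l → (Fin d → ℝ)))
  have hm : Measurable fun z : Data T d × ℝ => appendShare (stat lam θ t.isLt.le hl z.1) z.2 :=
    happ.comp ((hs'.comp measurable_fst).prodMk measurable_snd)
  refine Measure.ext_of_lintegral _ fun H hH => ?_
  have hHm : Measurable fun z : Data T d × ℝ =>
      H (appendShare (stat lam θ t.isLt.le hl z.1) z.2) := hH.comp hm
  rw [lintegral_map hH hs, lintegral_map hH hm, lintegral_prod _ hHm.aemeasurable]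
  have h := lintegral_law_share hlam ω t hk
    (F := fun z => H (appendShare (statAt lam θ t.isLt.le hl z.1 (z.2.1 + z.2.2))
      (z.2.1 / (z.2.1 + z.2.2))))
    (hH.comp (happ.comp ((hsa.comp (f := fun z : Data T d × ℝ × ℝ => (z.1, z.2.1 + z.2.2))
      (by fun_prop)).prodMk (by fun_prop))))
    (fun z w w' h _ => by
      simp only
      rw [h.statAt_eq t.isLt.le hl le_rfl (Nat.le_succ _) hlt])
  refine Eq.trans ?_ (h.trans ?_)
  · refine lintegral_congr fun w => ?_
    rw [stat_eq_statAt, statAt_succ]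
  · refine lintegral_congr_ae ?_
    filter_upwards [ae_law_pos hlam ω] with w hw
    refine lintegral_congr fun b => ?_
    have hR := tailSum_pos hlam t w hw
    have e : b * tailSum lam θ t.val w + (1 - b) * tailSum lam θ t.val w
        = tailSum lam θ t.val w := by ring
    simp only [e, mul_div_cancel_right₀ _ hR.ne', ← stat_eq_statAt]

/-- The conditional expectation of a function of the statistic given the statistic without its
last share. -/
lemma condExp_stat (hlam : IsBaselineHazard (lam θ.α)) (ω : Nuisance D) (t : Fin T) {k l : ℕ}
    (hk : t.val + 1 + k = T) (hl : l ≤ T) (hlt : l ≤ t.val + 1)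
    {ψ : ℝ × (Fin (t.val + 1) → ℝ) × ℝ × (Fin l → (Fin d → ℝ)) → ℝ} (hψ : Measurable ψ)
    (hint : Integrable (fun w => ψ (stat lam θ (Nat.succ_le_of_lt t.isLt) hl w)) (law lam θ ω)) :
    (fun w => ∫ b, ψ (appendShare (stat lam θ t.isLt.le hl w) b) ∂(bt k))
      =ᵐ[law lam θ ω] (law lam θ ω)[fun w => ψ (stat lam θ (Nat.succ_le_of_lt t.isLt) hl w) |
        MeasurableSpace.comap (stat lam θ t.isLt.le hl) inferInstance] := by
  have := isFiniteMeasure_law hlam ω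
  have hs := measurable_stat (d := d) hlam (Nat.succ_le_of_lt t.isLt) hl
  have hs' := measurable_stat (d := d) hlam t.isLt.le hl
  have happ := measurable_appendShare (k := t.val) (α := ℝ × (Fin l → (Fin d → ℝ)))
  have hdrop := measurable_dropShare (k := t.val) (α := ℝ × (Fin l → (Fin d → ℝ)))
  have hm : Measurable fun z : Data T d × ℝ => appendShare (stat lam θ t.isLt.le hl z.1) z.2 :=
    happ.comp ((hs'.comp measurable_fst).prodMk measurable_snd)
  have hmap := map_stat_eq hlam ω t hk hl hlt
  have hI : Integrable (fun z : Data T d × ℝ => ψ (appendShare (stat lam θ t.isLt.le hl z.1) z.2))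
      ((law lam θ ω).prod (bt k)) := by
    refine (integrable_map_measure hψ.aestronglyMeasurable hm.aemeasurable).1 ?_
    rw [← hmap]
    exact (integrable_map_measure hψ.aestronglyMeasurable hs.aemeasurable).2 hint
  have hle : MeasurableSpace.comap (stat lam θ t.isLt.le hl) inferInstance
      ≤ (inferInstance : MeasurableSpace (Data T d)) := hs'.comap_le
  refine ae_eq_condExp_of_forall_setIntegral_eq hle hint
    (fun s _ _ => hI.integral_prod_left.integrableOn) ?_ ?_
  · rintro _ ⟨A, hA, rfl⟩ -
    -- The conditioning event is a function of the longer statistic through `dropShare`. Both set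
    -- integrals are thus integrals of one function of that statistic, and `map_stat_eq` compares
    -- them.
    have hKm : Measurable fun q => A.indicator (fun _ => (1 : ℝ)) (dropShare q) * ψ q :=
      (((measurable_const (a := (1 : ℝ))).indicator hA).comp hdrop).mul hψ
    have hdropstat : ∀ w : Data T d, dropShare (stat lam θ (Nat.succ_le_of_lt t.isLt) hl w)
        = stat lam θ t.isLt.le hl w := by
      intro w
      rw [stat_eq_statAt, statAt_succ, dropShare_appendShare, stat_eq_statAt, tailSum_eq_add]
    have hind : ∀ (f : Data T d → ℝ), ∫ w in stat lam θ t.isLt.le hl ⁻¹' A, f w ∂(law lam θ ω)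
        = ∫ w, A.indicator (fun _ => (1 : ℝ)) (stat lam θ t.isLt.le hl w) * f w ∂(law lam θ ω) := by
      intro f
      rw [← integral_indicator (hs' hA)]
      refine integral_congr_ae (Eventually.of_forall fun w => ?_)
      by_cases h : stat lam θ t.isLt.le hl w ∈ A
      · simp [indicator, h]
      · simp [indicator, h]
    rw [hind, hind]
    have e1 := integral_map (μ := law lam θ ω) hs.aemeasurable hKm.aestronglyMeasurable
    rw [hmap, integral_map hm.aemeasurable hKm.aestronglyMeasurable] at e1
    simp only [hdropstat, dropShare_appendShare] at e1
    rw [← e1, integral_prod]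
    · simp only [integral_const_mul]
    · refine hI.bdd_mul (c := 1) ?_ (Eventually.of_forall fun z => ?_)
      · exact (((measurable_const (a := (1 : ℝ))).indicator hA).comp (hs'.comp measurable_fst)).aestronglyMeasurable
      · by_cases h : stat lam θ t.isLt.le hl z.1 ∈ A <;> simp [h]
  · refine StronglyMeasurable.aestronglyMeasurable ?_
    have hm2 : StronglyMeasurable fun q => ∫ b, ψ (appendShare q b) ∂(bt k) :=
      StronglyMeasurable.integral_prod_right (f := fun q b => ψ (appendShare q b))
        (hψ.comp happ).stronglyMeasurable
    exact hm2.comp_measurable (comap_measurable _)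

end Law

/-! ### Inversion of the statistic -/

section Rec
variable (lam : (Fin m → ℝ) → ℝ → ℝ) (θ : Param m d)

/-- The outcome of index `i` and the sum of the generalized residuals from index `i` onwards,
recovered from the statistic. -/
noncomputable def recoverAux {k : ℕ} (q : ℝ × (Fin k → ℝ) × ℝ × (Fin k → (Fin d → ℝ))) :
    ℕ → ℝ × ℝ
  | 0 => (q.1, q.2.2.1)
  | i + 1 => if h : i < k then
      -- The share times the current tail sum is P_i. Its rate is known, as the lagged outcome is
      -- already recovered; dividing by it and inverting Λ gives the next outcome, while subtracting
      -- P_i gives the next tail sum.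
      (cumHazInv (lam θ.α) ((Real.exp (θ.γ * (recoverAux q i).1
          + dotProduct (q.2.2.2 ⟨i, h⟩) θ.β))⁻¹ * (q.2.1 ⟨i, h⟩ * (recoverAux q i).2)),
        (recoverAux q i).2 - q.2.1 ⟨i, h⟩ * (recoverAux q i).2)
      else (0, 0)

/-- The first outcomes and regressors, and the sum of the later generalized residuals, recovered
from the statistic. -/
noncomputable def recover {k : ℕ} (q : ℝ × (Fin k → ℝ) × ℝ × (Fin k → (Fin d → ℝ))) :
    Data T d × ℝ :=
  ((fun l => (recoverAux lam θ q l.val).1,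
    -- The zero regressors and the zero heterogeneity are placeholders: the recovered point only
    -- enters functions of the first outcomes and regressors.
    fun l => if h : l.val < k then q.2.2.2 ⟨l.val, h⟩ else 0, 0), (recoverAux lam θ q k).2)

variable {lam θ}

lemma measurable_recoverAux (hlam : IsBaselineHazard (lam θ.α)) {k : ℕ} :
    ∀ i, Measurable fun q : ℝ × (Fin k → ℝ) × ℝ × (Fin k → (Fin d → ℝ)) => recoverAux lam θ q i
  | 0 => by simp only [recoverAux]; fun_prop
  | i + 1 => by
    have ih := measurable_recoverAux hlam (k := k) i
    have hi := hlam.measurable_cumHazInv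
    simp only [recoverAux]
    split_ifs
    · unfold dotProduct; fun_prop
    · fun_prop

lemma measurable_recover (hlam : IsBaselineHazard (lam θ.α)) {k : ℕ} :
    Measurable fun q : ℝ × (Fin k → ℝ) × ℝ × (Fin k → (Fin d → ℝ)) =>
      (recover lam θ q : Data T d × ℝ) := by
  have h := fun i => measurable_recoverAux (lam := lam) (θ := θ) hlam (k := k) i
  unfold recover
  refine Measurable.prodMk (Measurable.prodMk ?_ (Measurable.prodMk ?_ measurable_const)) ?_
  · exact measurable_pi_lambda _ fun l => (h _).fst
  · refine measurable_pi_lambda _ fun l => ?_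
    split_ifs <;> fun_prop
  · exact (h _).snd

lemma recoverAux_statAt (hlam : IsBaselineHazard (lam θ.α)) {k : ℕ} (hk : k ≤ T) (w : Data T d)
    (hw : ∀ t : Fin T, t.val < k → 0 < w.1 t.succ) {r : ℝ} (hr : 0 ≤ r) :
    ∀ i, (hi : i ≤ k) → recoverAux lam θ (statAt lam θ hk hk w r) i
      = (w.1 ⟨i, by omega⟩, midSum lam θ i k w + r)
  | 0, _ => rfl
  | i + 1, hi => by
    have ih := recoverAux_statAt hlam hk w hw hr i (by omega)
    rw [recoverAux, dif_pos (show i < k by omega), ih]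
    obtain ⟨t, rfl⟩ : ∃ t : Fin T, t.val = i := ⟨⟨i, by omega⟩, rfl⟩
    have hPp := P_pos hlam t w (hw t (by omega))
    have hM := midSum_nonneg hlam (t.val + 1) k w hw
    have hpos : 0 < midSum lam θ t.val k w + r := by
      rw [midSum_eq_add t (by omega)]; linarith
    have e : (statAt lam θ hk hk w r).2.1 ⟨t.val, by omega⟩ * (midSum lam θ t.val k w + r)
        = P lam θ w.1 w.2.1 t := by
      simp only [statAt]
      rw [div_mul_cancel₀ _ hpos.ne']
      rfl
    simp only [e]
    refine Prod.ext ?_ ?_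
    · change cumHazInv (lam θ.α) ((rate θ t w)⁻¹ * P lam θ w.1 w.2.1 t) = w.1 t.succ
      rw [P_eq, mul_comm, mul_assoc, mul_inv_cancel₀ (rate_pos θ t w).ne', mul_one,
        hlam.cumHazInv_cumHaz (hw t (by omega))]
    · change midSum lam θ t.val k w + r - P lam θ w.1 w.2.1 t = _
      rw [midSum_eq_add t (by omega)]
      ring

lemma recover_statAt (hlam : IsBaselineHazard (lam θ.α)) {k : ℕ} (hk : k ≤ T) (w : Data T d)
    (hw : ∀ t : Fin T, t.val < k → 0 < w.1 t.succ) {r : ℝ} (hr : 0 ≤ r) :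
    Agree k k (recover lam θ (statAt lam θ hk hk w r) : Data T d × ℝ).1 w ∧
      (recover lam θ (statAt lam θ hk hk w r) : Data T d × ℝ).2 = r := by
  have h := recoverAux_statAt hlam hk w hw hr
  refine ⟨⟨fun l hl => ?_, fun l hl => ?_⟩, ?_⟩
  · simp only [recover]
    rw [h l.val hl]
  · simp only [recover]
    rw [dif_pos hl]
    rfl
  · simp only [recover]
    rw [h k le_rfl, midSum_self, zero_add]

end Rec

lemma val_succ_le (i : Fin (T - 1)) : i.val + 1 ≤ T := by
  have := i.isLt
  omega

lemma val_le (i : Fin (T - 1)) : i.val ≤ T := (Nat.le_succ _).trans (val_succ_le i)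

/-! ### Averages over a share and iterated integrals -/

section Basic
variable {lam : (Fin m → ℝ) → ℝ → ℝ} {θ : Param m d}

/-- The average of `κ` over the share of a period in the sum of the later generalized residuals. -/
noncomputable def avg (lam : (Fin m → ℝ) → ℝ → ℝ) (θ : Param m d) (t : Fin T) (k : ℕ)
    (κ : Data T d × ℝ → ℝ) (z : Data T d × ℝ) : ℝ :=
  ∫ b, κ (draw lam θ t z.1 (b * z.2), (1 - b) * z.2) ∂(bt k)

lemma measurable_comp_draw (hlam : IsBaselineHazard (lam θ.α)) (t : Fin T)
    {κ : Data T d × ℝ → ℝ} (hκ : Measurable κ) :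
    Measurable fun z : (Data T d × ℝ) × ℝ =>
      κ (draw lam θ t z.1.1 (z.2 * z.1.2), (1 - z.2) * z.1.2) :=
  hκ.comp (((measurable_fst.comp measurable_fst).draw hlam t (by fun_prop)).prodMk (by fun_prop))

lemma measurable_avg (hlam : IsBaselineHazard (lam θ.α)) (t : Fin T) (k : ℕ)
    {κ : Data T d × ℝ → ℝ} (hκ : Measurable κ) : Measurable (avg lam θ t k κ) := by
  have : StronglyMeasurable (avg lam θ t k κ) :=
    StronglyMeasurable.integral_prod_right
      (f := fun (z : Data T d × ℝ) b => κ (draw lam θ t z.1 (b * z.2), (1 - b) * z.2))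
      (measurable_comp_draw hlam t hκ).stronglyMeasurable
  exact this.measurable

/-- Averaging removes the outcome of the period, but its regressor stays in the rate used by `draw`.
Feedback robustness is what removes that regressor. -/
lemma avg_depOnObs (t : Fin T) (k : ℕ) {κ : Data T d × ℝ → ℝ}
    (hκ : ∀ r, DepOnObs (t.val + 1) (t.val + 1) fun w => κ (w, r)) (r : ℝ) :
    DepOnObs t.val (t.val + 1) fun w => avg lam θ t k κ (w, r) := fun _ _ h =>
  integral_congr_ae (Eventually.of_forall fun _ =>
    hκ _ _ _ (h.draw le_rfl (Nat.lt_succ_self _) _))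

lemma appendShare_statAt (hlam : IsBaselineHazard (lam θ.α)) (t : Fin T) {l : ℕ} (hl : l ≤ T)
    (hlt : l ≤ t.val + 1) (w : Data T d) {r b : ℝ} (hr : 0 < r) (hb : 0 < b) :
    appendShare (statAt lam θ t.isLt.le hl w r) b
      = statAt lam θ (Nat.succ_le_of_lt t.isLt) hl (draw lam θ t w (b * r)) ((1 - b) * r) := by
  rw [statAt_succ, P_draw hlam t w (mul_pos hb hr)]
  have e : b * r + (1 - b) * r = r := by ring
  rw [e, mul_div_cancel_right₀ _ hr.ne',
    (agree_draw (j := t.val + 1) le_rfl w (b * r)).statAt_eq t.isLt.le hl le_rfl (Nat.le_succ _) hlt]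

lemma tailIntegral_last (φ : (Fin (T + 1) → ℝ) → (Fin T → (Fin d → ℝ)) → ℝ) (w : Data T d) :
    tailIntegral lam θ φ (Fin.last T) w.1 w.2.1 w.2.2 = φ w.1 w.2.1 := by
  rw [tailIntegral, Fin.reverseInduction_last]

lemma tailIntegral_castSucc (φ : (Fin (T + 1) → ℝ) → (Fin T → (Fin d → ℝ)) → ℝ) (t : Fin T)
    (w : Data T d) :
    tailIntegral lam θ φ t.castSucc w.1 w.2.1 w.2.2
      = ∫ u in Ioi (0 : ℝ), tailIntegral lam θ φ t.succ (setY t w u).1 (setY t w u).2.1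
          (setY t w u).2.2 * density lam θ u (w.1 t.castSucc) (w.2.1 t) w.2.2 := by
  rw [tailIntegral, Fin.reverseInduction_castSucc]
  rfl

lemma setIntegral_spell (hlam : IsBaselineHazard (lam θ.α)) (t : Fin T) (w : Data T d)
    {J : Data T d → ℝ} (hJ : Measurable J) :
    ∫ u in Ioi (0 : ℝ), J (setY t w u) * density lam θ u (w.1 t.castSucc) (w.2.1 t) w.2.2
      = ∫ e, J (draw lam θ t w (Real.exp (-w.2.2) * e)) ∂(gm 1) := by
  have hsp : Measurable (spellPDF (lam θ.α) (rate θ t w * Real.exp w.2.2)) :=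
    (measurable_spellPDF hlam.measurable).comp (measurable_const.prodMk measurable_id)
  have hm : Measurable fun u => J (setY t w u) := hJ.comp (measurable_const.setY t measurable_id)
  have hi := hlam.measurable_cumHazInv
  have h := integral_withDensity_eq_integral_toReal_smul (μ := volume.restrict (Ioi (0 : ℝ))) hsp
    (Eventually.of_forall fun u => ENNReal.ofReal_lt_top) (fun u => J (setY t w u))
  rw [spell_eq_map_draw hlam, integral_map (by fun_prop) hm.aestronglyMeasurable] at h
  simp only [draw]
  rw [h]
  refine setIntegral_congr_fun measurableSet_Ioi fun u hu => ?_
  have h1 := hlam.pos u hu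
  have h2 := rate_pos θ t w
  simp only [spellPDF]
  rw [ENNReal.toReal_ofReal (by positivity), density_eq, smul_eq_mul, mul_comm]

lemma exists_measurable_take {i : ℕ} {F : Data T d → ℝ} (hi : i ≤ T) (hF : Measurable F)
    (hFd : DepOn i i F) :
    ∃ h : (Fin (i + 1) → ℝ) × (Fin i → (Fin d → ℝ)) × ℝ → ℝ, Measurable h ∧
      ∀ w : Data T d, F w = h (take (Nat.succ_le_succ hi) w.1, take hi w.2.1, w.2.2) := by
  refine ⟨fun q => F (fun l => if h : l.val < i + 1 then q.1 ⟨l.val, h⟩ else 0,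
    fun l => if h : l.val < i then q.2.1 ⟨l.val, h⟩ else 0, q.2.2), hF.comp ?_, fun w => ?_⟩
  · refine Measurable.prodMk ?_ (Measurable.prodMk ?_ (by fun_prop))
    · refine measurable_pi_lambda _ fun l => ?_
      split_ifs <;> fun_prop
    · refine measurable_pi_lambda _ fun l => ?_
      split_ifs <;> fun_prop
  · refine hFd _ _ ⟨fun l hl => ?_, fun l hl => ?_⟩ rfl
    · simp only
      rw [dif_pos (by omega)]
      rfl
    · simp only
      rw [dif_pos hl]
      rfl

variable {ψ : (t : Fin (T - 1)) → ℝ × (Fin (t.val + 1) → ℝ) × ℝ × (Fin (t.val + 1) → (Fin d → ℝ)) → ℝ}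

/-- The term with index `i` as a function of the data and of the sum of the generalized residuals
from index `s` onwards. -/
noncomputable def psiAt (lam : (Fin m → ℝ) → ℝ → ℝ) (θ : Param m d)
    (ψ : (t : Fin (T - 1)) →
      ℝ × (Fin (t.val + 1) → ℝ) × ℝ × (Fin (t.val + 1) → (Fin d → ℝ)) → ℝ)
    (i : Fin (T - 1)) (s : ℕ) (z : Data T d × ℝ) : ℝ :=
  ψ i (statAt lam θ (val_succ_le i) (val_succ_le i) z.1
    (midSum lam θ (i.val + 1) s z.1 + z.2))

lemma measurable_psiAt (hlam : IsBaselineHazard (lam θ.α)) (hψ : ∀ i, Measurable (ψ i))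
    (i : Fin (T - 1)) (s : ℕ) : Measurable (psiAt lam θ ψ i s) := by
  have hM : Measurable fun z : Data T d × ℝ => midSum lam θ (i.val + 1) s z.1 :=
    (measurable_midSum hlam _ _).comp measurable_fst
  exact (hψ i).comp ((measurable_statAt hlam _ _).comp
    (f := fun z : Data T d × ℝ => (z.1, midSum lam θ (i.val + 1) s z.1 + z.2)) (by fun_prop))

lemma psiAt_dep (i : Fin (T - 1)) {s : ℕ} (hs : i.val + 1 ≤ s) (r : ℝ) :
    DepOnObs s s fun w => psiAt lam θ ψ i s (w, r) := by
  intro w w' h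
  simp only [psiAt]
  rw [h.midSum_eq le_rfl le_rfl, h.statAt_eq _ _ hs hs hs]

lemma psiAt_tailSum (i : Fin (T - 1)) {s : ℕ} (hs : i.val + 1 ≤ s) (w : Data T d) :
    psiAt lam θ ψ i s (w, tailSum lam θ s w)
      = ψ i (stat lam θ (val_succ_le i) (val_succ_le i) w) := by
  simp only [psiAt]
  rw [stat_eq_statAt, tailSum_eq_midSum_add hs]

/-- A term of smaller index sees period t only through P_t + R_{t+1}, and b r + (1 - b) r = r for
every share b. -/
lemma avg_psiAt (hlam : IsBaselineHazard (lam θ.α)) (i : Fin (T - 1)) (t : Fin T) (k : ℕ)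
    (hi : i.val + 1 ≤ t.val) (w : Data T d) {r : ℝ} (hr : 0 < r) :
    avg lam θ t k (psiAt lam θ ψ i (t.val + 1)) (w, r) = psiAt lam θ ψ i t.val (w, r) := by
  have : ∀ᵐ b ∂(bt k), psiAt lam θ ψ i (t.val + 1) (draw lam θ t w (b * r), (1 - b) * r)
      = psiAt lam θ ψ i t.val (w, r) := by
    filter_upwards [bt_ae_mem k] with b hb
    have h := agree_draw (lam := lam) (θ := θ) (t := t) (i := t.val) (j := T) le_rfl w (b * r)
    simp only [psiAt]
    rw [midSum_succ t hi, P_draw hlam t w (mul_pos hb.1 hr), h.midSum_eq le_rfl t.isLt.le,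
      h.statAt_eq _ _ hi (by omega) (by omega)]
    congr 2
    ring
  rw [avg, integral_congr_ae this]
  simp

lemma avg_psiAt_self (hlam : IsBaselineHazard (lam θ.α)) (i : Fin (T - 1)) (t : Fin T) (k : ℕ)
    (hi : i.val = t.val) (w : Data T d) {r : ℝ} (hr : 0 < r) :
    avg lam θ t k (psiAt lam θ ψ i (t.val + 1)) (w, r)
      = ∫ b, ψ i (appendShare (statAt lam θ (val_le i)
        (val_succ_le i) w r) b) ∂(bt k) := by
  have hiT : i.val < T := by have := i.isLt; omega
  obtain ⟨n, hn⟩ := t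
  obtain rfl : i.val = n := hi
  refine integral_congr_ae ?_
  filter_upwards [bt_ae_mem k] with b hb
  rw [appendShare_statAt hlam ⟨i.val, hiT⟩ _ le_rfl w hr hb.1]
  simp only [psiAt, midSum_self, zero_add]

end Basic

section Law
variable [NeZero T] {D : Design T d} {lam : (Fin m → ℝ) → ℝ → ℝ} {θ : Param m d}

/-- The inner integral is known only up to a null set, so `ae_setY` is needed to insert its value
along almost every line. -/
lemma ae_tailIntegral_castSucc (hlam : IsBaselineHazard (lam θ.α))
    (φ : (Fin (T + 1) → ℝ) → (Fin T → (Fin d → ℝ)) → ℝ) (t : Fin T) {J : Data T d → ℝ}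
    (hJ : Measurable J)
    (h : ∀ᵐ w ∂D.dominating, tailIntegral lam θ φ t.succ w.1 w.2.1 w.2.2 = J w) :
    ∀ᵐ w ∂D.dominating, tailIntegral lam θ φ t.castSucc w.1 w.2.1 w.2.2
      = ∫ e, J (draw lam θ t w (Real.exp (-w.2.2) * e)) ∂(gm 1) := by
  filter_upwards [ae_setY D t h] with w hw
  rw [tailIntegral_castSucc, ← setIntegral_spell hlam t w hJ]
  refine integral_congr_ae ?_
  filter_upwards [hw] with u hu
  rw [hu]

/-- The representations of R_{t+1} and of P_t turn the absolute moment into a mean of conditional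
absolute moments, which are then finite almost everywhere. -/
lemma ae_integrable_draw (hlam : IsBaselineHazard (lam θ.α)) (ω : Nuisance D) (t : Fin T) {k : ℕ}
    (hk : t.val + 1 + k = T) {κ : Data T d × ℝ → ℝ} (hκ : Measurable κ)
    (hκd : ∀ r, DepOn (t.val + 1) (t.val + 1) fun w => κ (w, r))
    (hint : Integrable (fun w => κ (w, tailSum lam θ (t.val + 1) w)) (law lam θ ω)) :
    ∀ᵐ w ∂D.dominating, Integrable (fun z : ℝ × ℝ =>
      κ (draw lam θ t w (Real.exp (-w.2.2) * z.1), Real.exp (-w.2.2) * z.2))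
        ((gm 1).prod (gm k)) := by
  rw [← ae_law_iff hlam ω]
  have h := hint.2
  have e := lintegral_law_tailSum hlam ω k (t.val + 1) hk (fun z => ‖κ z‖ₑ) (by fun_prop)
    (fun r w w' h ha => congrArg _ (hκd r w w' (h.mono le_rfl (Nat.le_succ _)) ha))
  have hm : Measurable fun q : Data T d × ℝ => ‖κ (q.1, Real.exp (-q.1.2.2) * q.2)‖ₑ := by fun_prop
  rw [HasFiniteIntegral, e, lintegral_law_draw hlam ω t hm.lintegral_prod_right'
    (fun w w' h ha => by
      refine lintegral_congr fun r => ?_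
      rw [ha]
      exact congrArg _ (hκd _ w w' h ha))] at h
  have hm2 : Measurable fun q : Data T d × ℝ => ∫⁻ r,
      ‖κ (draw lam θ t q.1 (Real.exp (-q.1.2.2) * q.2), Real.exp (-q.1.2.2) * r)‖ₑ ∂(gm k) :=
    hm.lintegral_prod_right'.comp (measurable_fst.draw hlam t
      (g := fun q : Data T d × ℝ => Real.exp (-q.1.2.2) * q.2) (by fun_prop))
  filter_upwards [ae_lt_top hm2.lintegral_prod_right' h.ne] with w hw
  have hm3 : Measurable fun z : ℝ × ℝ =>
      κ (draw lam θ t w (Real.exp (-w.2.2) * z.1), Real.exp (-w.2.2) * z.2) :=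
    hκ.comp ((measurable_const.draw hlam t (by fun_prop)).prodMk (by fun_prop))
  refine ⟨hm3.aestronglyMeasurable, ?_⟩
  rw [HasFiniteIntegral, lintegral_prod _ hm3.enorm.aemeasurable]
  exact hw

/-- Integrating out one outcome replaces `κ` by its average over the share of that period. -/
lemma ae_integral_draw (hlam : IsBaselineHazard (lam θ.α)) (ω : Nuisance D) (t : Fin T) {k : ℕ}
    (hk : t.val + 1 + k = T) {κ : Data T d × ℝ → ℝ} (hκ : Measurable κ)
    (hκd : ∀ r, DepOn (t.val + 1) (t.val + 1) fun w => κ (w, r))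
    (hint : Integrable (fun w => κ (w, tailSum lam θ (t.val + 1) w)) (law lam θ ω)) :
    ∀ᵐ w ∂D.dominating,
      Integrable (fun e => ∫ r, κ (draw lam θ t w (Real.exp (-w.2.2) * e),
        Real.exp (-w.2.2) * r) ∂(gm k)) (gm 1) ∧
      Integrable (fun r => avg lam θ t k κ (w, Real.exp (-w.2.2) * r)) (gm (k + 1)) ∧
      ∫ e, ∫ r, κ (draw lam θ t w (Real.exp (-w.2.2) * e), Real.exp (-w.2.2) * r) ∂(gm k) ∂(gm 1)
        = ∫ r, avg lam θ t k κ (w, Real.exp (-w.2.2) * r) ∂(gm (k + 1)) := by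
  filter_upwards [ae_integrable_draw hlam ω t hk hκ hκd hint] with w hw
  have hm3 : Measurable fun z : ℝ × ℝ =>
      κ (draw lam θ t w (Real.exp (-w.2.2) * z.1), Real.exp (-w.2.2) * z.2) :=
    hκ.comp ((measurable_const.draw hlam t (by fun_prop)).prodMk (by fun_prop))
  have hb : Measurable fun z : ℝ × ℝ => (z.2 * z.1, (1 - z.2) * z.1) := by fun_prop
  have e1 : ∀ r b : ℝ, κ (draw lam θ t w (Real.exp (-w.2.2) * (b * r)),
      Real.exp (-w.2.2) * ((1 - b) * r)) = κ (draw lam θ t w (b * (Real.exp (-w.2.2) * r)),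
      (1 - b) * (Real.exp (-w.2.2) * r)) := fun r b => by
    rw [mul_left_comm _ b, mul_left_comm _ (1 - b)]
  have hw2 := hw
  rw [← map_bt_gm, integrable_map_measure hm3.aestronglyMeasurable hb.aemeasurable] at hw2
  simp only [Function.comp_def, e1] at hw2
  refine ⟨hw.integral_prod_left, hw2.integral_prod_left, ?_⟩
  rw [← integral_prod (f := fun z : ℝ × ℝ =>
    κ (draw lam θ t w (Real.exp (-w.2.2) * z.1), Real.exp (-w.2.2) * z.2)) hw, ← map_bt_gm,
    integral_map hb.aemeasurable hm3.aestronglyMeasurable]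
  simp only [e1]
  rw [integral_prod _ hw2]
  rfl

/-- `lintegral_law_share` applied to |κ| after a redraw: drawing the observed residual returns the
observed point. It follows that averaging over a share contracts the L¹ norm. -/
lemma lintegral_law_avg (hlam : IsBaselineHazard (lam θ.α)) (ω : Nuisance D) (t : Fin T) {k : ℕ}
    (hk : t.val + 1 + k = T) {κ : Data T d × ℝ → ℝ} (hκ : Measurable κ)
    (hκd : ∀ r, DepOn (t.val + 1) (t.val + 1) fun w => κ (w, r)) :
    ∫⁻ w, ∫⁻ b, ‖κ (draw lam θ t w (b * tailSum lam θ t.val w),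
      (1 - b) * tailSum lam θ t.val w)‖ₑ ∂(bt k) ∂(law lam θ ω)
      = ∫⁻ w, ‖κ (w, tailSum lam θ (t.val + 1) w)‖ₑ ∂(law lam θ ω) := by
  have h := lintegral_law_share hlam ω t hk (F := fun z => ‖κ (draw lam θ t z.1 z.2.1, z.2.2)‖ₑ)
    (hκ.comp ((measurable_fst.draw hlam t (by fun_prop)).prodMk (by fun_prop))).enorm
    (fun z w w' h ha => congrArg _ (hκd _ _ _ (h.draw le_rfl (Nat.lt_succ_self _) _) ha))
  rw [← h]
  refine lintegral_congr_ae ?_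
  filter_upwards [ae_law_pos hlam ω] with w hw
  rw [draw_P hlam t w (hw t)]

lemma integrable_avg (hlam : IsBaselineHazard (lam θ.α)) (ω : Nuisance D) (t : Fin T) {k : ℕ}
    (hk : t.val + 1 + k = T) {κ : Data T d × ℝ → ℝ} (hκ : Measurable κ)
    (hκd : ∀ r, DepOn (t.val + 1) (t.val + 1) fun w => κ (w, r))
    (hint : Integrable (fun w => κ (w, tailSum lam θ (t.val + 1) w)) (law lam θ ω)) :
    Integrable (fun w => avg lam θ t k κ (w, tailSum lam θ t.val w)) (law lam θ ω) ∧
    ∀ᵐ w ∂(law lam θ ω), Integrable (fun b => κ (draw lam θ t w (b * tailSum lam θ t.val w),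
      (1 - b) * tailSum lam θ t.val w)) (bt k) := by
  have h := hint.2
  rw [HasFiniteIntegral, ← lintegral_law_avg hlam ω t hk hκ hκd] at h
  have ht := measurable_tailSum (T := T) (d := d) hlam t.val
  have ha := measurable_avg hlam t k hκ
  have hm : Measurable fun z : Data T d × ℝ => κ (draw lam θ t z.1 (z.2 * tailSum lam θ t.val z.1),
      (1 - z.2) * tailSum lam θ t.val z.1) :=
    (measurable_comp_draw hlam t hκ).comp (f := fun z : Data T d × ℝ =>
      ((z.1, tailSum lam θ t.val z.1), z.2)) (by fun_prop)
  refine ⟨⟨Measurable.aestronglyMeasurable (by fun_prop), ?_⟩, ?_⟩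
  · exact (lintegral_mono fun w => enorm_integral_le_lintegral_enorm _).trans_lt h
  · filter_upwards [ae_lt_top hm.enorm.lintegral_prod_right' h.ne] with w hw
    exact ⟨(hm.comp measurable_prodMk_left).aestronglyMeasurable, hw⟩

/-! ### Sufficiency: from the decomposition to robustness -/

section Backward
variable {φ : (Fin (T + 1) → ℝ) → (Fin T → (Fin d → ℝ)) → ℝ}
  {ψ : (t : Fin (T - 1)) → ℝ × (Fin (t.val + 1) → ℝ) × ℝ × (Fin (t.val + 1) → (Fin d → ℝ)) → ℝ}

/-- Backward induction on s. Each integration leaves the terms with i < t as they are and removes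
the term i = t, whose share average is its conditional mean given the shorter statistic. -/
lemma ae_tailIntegral_eq_sum (hlam : IsBaselineHazard (lam θ.α)) (ω : Nuisance D)
    (hψ : ∀ i, Measurable (ψ i))
    (hint : ∀ t : Fin (T - 1), Integrable
          (fun w => ψ t (stat lam θ (val_succ_le t)
            (val_succ_le t) w)) (law lam θ ω))
    (hsum : ∀ᵐ w ∂(law lam θ ω), φ w.1 w.2.1 =
          ∑ t : Fin (T - 1), ψ t (stat lam θ (val_succ_le t)
            (val_succ_le t) w))
    (hce : ∀ t : Fin (T - 1),
          (law lam θ ω)[fun w => ψ t (stat lam θ (val_succ_le t)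
              (val_succ_le t) w) |
            MeasurableSpace.comap
              (stat lam θ (val_le t) (val_succ_le t))
              inferInstance] =ᵐ[law lam θ ω] 0) (s : Fin (T + 1)) :
    ∀ᵐ w ∂D.dominating, tailIntegral lam θ φ s w.1 w.2.1 w.2.2
      = ∑ i : Fin (T - 1) with i.val < s.val,
        ∫ r, psiAt lam θ ψ i s.val (w, Real.exp (-w.2.2) * r) ∂(gm (T - s.val)) := by
  induction s using Fin.reverseInduction with
  | last =>
    rw [ae_law_iff hlam ω] at hsum
    filter_upwards [hsum] with w hw
    rw [tailIntegral_last, hw, Finset.filter_true_of_mem fun i _ => by simp; omega]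
    refine Finset.sum_congr rfl fun i _ => ?_
    -- At s = T the tail sum is empty and `gm 0` is the point mass at 0.
    rw [← psiAt_tailSum (lam := lam) (θ := θ) (ψ := ψ) i (val_succ_le i) w, tailSum_of_le le_rfl]
    simp [gm]
  | cast t ih =>
    have hk : t.val + 1 + (T - (t.val + 1)) = T := by have := t.isLt; omega
    have hpm := fun i s => measurable_psiAt hlam hψ i s
    have hJ : Measurable fun w : Data T d => ∑ i : Fin (T - 1) with i.val < t.val + 1,
        ∫ r, psiAt lam θ ψ i (t.val + 1) (w, Real.exp (-w.2.2) * r) ∂(gm (T - (t.val + 1))) := by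
      refine Finset.measurable_fun_sum _ fun i _ => ?_
      refine (StronglyMeasurable.integral_prod_right (f := fun (w : Data T d) r =>
        psiAt lam θ ψ i (t.val + 1) (w, Real.exp (-w.2.2) * r)) ?_).measurable
      exact ((hpm i _).comp (f := fun z : Data T d × ℝ => (z.1, Real.exp (-z.1.2.2) * z.2))
        (by fun_prop)).stronglyMeasurable
    have h1 := ae_tailIntegral_castSucc (D := D) hlam φ t hJ ih
    have h2 : ∀ᵐ w ∂D.dominating, ∀ i : Fin (T - 1), i.val < t.val + 1 →
        Integrable (fun e => ∫ r, psiAt lam θ ψ i (t.val + 1)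
          (draw lam θ t w (Real.exp (-w.2.2) * e), Real.exp (-w.2.2) * r)
            ∂(gm (T - (t.val + 1)))) (gm 1) ∧
        ∫ e, ∫ r, psiAt lam θ ψ i (t.val + 1)
          (draw lam θ t w (Real.exp (-w.2.2) * e), Real.exp (-w.2.2) * r)
            ∂(gm (T - (t.val + 1))) ∂(gm 1)
        = if i.val < t.val then
          ∫ r, psiAt lam θ ψ i t.val (w, Real.exp (-w.2.2) * r) ∂(gm (T - t.val)) else 0 := by
      refine ae_all_iff.2 fun i => ?_
      by_cases hi : i.val < t.val + 1
      swap
      · exact Eventually.of_forall fun w h => absurd h hi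
      have e1 := ae_integral_draw hlam ω t hk (hpm i (t.val + 1))
        (fun r => (psiAt_dep i (by omega) r).depOn)
        (by simpa only [psiAt_tailSum i (show i.val + 1 ≤ t.val + 1 by omega)] using hint i)
      have hkk : T - (t.val + 1) + 1 = T - t.val := by omega
      rcases (Nat.lt_succ_iff.1 hi).lt_or_eq with hit | hit
      · filter_upwards [e1] with w hw _
        refine ⟨hw.1, ?_⟩
        rw [hw.2.2, if_pos hit, ← hkk]
        refine integral_congr_ae ?_
        filter_upwards [gm_ae_pos (T - (t.val + 1))] with r hr
        exact avg_psiAt hlam i t _ (by omega) w (mul_pos (Real.exp_pos _) hr)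
      -- The conditional mean vanishes at the realized R_i. The Gamma representation makes this a
      -- statement for almost every r, which is what the integral against `gm` needs.
      · have hzero : ∀ᵐ w ∂(law lam θ ω), ∀ᵐ r ∂(gm (T - (t.val + 1) + 1)),
            ∫ b, ψ i (appendShare (statAt lam θ (val_le i)
              (val_succ_le i) w (Real.exp (-w.2.2) * r)) b)
              ∂(bt (T - (t.val + 1))) = 0 := by
          have happ := measurable_appendShare (k := i.val) (α := ℝ × (Fin (i.val + 1) → (Fin d → ℝ)))
          have hm2 : StronglyMeasurable fun q => ∫ b, ψ i (appendShare q b)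
              ∂(bt (T - (t.val + 1))) :=
            StronglyMeasurable.integral_prod_right (f := fun q b => ψ i (appendShare q b))
              ((hψ i).comp happ).stronglyMeasurable
          refine (ae_law_tailSum_iff hlam ω (s := i.val) (by omega) (p := fun w r =>
            ∫ b, ψ i (appendShare (statAt lam θ (val_le i)
              (val_succ_le i) w r) b) ∂(bt (T - (t.val + 1))) = 0) ?_ ?_).1 ?_
          · exact (hm2.measurable.comp (measurable_statAt hlam (val_le i)
              (val_succ_le i))) (measurableSet_singleton 0)
          · intro r w w' h _
            simp only
            rw [h.statAt_eq _ _ le_rfl (Nat.le_succ _) le_rfl]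
          · have hc := condExp_stat hlam ω ⟨i.val, by omega⟩ (k := T - (t.val + 1))
              (by simp only; omega)
              (val_succ_le i) le_rfl (hψ i) (hint i)
            filter_upwards [hc, hce i] with w h1 h2
            rw [← stat_eq_statAt]
            exact h1.trans h2
        filter_upwards [e1, (ae_law_iff hlam ω).1 hzero] with w hw hz _
        refine ⟨hw.1, ?_⟩
        rw [hw.2.2, if_neg (by omega)]
        refine (integral_congr_ae ?_).trans (integral_zero' _ _)
        filter_upwards [gm_ae_pos (T - (t.val + 1)), hz] with r hr hzr
        rw [avg_psiAt_self hlam i t _ hit w (mul_pos (Real.exp_pos _) hr), hzr]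
        rfl
    filter_upwards [h1, h2] with w hw1 hw2
    rw [hw1]
    have hdr : ∀ e, (draw lam θ t w (Real.exp (-w.2.2) * e)).2.2 = w.2.2 := fun e => rfl
    simp only [hdr]
    rw [integral_finsetSum _ fun i hi => (hw2 i (Finset.mem_filter.1 hi).2).1,
      Finset.sum_congr rfl fun i hi => (hw2 i (Finset.mem_filter.1 hi).2).2, Finset.sum_ite,
      Finset.sum_const_zero, add_zero, Finset.filter_filter]
    refine Finset.sum_congr ?_ fun _ _ => rfl
    ext i
    simp only [Finset.mem_filter, Finset.mem_univ, true_and, Fin.val_castSucc]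
    omega

end Backward

end Law

/-! ### Necessity: completeness and representing functions -/

section Law
variable [NeZero T] {D : Design T d} {lam : (Fin m → ℝ) → ℝ → ℝ} {θ : Param m d}

/-- π(· | y_0, x_1) is a Lebesgue density of mass one that vanishes off this section of the support,
so the section cannot be null. -/
lemma Nuisance.volume_supp_ne_zero (ω : Nuisance D) {y₀ : ℝ} {x₁ : Fin d → ℝ} {a₀ : ℝ}
    (h : (y₀, x₁, a₀) ∈ D.supp) {q : ℝ → Prop}
    (hq : ∀ᵐ a, (y₀, x₁, a) ∈ D.supp → q a) : volume {a | (y₀, x₁, a) ∈ D.supp ∧ q a} ≠ 0 := by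
  intro h0
  have hν := ((ω.mem_supp_iff _ _ _).1 h).1
  have h1 := ω.lintegral_π y₀ x₁ hν
  have h2 : ∀ᵐ a, a ∉ {a | (y₀, x₁, a) ∈ D.supp ∧ q a} := measure_eq_zero_iff_ae_notMem.1 h0
  have h3 : ∀ᵐ a, ENNReal.ofReal (ω.π y₀ x₁ a) = 0 := by
    filter_upwards [h2, hq] with a ha hqa
    by_contra hne
    have hs : (y₀, x₁, a) ∈ D.supp :=
      (ω.mem_supp_iff _ _ _).2 ⟨hν, by simpa [ENNReal.ofReal_eq_zero] using hne⟩
    exact ha ⟨hs, hqa hs⟩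
  rw [lintegral_congr_ae h3] at h1
  simp at h1

/-- Completeness of the Gamma family, with the heterogeneity as its log rate. -/
lemma ae_eq_zero_of_ae_integral_gm (ω : Nuisance D) (k : ℕ) {f : Data T d × ℝ → ℝ}
    (hf : Measurable f) {i j : ℕ} (hfd : ∀ r, DepOnObs i j fun w => f (w, r))
    (h : ∀ᵐ w ∂D.dominating, Integrable (fun r => f (w, Real.exp (-w.2.2) * r)) (gm (k + 1)) ∧
      ∫ r, f (w, Real.exp (-w.2.2) * r) ∂(gm (k + 1)) = 0) :
    ∀ᵐ w ∂D.dominating, ∀ᵐ v ∂(volume.restrict (Ioi (0 : ℝ))), f (w, v) = 0 := by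
  have hm : Measurable fun w : Data T d => ∫⁻ v in Ioi (0 : ℝ), ‖f (w, v)‖ₑ :=
    hf.enorm.lintegral_prod_right'
  have hiff : ∀ w : Data T d, (∀ᵐ v ∂(volume.restrict (Ioi (0 : ℝ))), f (w, v) = 0) ↔
      ∫⁻ v in Ioi (0 : ℝ), ‖f (w, v)‖ₑ = 0 := fun w => by
    rw [lintegral_eq_zero_iff (by fun_prop)]
    simp [EventuallyEq]
  have hM : MeasurableSet {w : Data T d | w ∈ D.suppSet →
      ∫⁻ v in Ioi (0 : ℝ), ‖f (w, v)‖ₑ = 0} :=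
    D.measurableSet_suppSet.imp (hm (measurableSet_singleton 0))
  unfold Design.dominating at h ⊢
  rw [ae_restrict_iff' (by exact D.measurableSet_suppSet)] at h ⊢
  simp only [hiff]
  -- Fix (y, x). There f is one function of v, and the hypothesis holds for almost every a in a
  -- non-null section of the support, as completeness requires.
  refine (Measure.ae_prod_iff_ae_ae hM).2 ?_
  filter_upwards [Measure.ae_ae_of_ae_prod h] with y hy
  refine (Measure.ae_prod_iff_ae_ae (measurable_prodMk_left hM)).2 ?_
  filter_upwards [Measure.ae_ae_of_ae_prod hy] with x hx
  refine Eventually.of_forall fun a₀ ha₀ => ?_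
  rw [← hiff]
  have hd : ∀ a v, f ((y, x, a), v) = f ((y, x, a₀), v) := fun a v =>
    hfd v _ _ ⟨fun _ _ => rfl, fun _ _ => rfl⟩
  refine ae_eq_zero_of_integral_gm_eq_zero k (f := fun v => f ((y, x, a₀), v)) (by fun_prop)
    (ω.volume_supp_ne_zero ha₀ hx) (fun a ha => ?_) fun a ha => ?_
  · simpa only [hd a] using ha.2.1
  · simpa only [hd a] using ha.2.2

/-- Positive scaling preserves Lebesgue null sets, and these are the null sets of the Gamma laws on
(0, ∞). -/
lemma ae_comp_tailSum_eq_zero (hlam : IsBaselineHazard (lam θ.α)) (ω : Nuisance D) {s k : ℕ}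
    (hs : s + (k + 1) = T) {f : Data T d × ℝ → ℝ} (hf : Measurable f)
    (hfd : ∀ r, DepOnObs s (s + 1) fun w => f (w, r))
    (h : ∀ᵐ w ∂D.dominating, Integrable (fun r => f (w, Real.exp (-w.2.2) * r)) (gm (k + 1)) ∧
      ∫ r, f (w, Real.exp (-w.2.2) * r) ∂(gm (k + 1)) = 0) :
    ∀ᵐ w ∂(law lam θ ω), f (w, tailSum lam θ s w) = 0 := by
  refine (ae_law_tailSum_iff hlam ω hs (p := fun w r => f (w, r) = 0)
    (hf (measurableSet_singleton 0)) fun r w w' h _ => congrArg (· = 0) (hfd r w w' h)).2 ?_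
  rw [ae_law_iff hlam ω]
  filter_upwards [ae_eq_zero_of_ae_integral_gm ω k hf hfd h] with w hw
  rw [ae_gm_iff, ae_restrict_iff' measurableSet_Ioi]
  rw [ae_restrict_iff' measurableSet_Ioi] at hw
  have hq : Measure.QuasiMeasurePreserving (fun r : ℝ => Real.exp (-w.2.2) * r) volume volume :=
    ⟨by fun_prop, by
      rw [Real.map_volume_mul_left (Real.exp_pos _).ne']
      exact Measure.smul_absolutelyContinuous⟩
  filter_upwards [hq.ae hw] with r hr hr0
  exact hr (mul_pos (Real.exp_pos _) hr0)

/-- `κ` at the sum of the generalized residuals from index `s` onwards represents the iterated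
integral over the outcomes from index `s` onwards. -/
structure Represents (lam : (Fin m → ℝ) → ℝ → ℝ) (θ : Param m d) (ω : Nuisance D)
    (φ : (Fin (T + 1) → ℝ) → (Fin T → (Fin d → ℝ)) → ℝ) (s : Fin (T + 1))
    (κ : Data T d × ℝ → ℝ) : Prop where
  measurable : Measurable κ
  depOnObs : ∀ r, DepOnObs s.val s.val fun w => κ (w, r)
  integrable : Integrable (fun w => κ (w, tailSum lam θ s.val w)) (law lam θ ω)
  ae_eq : ∀ᵐ w ∂D.dominating, tailIntegral lam θ φ s w.1 w.2.1 w.2.2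
    = ∫ r, κ (w, Real.exp (-w.2.2) * r) ∂(gm (T - s.val))

variable {ω : Nuisance D} {φ : (Fin (T + 1) → ℝ) → (Fin T → (Fin d → ℝ)) → ℝ}

lemma represents_last (hφ : Measurable fun q : (Fin (T + 1) → ℝ) × (Fin T → (Fin d → ℝ)) =>
      φ q.1 q.2) (hint : Integrable (fun w => φ w.1 w.2.1) (law lam θ ω)) :
    Represents lam θ ω φ (Fin.last T) fun z => φ z.1.1 z.1.2.1 where
  measurable := hφ.comp (f := fun z : Data T d × ℝ => (z.1.1, z.1.2.1)) (by fun_prop)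
  depOnObs r w w' h := by
    have h1 : w.1 = w'.1 := funext fun i => h.1 i (by have := i.isLt; simp; omega)
    have h2 : w.2.1 = w'.2.1 := funext fun i => h.2 i i.isLt
    simp only [h1, h2]
  integrable := hint
  ae_eq := Eventually.of_forall fun w => by
    rw [tailIntegral_last]
    simp [gm]

lemma Represents.ae_eq_avg (hlam : IsBaselineHazard (lam θ.α)) {t : Fin T} {k : ℕ}
    (hk : t.val + 1 + k = T) {κ : Data T d × ℝ → ℝ} (h : Represents lam θ ω φ t.succ κ) :
    ∀ᵐ w ∂D.dominating,
      Integrable (fun r => avg lam θ t k κ (w, Real.exp (-w.2.2) * r)) (gm (k + 1)) ∧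
      tailIntegral lam θ φ t.castSucc w.1 w.2.1 w.2.2
        = ∫ r, avg lam θ t k κ (w, Real.exp (-w.2.2) * r) ∂(gm (k + 1)) := by
  have hkk : T - t.succ.val = k := by simp only [Fin.val_succ]; omega
  have hJ : Measurable fun w : Data T d => ∫ r, κ (w, Real.exp (-w.2.2) * r) ∂(gm k) :=
    (StronglyMeasurable.integral_prod_right (f := fun (w : Data T d) r =>
      κ (w, Real.exp (-w.2.2) * r)) (h.measurable.comp (f := fun z : Data T d × ℝ =>
        (z.1, Real.exp (-z.1.2.2) * z.2)) (by fun_prop)).stronglyMeasurable).measurable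
  have h1 := h.ae_eq
  rw [hkk] at h1
  filter_upwards [ae_tailIntegral_castSucc hlam φ t hJ h1,
    ae_integral_draw hlam ω t hk h.measurable (fun r => (h.depOnObs r).depOn) h.integrable]
    with w hw1 hw2
  exact ⟨hw2.2.1, hw1.trans hw2.2.2⟩

/-- The share average of κ and κ' have the same Gamma average, and neither involves a. By
completeness they agree at R_t, so that κ' inherits integrability from the share average. -/
lemma Represents.castSucc_of_avg (hlam : IsBaselineHazard (lam θ.α)) {t : Fin T} {k : ℕ}
    (hk : t.val + 1 + k = T) {κ κ' : Data T d × ℝ → ℝ} (h : Represents lam θ ω φ t.succ κ)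
    (hm : Measurable κ') (hd : ∀ r, DepOnObs t.val t.val fun w => κ' (w, r))
    (hint : ∀ᵐ w ∂D.dominating,
      Integrable (fun r => κ' (w, Real.exp (-w.2.2) * r)) (gm (k + 1)))
    (heq : ∀ᵐ w ∂D.dominating, tailIntegral lam θ φ t.castSucc w.1 w.2.1 w.2.2
      = ∫ r, κ' (w, Real.exp (-w.2.2) * r) ∂(gm (k + 1))) :
    Represents lam θ ω φ t.castSucc κ' ∧ ∀ᵐ w ∂(law lam θ ω),
      avg lam θ t k κ (w, tailSum lam θ t.val w) = κ' (w, tailSum lam θ t.val w) := by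
  have hA := measurable_avg hlam t k h.measurable
  have hz : ∀ᵐ w ∂(law lam θ ω),
      avg lam θ t k κ (w, tailSum lam θ t.val w) = κ' (w, tailSum lam θ t.val w) := by
    have := ae_comp_tailSum_eq_zero hlam ω (s := t.val) (k := k) (by omega)
      (f := fun z => avg lam θ t k κ z - κ' z) (by fun_prop) (fun r w w' h' => ?_) ?_
    · filter_upwards [this] with w hw
      exact sub_eq_zero.1 hw
    · exact congrArg₂ (· - ·) (avg_depOnObs t k h.depOnObs r w w' h')
        (hd r w w' (h'.mono le_rfl (Nat.le_succ _)))
    · filter_upwards [h.ae_eq_avg hlam hk, hint, heq] with w h1 h2 h3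
      refine ⟨h1.1.sub h2, ?_⟩
      rw [integral_sub h1.1 h2, ← h1.2, ← h3, sub_self]
  refine ⟨⟨hm, hd, ?_, ?_⟩, hz⟩
  · exact (integrable_avg hlam ω t hk h.measurable (fun r => (h.depOnObs r).depOn)
      h.integrable).1.congr hz
  · have hkk : T - t.castSucc.val = k + 1 := by simp only [Fin.val_castSucc]; omega
    rw [hkk]
    exact heq

/-- The representing function is the share average with the regressor of index t frozen at one good
value v. By feedback robustness, freezing leaves its Gamma average unchanged. -/
lemma Represents.exists_castSucc_of_pos (hlam : IsBaselineHazard (lam θ.α))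
    (hFR : FeedbackRobust D lam θ φ) {t : Fin T} (ht : 0 < t.val) {k : ℕ}
    (hk : t.val + 1 + k = T) {κ : Data T d × ℝ → ℝ} (h : Represents lam θ ω φ t.succ κ) :
    ∃ κ', Represents lam θ ω φ t.castSucc κ' ∧ ∀ᵐ w ∂(law lam θ ω),
      avg lam θ t k κ (w, tailSum lam θ t.val w) = κ' (w, tailSum lam θ t.val w) := by
  obtain ⟨F, -, hF⟩ := hFR t ht
  have := D.sigmaFinite_μX t
  have hA := measurable_avg hlam t k h.measurable
  have hB : Measurable fun z : Data T d × ℝ =>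
    avg lam θ t k κ (z.1, Real.exp (-z.1.2.2) * z.2) := by fun_prop
  set I : Data T d → Prop := fun w =>
    Integrable (fun r => avg lam θ t k κ (w, Real.exp (-w.2.2) * r)) (gm (k + 1)) with hI
  set J : Data T d → ℝ := fun w =>
    ∫ r, avg lam θ t k κ (w, Real.exp (-w.2.2) * r) ∂(gm (k + 1)) with hJ
  have hIm : MeasurableSet {w | I w} := measurableSet_integrable
    (f := fun (w : Data T d) r => avg lam θ t k κ (w, Real.exp (-w.2.2) * r)) hB.stronglyMeasurable
  have hJm : Measurable J := (StronglyMeasurable.integral_prod_right (f := fun (w : Data T d) r =>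
    avg lam θ t k κ (w, Real.exp (-w.2.2) * r)) hB.stronglyMeasurable).measurable
  have hX := measurable_setX (T := T) (d := d) t
  have h0 := h.ae_eq_avg hlam hk
  have h1 : ∀ᵐ w ∂D.dominating, I w ∧ J w
      = F (take (Nat.succ_le_succ t.isLt.le) w.1, take t.isLt.le w.2.1, w.2.2) := by
    filter_upwards [h0, hF] with w hw hw'
    exact ⟨hw.1, hw.2.symm.trans hw'⟩
  have h2 : ∀ᵐ w ∂D.dominating, ∀ᵐ v ∂(D.μX t), I (setX t w v) ∧ J (setX t w v) = J w := by
    filter_upwards [h1, ae_setX D ω t ht h1] with w hw hw'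
    filter_upwards [hw'] with v hv
    refine ⟨hv.1, hv.2.trans ?_⟩
    rw [hw.2, take_setX le_rfl]
    rfl
  -- The exchange of quantifiers is what yields a single v valid for almost every data point.
  rw [Measure.ae_ae_comm (p := fun w v => I (setX t w v) ∧ J (setX t w v) = J w)
    ((hX hIm).inter (measurableSet_eq_fun (hJm.comp hX) (hJm.comp measurable_fst)))] at h2
  -- A feedback density of mass one exists, so the measure of the regressor is not zero.
  have hne : (ae (D.μX t)).NeBot := by
    rw [ae_neBot]
    intro h0
    have := ω.lintegral_g t ht 0 0 0
    simp [h0] at this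
  obtain ⟨v, hv⟩ := h2.exists
  refine ⟨fun z => avg lam θ t k κ (setX t z.1 v, z.2), ?_⟩
  refine h.castSucc_of_avg hlam hk ?_ (fun r w w' h' => ?_) ?_ ?_
  · exact hA.comp ((measurable_fst.setX t measurable_const).prodMk measurable_snd)
  · exact avg_depOnObs t k h.depOnObs r _ _ (h'.setX le_rfl v)
  · filter_upwards [hv] with w hw
    exact hw.1
  · filter_upwards [hv, h0] with w hw hw0
    exact hw0.2.trans hw.2.symm

lemma Represents.zero_castSucc (hlam : IsBaselineHazard (lam θ.α))
    (hHR : HeterogeneityRobust D lam θ φ) {t : Fin T} (ht : t.val = 0) {k : ℕ}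
    (hk : t.val + 1 + k = T) {κ : Data T d × ℝ → ℝ} (h : Represents lam θ ω φ t.succ κ) :
    Represents lam θ ω φ t.castSucc (fun _ => 0) ∧ ∀ᵐ w ∂(law lam θ ω),
      avg lam θ t k κ (w, tailSum lam θ t.val w) = 0 := by
  have ht0 : t.castSucc = 0 := Fin.ext ht
  refine h.castSucc_of_avg hlam hk measurable_const (fun _ _ _ _ => rfl)
    (Eventually.of_forall fun w => by simp) ?_
  filter_upwards [hHR] with w hw
  rw [ht0, hw]
  simp

/-- The κ_s are chosen by recursion downwards from φ; heterogeneity robustness permits κ_0 to be the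
zero function exactly. -/
lemma exists_represents (hlam : IsBaselineHazard (lam θ.α))
    (hφ : Measurable fun q : (Fin (T + 1) → ℝ) × (Fin T → (Fin d → ℝ)) => φ q.1 q.2)
    (hint : Integrable (fun w => φ w.1 w.2.1) (law lam θ ω))
    (hHR : HeterogeneityRobust D lam θ φ) (hFR : FeedbackRobust D lam θ φ) :
    ∃ κ : Fin (T + 1) → Data T d × ℝ → ℝ, (∀ s, Represents lam θ ω φ s (κ s)) ∧
      (κ (Fin.last T) = fun z => φ z.1.1 z.1.2.1) ∧ (κ 0 = fun _ => 0) ∧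
      ∀ t : Fin T, ∀ᵐ w ∂(law lam θ ω), avg lam θ t (T - (t.val + 1)) (κ t.succ)
        (w, tailSum lam θ t.val w) = κ t.castSucc (w, tailSum lam θ t.val w) := by
  have step : ∀ (t : Fin T) (κ : {κ // Represents lam θ ω φ t.succ κ}),
      ∃ κ' : {κ // Represents lam θ ω φ t.castSucc κ}, (t.val = 0 → κ'.1 = fun _ => 0) ∧
        ∀ᵐ w ∂(law lam θ ω), avg lam θ t (T - (t.val + 1)) κ.1 (w, tailSum lam θ t.val w)
          = κ'.1 (w, tailSum lam θ t.val w) := by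
    rintro t ⟨κ, h⟩
    have hk : t.val + 1 + (T - (t.val + 1)) = T := by have := t.isLt; omega
    rcases Nat.eq_zero_or_pos t.val with ht | ht
    · obtain ⟨h1, h2⟩ := h.zero_castSucc hlam hHR ht hk
      exact ⟨⟨_, h1⟩, fun _ => rfl, h2⟩
    · obtain ⟨κ', h1, h2⟩ := h.exists_castSucc_of_pos hlam hFR ht hk
      exact ⟨⟨κ', h1⟩, fun h => absurd h ht.ne', h2⟩
  choose next hnext0 hnext using step
  set fam : ∀ s : Fin (T + 1), {κ // Represents lam θ ω φ s κ} := fun s =>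
    Fin.reverseInduction (motive := fun s => {κ // Represents lam θ ω φ s κ})
      ⟨_, represents_last hφ hint⟩ next s with hfam
  have hc : ∀ t : Fin T, fam t.castSucc = next t (fam t.succ) := fun t => by
    simp only [hfam, Fin.reverseInduction_castSucc]
  refine ⟨fun s => (fam s).1, fun s => (fam s).2, ?_, ?_, fun t => ?_⟩
  · simp only [hfam, Fin.reverseInduction_last]
  · have := hnext0 0 (fam (Fin.succ 0)) rfl
    rw [← hc] at this
    exact this
  · simp only
    rw [hc]
    exact hnext t _

end Law

/-! ### Necessity: increments and the telescoping sum -/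

section Basic
variable {lam : (Fin m → ℝ) → ℝ → ℝ} {θ : Param m d}

/-- The difference of `κ` after and `κ'` before a period, as a function of the statistic. -/
noncomputable def increment (lam : (Fin m → ℝ) → ℝ → ℝ) (θ : Param m d) (t : Fin T)
    (κ κ' : Data T d × ℝ → ℝ)
    (q : ℝ × (Fin (t.val + 1) → ℝ) × ℝ × (Fin (t.val + 1) → (Fin d → ℝ))) : ℝ :=
  κ (recover lam θ q) - κ' ((recover lam θ q).1,
    P lam θ (recover lam θ q : Data T d × ℝ).1.1 (recover lam θ q : Data T d × ℝ).1.2.1 t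
      + (recover lam θ q : Data T d × ℝ).2)

lemma measurable_increment (hlam : IsBaselineHazard (lam θ.α)) (t : Fin T)
    {κ κ' : Data T d × ℝ → ℝ} (hκ : Measurable κ) (hκ' : Measurable κ') :
    Measurable (increment lam θ t κ κ') := by
  have hr := measurable_recover (T := T) (d := d) hlam (k := t.val + 1)
  have hP : Measurable fun z : Data T d × ℝ => P lam θ z.1.1 z.1.2.1 t :=
    (measurable_P hlam t).comp measurable_fst
  have h2 : Measurable fun z : Data T d × ℝ => κ' (z.1, P lam θ z.1.1 z.1.2.1 t + z.2) := by
    fun_prop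
  exact (hκ.comp hr).sub (h2.comp hr)

lemma increment_statAt (hlam : IsBaselineHazard (lam θ.α)) (t : Fin T)
    {κ κ' : Data T d × ℝ → ℝ}
    (hκ : ∀ r, DepOnObs (t.val + 1) (t.val + 1) fun w => κ (w, r))
    (hκ' : ∀ r, DepOnObs t.val t.val fun w => κ' (w, r)) (w : Data T d)
    (hw : ∀ s : Fin T, s.val < t.val + 1 → 0 < w.1 s.succ) {r : ℝ} (hr : 0 ≤ r) :
    increment lam θ t κ κ' (statAt lam θ (Nat.succ_le_of_lt t.isLt) (Nat.succ_le_of_lt t.isLt) w r)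
      = κ (w, r) - κ' (w, P lam θ w.1 w.2.1 t + r) := by
  obtain ⟨h1, h2⟩ := recover_statAt hlam (Nat.succ_le_of_lt t.isLt) w hw hr
  rw [increment, ← h1.P_eq t le_rfl (Nat.lt_succ_self _)]
  refine congrArg₂ (· - ·) ?_ ?_
  · exact (congrArg (fun z => κ (_, z)) h2).trans (hκ r _ _ h1)
  · rw [h2]
    exact hκ' _ _ _ (h1.mono (Nat.le_succ _) (Nat.le_succ _))

/-- Moving the share at fixed tail sum r changes neither the earlier history nor P_t + R_{t+1} = r,
so the κ' part is constant under the average. -/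
lemma integral_increment_appendShare (hlam : IsBaselineHazard (lam θ.α)) (t : Fin T) (k : ℕ)
    {κ κ' : Data T d × ℝ → ℝ}
    (hκ : ∀ r, DepOnObs (t.val + 1) (t.val + 1) fun w => κ (w, r))
    (hκ' : ∀ r, DepOnObs t.val t.val fun w => κ' (w, r)) (w : Data T d)
    (hw : ∀ s : Fin T, 0 < w.1 s.succ) {r : ℝ} (hr : 0 < r)
    (hint : Integrable (fun b => κ (draw lam θ t w (b * r), (1 - b) * r)) (bt k)) :
    ∫ b, increment lam θ t κ κ' (appendShare (statAt lam θ t.isLt.le (Nat.succ_le_of_lt t.isLt) w r)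
      b) ∂(bt k) = avg lam θ t k κ (w, r) - κ' (w, r) := by
  have h : ∀ᵐ b ∂(bt k), increment lam θ t κ κ' (appendShare (statAt lam θ t.isLt.le
      (Nat.succ_le_of_lt t.isLt) w r) b)
      = κ (draw lam θ t w (b * r), (1 - b) * r) - κ' (w, r) := by
    filter_upwards [bt_ae_mem k] with b hb
    have hbr := mul_pos hb.1 hr
    rw [appendShare_statAt hlam t _ le_rfl w hr hb.1, increment_statAt hlam t hκ hκ' _ ?_
      (mul_nonneg (sub_nonneg.2 hb.2) hr.le), P_draw hlam t w hbr]
    · have e : b * r + (1 - b) * r = r := by ring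
      rw [e]
      exact congrArg _ (hκ' r _ _ (agree_draw le_rfl w (b * r)))
    · intro s _
      rcases eq_or_ne s t with rfl | hst
      · exact draw_pos hlam s w hbr
      · have : (draw lam θ t w (b * r)).1 s.succ = w.1 s.succ :=
          Function.update_of_ne (fun h => hst (Fin.succ_injective _ h)) _ _
        rw [this]
        exact hw s
  rw [integral_congr_ae h, integral_sub hint (integrable_const _), avg]
  simp

end Basic

section Law
variable [NeZero T] {D : Design T d} {lam : (Fin m → ℝ) → ℝ → ℝ} {θ : Param m d}
  {ω : Nuisance D} {φ : (Fin (T + 1) → ℝ) → (Fin T → (Fin d → ℝ)) → ℝ}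

lemma increment_stat (hlam : IsBaselineHazard (lam θ.α)) (t : Fin T)
    {κ κ' : Data T d × ℝ → ℝ} (hκ : Represents lam θ ω φ t.succ κ)
    (hκ' : Represents lam θ ω φ t.castSucc κ') {w : Data T d} (hw : ∀ s : Fin T, 0 < w.1 s.succ) :
    increment lam θ t κ κ' (stat lam θ (Nat.succ_le_of_lt t.isLt) (Nat.succ_le_of_lt t.isLt) w)
      = κ (w, tailSum lam θ (t.val + 1) w) - κ' (w, tailSum lam θ t.val w) := by
  rw [stat_eq_statAt, increment_statAt hlam t hκ.depOnObs hκ'.depOnObs w (fun s _ => hw s)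
    (tailSum_nonneg hlam _ w hw), ← tailSum_eq_add]

lemma integrable_increment (hlam : IsBaselineHazard (lam θ.α)) (t : Fin T)
    {κ κ' : Data T d × ℝ → ℝ} (hκ : Represents lam θ ω φ t.succ κ)
    (hκ' : Represents lam θ ω φ t.castSucc κ') :
    Integrable (fun w => increment lam θ t κ κ'
      (stat lam θ (Nat.succ_le_of_lt t.isLt) (Nat.succ_le_of_lt t.isLt) w)) (law lam θ ω) := by
  refine (hκ.integrable.sub hκ'.integrable).congr ?_
  filter_upwards [ae_law_pos hlam ω] with w hw
  exact (increment_stat hlam t hκ hκ' hw).symm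

lemma condExp_increment (hlam : IsBaselineHazard (lam θ.α)) (t : Fin T)
    {κ κ' : Data T d × ℝ → ℝ} (hκ : Represents lam θ ω φ t.succ κ)
    (hκ' : Represents lam θ ω φ t.castSucc κ')
    (h : ∀ᵐ w ∂(law lam θ ω), avg lam θ t (T - (t.val + 1)) κ (w, tailSum lam θ t.val w)
      = κ' (w, tailSum lam θ t.val w)) :
    (law lam θ ω)[fun w => increment lam θ t κ κ'
        (stat lam θ (Nat.succ_le_of_lt t.isLt) (Nat.succ_le_of_lt t.isLt) w) |
      MeasurableSpace.comap (stat lam θ t.isLt.le (Nat.succ_le_of_lt t.isLt)) inferInstance]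
      =ᵐ[law lam θ ω] 0 := by
  have hk : t.val + 1 + (T - (t.val + 1)) = T := by have := t.isLt; omega
  have hc := condExp_stat hlam ω t hk (Nat.succ_le_of_lt t.isLt) le_rfl
    (measurable_increment hlam t hκ.measurable hκ'.measurable) (integrable_increment hlam t hκ hκ')
  filter_upwards [hc, h, ae_law_pos hlam ω,
    (integrable_avg hlam ω t hk hκ.measurable (fun r => (hκ.depOnObs r).depOn)
      hκ.integrable).2] with w h1 h2 h3 h4
  rw [← h1, stat_eq_statAt, integral_increment_appendShare hlam t _ hκ.depOnObs hκ'.depOnObs w h3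
    (tailSum_pos hlam t w h3) h4, h2, sub_self]
  rfl

/-- There are T - 1 increments rather than T because the last share is identically one: averaging
over it does nothing, and κ_{T-1}(R_{T-1}) is already φ. -/
lemma exists_decomposition (hT : 2 ≤ T) (hlam : IsBaselineHazard (lam θ.α))
    (hφ : Measurable fun q : (Fin (T + 1) → ℝ) × (Fin T → (Fin d → ℝ)) => φ q.1 q.2)
    (hint : Integrable (fun w => φ w.1 w.2.1) (law lam θ ω))
    (hHR : HeterogeneityRobust D lam θ φ) (hFR : FeedbackRobust D lam θ φ) :
    ∃ ψ : (t : Fin (T - 1)) →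
        ℝ × (Fin (t.val + 1) → ℝ) × ℝ × (Fin (t.val + 1) → (Fin d → ℝ)) → ℝ,
      (∀ t, Measurable (ψ t)) ∧
      (∀ t : Fin (T - 1), Integrable
        (fun w => ψ t (stat lam θ (val_succ_le t)
          (val_succ_le t) w)) (law lam θ ω)) ∧
      (∀ᵐ w ∂(law lam θ ω), φ w.1 w.2.1 =
        ∑ t : Fin (T - 1), ψ t (stat lam θ (val_succ_le t)
          (val_succ_le t) w)) ∧
      (∀ t : Fin (T - 1),
        (law lam θ ω)[fun w => ψ t (stat lam θ (val_succ_le t)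
            (val_succ_le t) w) |
          MeasurableSpace.comap
            (stat lam θ (val_le t) (val_succ_le t))
            inferInstance] =ᵐ[law lam θ ω] 0) := by
  obtain ⟨κ, hκ, hlast, hzero, havg⟩ := exists_represents hlam hφ hint hHR hFR
  have hidx : ∀ i : Fin (T - 1), i.val < T := fun i => by have := i.isLt; omega
  refine ⟨fun i => increment lam θ (⟨i.val, hidx i⟩ : Fin T) (κ (Fin.succ ⟨i.val, hidx i⟩))
    (κ (Fin.castSucc ⟨i.val, hidx i⟩)), fun i => ?_, fun i => ?_, ?_, fun i => ?_⟩
  · exact measurable_increment hlam _ (hκ _).measurable (hκ _).measurable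
  · exact integrable_increment hlam ⟨i.val, hidx i⟩ (hκ _) (hκ _)
  · have hlt : T - 1 < T := by omega
    filter_upwards [ae_law_pos hlam ω, havg ⟨T - 1, hlt⟩] with w hw h
    -- G extends n ↦ κ_n(R_n) from `Fin (T + 1)` to `ℕ`, so that the sum telescopes over a range.
    obtain ⟨G, hG⟩ : ∃ G : ℕ → ℝ, ∀ n (hn : n < T + 1), G n = κ ⟨n, hn⟩ (w, tailSum lam θ n w) :=
      ⟨fun n => if hn : n < T + 1 then κ ⟨n, hn⟩ (w, tailSum lam θ n w) else 0,
        fun n hn => dif_pos hn⟩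
    have hterm : ∀ i : Fin (T - 1), increment lam θ (⟨i.val, hidx i⟩ : Fin T)
        (κ (Fin.succ ⟨i.val, hidx i⟩)) (κ (Fin.castSucc ⟨i.val, hidx i⟩))
        (stat lam θ (val_succ_le i) (val_succ_le i) w)
        = G (i.val + 1) - G i.val := by
      intro i
      have hi := hidx i
      rw [hG _ (by omega), hG _ (by omega)]
      exact increment_stat hlam ⟨i.val, hidx i⟩ (hκ _) (hκ _) hw
    rw [Finset.sum_congr rfl fun i _ => hterm i,
      Fin.sum_univ_eq_sum_range (fun j => G (j + 1) - G j), Finset.sum_range_sub,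
      hG _ (by omega), hG _ (by omega)]
    have h0 : κ ⟨0, by omega⟩ = fun _ => 0 := hzero
    have hs : (⟨T - 1, hlt⟩ : Fin T).succ = Fin.last T := Fin.ext (by simp; omega)
    have hk : T - (T - 1 + 1) = 0 := by omega
    have hR : tailSum lam θ (T - 1) w = P lam θ w.1 w.2.1 ⟨T - 1, hlt⟩ := by
      rw [tailSum_eq_add ⟨T - 1, hlt⟩, tailSum_of_le (by simp only; omega), add_zero]
    rw [h0, sub_zero]
    refine Eq.trans ?_ h
    -- Here `bt 0` is the point mass at 1 and R_{T-1} = P_{T-1}, so the average is φ after redrawing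
    -- the observed residual.
    simp only [hs, hlast, hk, avg, bt, integral_dirac, one_mul]
    rw [hR, draw_P hlam _ w (hw _)]
  · exact condExp_increment hlam ⟨i.val, hidx i⟩ (hκ _) (hκ _) (havg _)

/-- Each surviving term is a Gamma average of a function of the history before t and of the tail
sum, and depends on nothing later. -/
lemma feedbackRobust_of_ae_eq_sum (hlam : IsBaselineHazard (lam θ.α))
    {ψ : (t : Fin (T - 1)) →
      ℝ × (Fin (t.val + 1) → ℝ) × ℝ × (Fin (t.val + 1) → (Fin d → ℝ)) → ℝ}
    (hψ : ∀ i, Measurable (ψ i))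
    (h : ∀ s : Fin (T + 1), ∀ᵐ w ∂D.dominating, tailIntegral lam θ φ s w.1 w.2.1 w.2.2
      = ∑ i : Fin (T - 1) with i.val < s.val,
        ∫ r, psiAt lam θ ψ i s.val (w, Real.exp (-w.2.2) * r) ∂(gm (T - s.val))) :
    FeedbackRobust D lam θ φ := by
  intro t _
  have hJ : Measurable fun w : Data T d => ∑ i : Fin (T - 1) with i.val < t.val,
      ∫ r, psiAt lam θ ψ i t.val (w, Real.exp (-w.2.2) * r) ∂(gm (T - t.val)) := by
    refine Finset.measurable_fun_sum _ fun i _ => ?_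
    refine (StronglyMeasurable.integral_prod_right (f := fun (w : Data T d) r =>
      psiAt lam θ ψ i t.val (w, Real.exp (-w.2.2) * r)) ?_).measurable
    exact ((measurable_psiAt hlam hψ i _).comp (f := fun z : Data T d × ℝ =>
      (z.1, Real.exp (-z.1.2.2) * z.2)) (by fun_prop)).stronglyMeasurable
  obtain ⟨F, hF, hFe⟩ := exists_measurable_take t.isLt.le hJ fun w w' hw ha =>
    Finset.sum_congr rfl fun i hi => by
      rw [ha]
      exact integral_congr_ae (Eventually.of_forall fun r =>
        psiAt_dep i (Finset.mem_filter.1 hi).2 _ w w' hw)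
  refine ⟨F, hF, ?_⟩
  filter_upwards [h t.castSucc] with w hw
  exact hw.trans (hFe w)

end Law

end MPH

/-! ### The equivalence -/

theorem lemma1 {T m d : ℕ} [NeZero T] (hT : 2 ≤ T) (D : MPH.Design T d)
    (lam : (Fin m → ℝ) → ℝ → ℝ) (θ : MPH.Param m d) (hlam : MPH.IsBaselineHazard (lam θ.α))
    (ω : MPH.Nuisance D)
    (φ : (Fin (T + 1) → ℝ) → (Fin T → (Fin d → ℝ)) → ℝ)
    (hφ : Measurable (fun q : (Fin (T + 1) → ℝ) × (Fin T → (Fin d → ℝ)) => φ q.1 q.2))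
    (hφ_int : Integrable (fun w => φ w.1 w.2.1) (MPH.law lam θ ω)) :
    (MPH.HeterogeneityRobust D lam θ φ ∧ MPH.FeedbackRobust D lam θ φ) ↔
      ∃ ψ : (t : Fin (T - 1)) →
          ℝ × (Fin (t.val + 1) → ℝ) × ℝ × (Fin (t.val + 1) → (Fin d → ℝ)) → ℝ,
        (∀ t, Measurable (ψ t)) ∧
        (∀ t : Fin (T - 1), Integrable
          (fun w => ψ t (MPH.stat lam θ (show t.val + 1 ≤ T by omega)
            (show t.val + 1 ≤ T by omega) w)) (MPH.law lam θ ω)) ∧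
        (∀ᵐ w ∂(MPH.law lam θ ω), φ w.1 w.2.1 =
          ∑ t : Fin (T - 1), ψ t (MPH.stat lam θ (show t.val + 1 ≤ T by omega)
            (show t.val + 1 ≤ T by omega) w)) ∧
        (∀ t : Fin (T - 1),
          (MPH.law lam θ ω)[fun w => ψ t (MPH.stat lam θ (show t.val + 1 ≤ T by omega)
              (show t.val + 1 ≤ T by omega) w) |
            MeasurableSpace.comap
              (MPH.stat lam θ (show t.val ≤ T by omega) (show t.val + 1 ≤ T by omega))
              inferInstance] =ᵐ[MPH.law lam θ ω] 0) := by
  constructor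
  · rintro ⟨hHR, hFR⟩
    exact MPH.exists_decomposition hT hlam hφ hφ_int hHR hFR
  · rintro ⟨ψ, hψ, hint, hsum, hce⟩
    have h := MPH.ae_tailIntegral_eq_sum hlam ω hψ hint hsum hce
    refine ⟨?_, MPH.feedbackRobust_of_ae_eq_sum hlam hψ h⟩
    -- At s = 0 no index satisfies i < s, so the sum is empty and the full integral vanishes.
    filter_upwards [h 0] with w hw
    simpa using hw
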